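/- Let $G$ be a connected, locally finite, bipartite graph (multiple edges allowed) embedded in the plane, such that every face is a bounded topological disc (there is no unbounded face). Every edge joins a white to a black vertex. **Train-tracks.** A train-track is a maximal path that crosses edges of $G$ at their midpoints and turns alternately around the white end and around the black end of the edges that it crosses. Train-tracks are oriented consistently: they turn counterclockwise around white and clockwise around black vertices. The pieces between two consecutive crossings are called strands. Each edge is crossed by two strand continuations, whose train-tracks $\vec t_1,\vec t_2$ (possibly equal) are labelled so that their directions at the crossing form a positive basis of the plane. $G$ is *minimal* if no train-track intersects itself and there is no parallel bigon, i.e. no two distinct train-tracks and distinct edges $x\ne y$ such that both train-tracks lead, in their orientation, from $x$ to $y$. **Immersions.** Let $Z_G$ be the set of maps $\alpha$ from the set of (consistently oriented) train-tracks to $\mathbb R/2\pi\mathbb Z$. An isoradial immersion of $G$ is a pair $(\alpha,k)$ with $\alpha\in Z_G$ and $k=(k_e)_e$ an integer for each edge $e$. Its rhombus angle at $e$ is $\tilde\theta_e=\theta_e+2\pi k_e$, where $\theta_e\in[0,2\pi)$ lifts $\alpha(\vec t_2)-\alpha(\vec t_1)$, and its dual rhombus angle is $\pi-\tilde\theta_e$.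 It is flat if, with multiplicity, the rhombus angles of the edges at each vertex sum to $2\pi$, and the dual rhombus angles of the edges bounding each face sum to $2\pi$. A *minimal immersion* is a flat isoradial immersion with $k\equiv0$ and all rhombus angles in $(0,2\pi)$. **The space $Y_G$.** For a vertex $v$ let $T(v)$ be the cyclically (counterclockwise) ordered set of strands that turn around $v$; for a face $f$ let $T^\bullet(f)$ and $T^\circ(f)$ be the cyclically ordered sets of strands in $f$ that turn around a black, respectively white, boundary vertex of $f$. A map $\alpha\in Z_G$ is evaluated on a strand through its train-track. On a finite cyclically ordered set $x_0,\dots,x_{n-1}$ it is called monotone if its values have real lifts $a_0\le a_1\le\dots\le a_{n-1}\le a_0+2\pi$. $Y_G\subset Z_G$ is the set of $\alpha$ whose restriction to $T(v)$ is monotone, injective and non-constant for all vertices $v$, and whose restrictions to $T^\bullet(f)$ and $T^\circ(f)$ are monotone and non-constant for all faces $f$. **The space $X_G$.** Two distinct train-tracks are parallel if they intersect infinitely many times in the same direction, or if they are disjoint and cross some topological disc in the same direction; they are anti-parallel if they become parallel when one of them is reversed. Three pairwise non-parallel train-tracks are in the global cyclic order $[\vec t_1,\vec t_2,\vec t_3]$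 if their outgoing points on the boundary of a large disc, outside of which their outgoing ends are pairwise disjoint, are in counterclockwise order. $X_G\subset Z_G$ is the set of $\alpha$ that are monotone, i.e. $[\vec t_1,\vec t_2,\vec t_3]$ implies that $\alpha(\vec t_1),\alpha(\vec t_2),\alpha(\vec t_3)$ are in (weak) counterclockwise cyclic order, and that map any two distinct intersecting or anti-parallel train-tracks to distinct angles. **Theorem.** (1) $G$ admits a minimal immersion if and only if $G$ is minimal. (2) Whether or not $G$ is minimal, the minimal immersions of $G$ are exactly the pairs $(\alpha,0)$ with $\alpha\in Y_G$. (3) If $G$ is minimal, then $X_G$ is non-empty and $X_G\subset Y_G$. -/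

import Mathlib

open scoped Real

noncomputable section

/-- A bipartite graph embedded in the plane, locally finite and all of whose faces are bounded
topological discs (so there is no unbounded face), given by its combinatorial embedding.

`E` is the set of edges (multiple edges are allowed).  Every edge has one white and one black
end; `rotW e` is the edge that follows `e` in counterclockwise order around the white end of `e`,
and `rotB e` the one that follows `e` in counterclockwise order around its black end.
White (black) vertices are the orbits of `rotW` (`rotB`).  Going along `e` from white to black and
then keeping the face on the left, the next edges met are `rotB⁻¹ e`, travelled from black to
white, and `rotW⁻¹ (rotB⁻¹ e)`, travelled from white to black again.  So the faces are the orbits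
of `rotW⁻¹ * rotB⁻¹`: the orbit of `e` is the face to the left of `e` oriented from white to black,
and the face to the right of `e` is the orbit of `rotB e`.

Gluing a disc on each face produces a connected surface without boundary; it is
the plane if and only if it is not compact and its first homology vanishes, which are the last
two fields. -/
structure BipartitePlaneGraph (E : Type*) where
  /-- counterclockwise rotation around white vertices -/
  rotW : Equiv.Perm E
  /-- counterclockwise rotation around black vertices -/
  rotB : Equiv.Perm E
  /-- white vertices have finite degree -/
  finite_white : ∀ e, e ∈ Function.periodicPts rotW
  /-- black vertices have finite degree -/
  finite_black : ∀ e, e ∈ Function.periodicPts rotB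
  /-- faces have finite degree -/
  finite_face : ∀ e, e ∈ Function.periodicPts (rotW⁻¹ * rotB⁻¹ : Equiv.Perm E)
  /-- the graph is connected -/
  connected : MulAction.IsPretransitive (Subgroup.closure {rotW, rotB}) E
  /-- the surface is not compact -/
  infinite : Infinite E
  /-- every finite 1-cycle `c` (edges oriented from white to black) is the boundary of a finite
  2-chain `n` (a function on faces, written as a function of the edge to the left of which the
  face lies) -/
  planar : ∀ c : E → ℤ, (Function.support c).Finite →
    (∀ e, ∑ i ∈ Finset.range (Function.minimalPeriod rotW e), c ((rotW ^ i) e) = 0) →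
    (∀ e, ∑ i ∈ Finset.range (Function.minimalPeriod rotB e), c ((rotB ^ i) e) = 0) →
    ∃ n : E → ℤ, (Function.support n).Finite ∧ (∀ e, n (rotW⁻¹ (rotB⁻¹ e)) = n e) ∧
      ∀ e, c e = n e - n (rotB e)

/-- The strands of train-tracks, i.e. the edges of the graph of train-tracks `G^T`, whose vertices
are (the midpoints of) the edges of `G`.  With the consistent orientation, `white e` starts at `e`
and turns counterclockwise around the white end of `e` up to the next edge `rotW e`; `black e`
starts at `e` and turns clockwise around the black end of `e` up to the edge `rotB⁻¹ e`.
Both lie in the face to the left of `e`. -/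
inductive Strand (E : Type*) where
  | white (e : E) : Strand E
  | black (e : E) : Strand E

/-- The edge of `G` at which a strand starts. -/
def Strand.source {E : Type*} : Strand E → E
  | .white e => e
  | .black e => e

namespace BipartitePlaneGraph

variable {E : Type*} (G : BipartitePlaneGraph E)

/-- The permutation whose orbits are the faces. -/
def rotF : Equiv.Perm E := G.rotW⁻¹ * G.rotB⁻¹

/-- White vertices. -/
def WhiteVertex : Type _ := Quotient (Equiv.Perm.SameCycle.setoid G.rotW)

/-- Black vertices. -/
def BlackVertex : Type _ := Quotient (Equiv.Perm.SameCycle.setoid G.rotB)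

/-- Faces. -/
def Face : Type _ := Quotient (Equiv.Perm.SameCycle.setoid G.rotF)

/-! ### Train-tracks -/

/-- The strand that follows a given strand on its train-track: a train-track crosses the edge it
arrives at, so it turns alternately around white and black vertices. -/
def next : Equiv.Perm (Strand E) where
  toFun
    | .white e => .black (G.rotW e)
    | .black e => .white (G.rotB⁻¹ e)
  invFun
    | .white e => .black (G.rotB e)
    | .black e => .white (G.rotW⁻¹ e)
  left_inv s := by cases s <;> simp
  right_inv s := by cases s <;> simp

/-- The set of train-tracks, with their consistent orientation. -/
def TrainTrack : Type _ := Quotient (Equiv.Perm.SameCycle.setoid G.next)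

/-- The train-track of a strand. -/
def track (s : Strand E) : G.TrainTrack := Quotient.mk _ s

/-- The train-track `t` crosses the edge `e`. -/
def Crosses (t : G.TrainTrack) (e : E) : Prop := ∃ s : Strand E, s.source = e ∧ G.track s = t

/-- The train-track `t` leads from the edge `e` to the edge `e'`, in its orientation. -/
def Leads (t : G.TrainTrack) (e e' : E) : Prop :=
  ∃ s : Strand E, G.track s = t ∧ s.source = e ∧ ∃ n : ℕ, ((G.next ^ n) s).source = e'

/-- Some train-track intersects itself: the two strands that start at some edge belong to the same
train-track. -/
def HasSelfIntersection : Prop := ∃ e : E, G.track (.white e) = G.track (.black e)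

/-- A parallel bigon: two train-tracks that intersect at two points and are both
oriented from the first point to the second. -/
def HasParallelBigon : Prop :=
  ∃ (t₁ t₂ : G.TrainTrack) (x y : E), t₁ ≠ t₂ ∧ x ≠ y ∧ G.Leads t₁ x y ∧ G.Leads t₂ x y

/-- Minimal graphs. -/
def IsMinimal : Prop := ¬ G.HasSelfIntersection ∧ ¬ G.HasParallelBigon

/-! ### Isoradial immersions -/

/-- The representative in `[0, 2π)` of an angle. -/
def angleLift (θ : Real.Angle) : ℝ := toIcoMod Real.two_pi_pos 0 θ.toReal

/-- The rhombus angle of `e`, for an angle map `α`.  Of the two train-tracks crossing `e`, the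
first in the positive orientation of the plane is the one going from the white to the black side
of `e` (whose next strand is `black e`), the second is the one going from the
black to the white side (whose next strand is `white e`). -/
def rhombusAngle (α : G.TrainTrack → Real.Angle) (e : E) : ℝ :=
  angleLift (α (G.track (.white e)) - α (G.track (.black e)))

/-- An isoradial immersion: an angle map (an element of `Z_G`, restricted to consistently oriented
train-tracks) and an integer for each edge. -/
@[ext] structure IsoradialImmersion where
  /-- the train-track angles -/
  α : G.TrainTrack → Real.Angle
  /-- the integers that determine the lifts of the rhombus angles -/
  k : E → ℤ

variable {G} in
/-- The lifted rhombus angle of the generalized rhombus of `e`.  The lifted dual rhombus angle is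
`π` minus this one. -/
def IsoradialImmersion.angle (I : G.IsoradialImmersion) (e : E) : ℝ :=
  G.rhombusAngle I.α e + 2 * π * I.k e

variable {G} in
/-- All cone angles, at white vertices, at black vertices and at faces, are equal to `2π`.
The boundary of the face of `e` consists of the edges `rotF ^ i e` and
`rotB⁻¹ (rotF ^ i e)`, with multiplicity. -/
def IsoradialImmersion.IsFlat (I : G.IsoradialImmersion) : Prop :=
  (∀ e, ∑ i ∈ Finset.range (Function.minimalPeriod G.rotW e), I.angle ((G.rotW ^ i) e) = 2 * π) ∧
  (∀ e, ∑ i ∈ Finset.range (Function.minimalPeriod G.rotB e), I.angle ((G.rotB ^ i) e) = 2 * π) ∧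
  (∀ e, ∑ i ∈ Finset.range (Function.minimalPeriod G.rotF e),
    ((π - I.angle ((G.rotF ^ i) e)) + (π - I.angle (G.rotB⁻¹ ((G.rotF ^ i) e)))) = 2 * π)

variable {G} in
/-- Minimal immersions: flat isoradial immersions with `k` identically zero and
all rhombus angles in `(0, 2π)`. -/
def IsoradialImmersion.IsMinimal (I : G.IsoradialImmersion) : Prop :=
  I.IsFlat ∧ (∀ e, I.k e = 0) ∧ ∀ e, I.angle e ∈ Set.Ioo 0 (2 * π)

/-! ### The space `Y_G` -/

/-- The restriction of `f` to the orbit of `x` under `p`, cyclically ordered by `p`, is (weakly)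
monotone as a map to `ℝ / 2πℤ`: it has a nondecreasing lift to `ℝ` that increases by `2π` when
going once around the orbit.  Equivalently, the values on `x, p x, …, p ^ (n - 1) x`, where
`n` is the size of the orbit, lift to `a₀ ≤ a₁ ≤ … ≤ aₙ₋₁ ≤ a₀ + 2π`. -/
def CyclicMonotone (p : Equiv.Perm E) (f : E → Real.Angle) (x : E) : Prop :=
  ∃ l : ℤ → ℝ, Monotone l ∧ (∀ i : ℤ, (l i : Real.Angle) = f ((p ^ i) x)) ∧
    ∀ i : ℤ, l (i + Function.minimalPeriod p x) = l i + 2 * π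

/-- The restriction of `f` to the orbit of `x` is injective. -/
def CyclicInjective (p : Equiv.Perm E) (f : E → Real.Angle) (x : E) : Prop :=
  Set.InjOn f {y | p.SameCycle x y}

/-- The restriction of `f` to the orbit of `x` is not constant. -/
def CyclicNonconstant (p : Equiv.Perm E) (f : E → Real.Angle) (x : E) : Prop :=
  ∃ y z, p.SameCycle x y ∧ p.SameCycle x z ∧ f y ≠ f z

/-- The space `Y_G`.  The strands around the white (black) end of `e` are, counterclockwise,
the `white (rotW ^ i e)` (the `black (rotB ^ i e)`).  The strands of the face of `e` that turn
around a white (black) boundary vertex are, counterclockwise around the face, the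
`white (rotF ^ i e)` (the `black (rotF ^ i e)`). -/
def Y : Set (G.TrainTrack → Real.Angle) :=
  {α | ∀ e,
    (CyclicMonotone G.rotW (fun x => α (G.track (.white x))) e ∧
      CyclicInjective G.rotW (fun x => α (G.track (.white x))) e ∧
      CyclicNonconstant G.rotW (fun x => α (G.track (.white x))) e) ∧
    (CyclicMonotone G.rotB (fun x => α (G.track (.black x))) e ∧
      CyclicInjective G.rotB (fun x => α (G.track (.black x))) e ∧
      CyclicNonconstant G.rotB (fun x => α (G.track (.black x))) e) ∧
    (CyclicMonotone G.rotF (fun x => α (G.track (.black x))) e ∧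
      CyclicNonconstant G.rotF (fun x => α (G.track (.black x))) e) ∧
    (CyclicMonotone G.rotF (fun x => α (G.track (.white x))) e ∧
      CyclicNonconstant G.rotF (fun x => α (G.track (.white x))) e)}

/-! ### The global cyclic order and the space `X_G` -/

/-- The faces of the graph of train-tracks: they correspond to the vertices and faces of `G`. -/
def Region : Type _ := (G.WhiteVertex ⊕ G.BlackVertex) ⊕ G.Face

/-- The region to the left of a strand. -/
def left : Strand E → G.Region
  | .white e => Sum.inl (Sum.inl (Quotient.mk _ e))
  | .black e => Sum.inr (Quotient.mk _ e)

/-- The region to the right of a strand. -/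
def right : Strand E → G.Region
  | .white e => Sum.inr (Quotient.mk _ e)
  | .black e => Sum.inl (Sum.inr (Quotient.mk _ e))

/-- The two (distinct) train-tracks intersect. -/
def Intersect (t₁ t₂ : G.TrainTrack) : Prop := t₁ ≠ t₂ ∧ ∃ e, G.Crosses t₁ e ∧ G.Crosses t₂ e

/-- The two train-tracks are distinct and do not intersect. -/
def AreDisjoint (t₁ t₂ : G.TrainTrack) : Prop := t₁ ≠ t₂ ∧ ∀ e, ¬ (G.Crosses t₁ e ∧ G.Crosses t₂ e)

/-- The regions `x` and `y` can be joined by a path that crosses neither `t₁` nor `t₂`. -/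
def Joined (t₁ t₂ : G.TrainTrack) : G.Region → G.Region → Prop :=
  Relation.ReflTransGen fun x y => ∃ s : Strand E, G.track s ≠ t₁ ∧ G.track s ≠ t₂ ∧
    ((x = G.left s ∧ y = G.right s) ∨ (x = G.right s ∧ y = G.left s))

/-- Parallel train-tracks: they intersect infinitely many times in the same direction, or they are
disjoint and cross some topological disc in the same direction.  Such a disc can be taken to be a
thin neighbourhood of an arc from one train-track to the other, which then
leaves one of them on its right and reaches the other on its left. -/
def Parallel (t₁ t₂ : G.TrainTrack) : Prop :=
  (t₁ ≠ t₂ ∧ ∃ X : Set E, X.Infinite ∧ (∀ e ∈ X, G.Crosses t₁ e ∧ G.Crosses t₂ e) ∧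
    ∀ e ∈ X, ∀ e' ∈ X, (G.Leads t₁ e e' ↔ G.Leads t₂ e e')) ∨
  (G.AreDisjoint t₁ t₂ ∧ ∃ s₁ s₂, G.track s₁ = t₁ ∧ G.track s₂ = t₂ ∧
    (G.Joined t₁ t₂ (G.right s₁) (G.left s₂) ∨ G.Joined t₁ t₂ (G.left s₁) (G.right s₂)))

/-- Anti-parallel train-tracks: they become parallel when the orientation of one of them is
reversed. -/
def AntiParallel (t₁ t₂ : G.TrainTrack) : Prop :=
  (t₁ ≠ t₂ ∧ ∃ X : Set E, X.Infinite ∧ (∀ e ∈ X, G.Crosses t₁ e ∧ G.Crosses t₂ e) ∧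
    ∀ e ∈ X, ∀ e' ∈ X, (G.Leads t₁ e e' ↔ G.Leads t₂ e' e)) ∨
  (G.AreDisjoint t₁ t₂ ∧ ∃ s₁ s₂, G.track s₁ = t₁ ∧ G.track s₂ = t₂ ∧
    (G.Joined t₁ t₂ (G.right s₁) (G.right s₂) ∨ G.Joined t₁ t₂ (G.left s₁) (G.left s₂)))

/-- The part of a train-track that starts with the strand `s`. -/
def ray (s : Strand E) : Set (Strand E) := Set.range fun n : ℕ => (G.next ^ n) s

/-- The outgoing points of `t₁, t₂, t₃` on the boundary of a large disc `B` are in counterclockwise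
order.  That is, outside `B` the outgoing end of `t₃` runs inside the sector `A` that is
bounded by the outgoing end of `t₂`, the boundary arc of `B` that leads counterclockwise from the
outgoing point of `t₂` to that of `t₁`, and the outgoing end of `t₁`.  So `A` is a set of regions
that lies to the left of the outgoing end of `t₂` and to the right of that of `t₁`, that
has only finitely many other boundary strands, and that contains the outgoing end of `t₃`. -/
def OutgoingOrder (t₁ t₂ t₃ : G.TrainTrack) : Prop :=
  ∃ (s₁ s₂ s₃ : Strand E) (A : Set G.Region),
    G.track s₁ = t₁ ∧ G.track s₂ = t₂ ∧ G.track s₃ = t₃ ∧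
    (∀ s ∈ G.ray s₁, G.left s ∉ A ∧ G.right s ∈ A) ∧
    (∀ s ∈ G.ray s₂, G.left s ∈ A ∧ G.right s ∉ A) ∧
    (∀ s ∈ G.ray s₃, G.left s ∈ A ∧ G.right s ∈ A) ∧
    {s | s ∉ G.ray s₁ ∧ s ∉ G.ray s₂ ∧ ¬ (G.left s ∈ A ↔ G.right s ∈ A)}.Finite

/-- The global cyclic order, a partial cyclic order on train-tracks. -/
def GlobalOrder (t₁ t₂ t₃ : G.TrainTrack) : Prop :=
  ¬ G.Parallel t₁ t₂ ∧ ¬ G.Parallel t₂ t₃ ∧ ¬ G.Parallel t₁ t₃ ∧ G.OutgoingOrder t₁ t₂ t₃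

/-- The space `X_G` of (weakly) monotone maps that send pairs of intersecting or anti-parallel
train-tracks to distinct angles. -/
def X : Set (G.TrainTrack → Real.Angle) :=
  {α | (∀ t₁ t₂ t₃, G.GlobalOrder t₁ t₂ t₃ → btw (α t₁) (α t₂) (α t₃)) ∧
    ∀ t₁ t₂, G.Intersect t₁ t₂ ∨ G.AntiParallel t₁ t₂ → α t₁ ≠ α t₂}

end BipartitePlaneGraph

end

/-! Part (2) is local. The rhombus angles around a vertex are the increments in `[0, 2π)` of the
angle map along consecutive strands, and the two dual angles of consecutive edges of a face add up
to an increment along the strands of that face. A cyclic sequence is monotone and non-constant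
exactly when its increments sum to `2π` (`sum_increment`, `cyclicMonotone_of_sum`), and at vertices
positivity of the increments is injectivity. This gives `mem_Y_iff`.

Part (3) is plane topology in homological form. A closed loop made of pieces of train-tracks, and
perhaps a chord across a region, is a finite cocycle on strands and has a finitely supported
potential, its winding number. A curve that does not cross the loop keeps the same value on its
left, and this value is zero if the curve runs to infinity. The absence of bigons forbids the
relevant crossings. So there are no closed train-tracks (`Minimal.go_ne_self`), train-tracks that
leave a region on the same side do not meet later (`Minimal.not_cross`), and two of them cannot
visit a region in interlaced order (`Minimal.not_abab_aux`). The surface has one end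
(`const_off_finite`), so the forward ends of the train-tracks are cyclically ordered. There are
countably many of them, hence they embed monotonically into the circle (`Minimal.exists_monotone`),
and `X` is non-empty. At a vertex or face, the local order of the strands is the global order of
their ends (`Fan.order`), and strands of different tracks have different angles (`ne_of_mem_X`); the
interlacing result upgrades this to monotonicity (`cyclicMonotone_of_btw`), so `X` is contained in
`Y`.

The remaining implication of (1) is a discrete Gauss-Bonnet argument. A shortest parallel bigon
encloses a finite non-empty set of regions. By flatness, `2π` times (strands minus crossings minus
regions) is a sum of local terms (`sum_excess`), which vanish except at the two vertices of the
bigon, where they exceed `-π`. The total exceeds `-2π`, whereas Euler's inequality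
`ncard_strandsOf_lt` bounds it above by `-2π`. -/

/-! ### Abstract curve systems and potentials -/

/-- A system of oriented curves with transversal double points on an oriented surface, given by its
strands `S`, the corners `C` at the crossings, and the regions `R`.  At each crossing two strands
start, exchanged by `opp`; if `pos s` then `opp s` is the one to the right of `s`.  The corners to the
left and to the right of `s` are `lo s`, `ro s` at its start and `li s`, `ri s` at its end.
Integral cocycles have potentials, and finite ones have finite potentials. -/
structure CurveSystem (S C R : Type*) where
  next : Equiv.Perm S
  opp : S → S
  pos : S → Prop
  lo : S → C
  li : S → C
  ro : S → C
  ri : S → C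
  reg : C → R
  opp_opp : ∀ s, opp (opp s) = s
  pos_opp : ∀ s, pos (opp s) ↔ ¬ pos s
  ro_eq : ∀ s, pos s → ro s = lo (opp s)
  lo_eq : ∀ s, pos s → lo s = li (next⁻¹ (opp s))
  ro_opp : ∀ s, pos s → ro (opp s) = ri (next⁻¹ s)
  li_eq : ∀ s, pos s → li (next⁻¹ s) = ri (next⁻¹ (opp s))
  reg_li : ∀ s, reg (li s) = reg (lo s)
  reg_ri : ∀ s, reg (ri s) = reg (ro s)
  finite_left : ∀ r, {s | reg (lo s) = r}.Finite
  finite_right : ∀ r, {s | reg (ro s) = r}.Finite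
  connected : ∀ P : S → Prop, (∀ s, P s ↔ P (next s)) → (∀ s, P s → P (opp s)) → ∀ s t, P s → P t
  const : ∀ σ : R → ℤ, (∀ s, σ (reg (lo s)) = σ (reg (ro s))) → ∀ r r', σ r = σ r'
  potential : ∀ f : S → ℤ, (∀ s, f s + f (opp s) = f (next⁻¹ s) + f (next⁻¹ (opp s))) →
    ∃ σ : R → ℤ, ∀ s, σ (reg (lo s)) - σ (reg (ro s)) = f s
  finite_potential : ∀ f : S → ℤ, (Function.support f).Finite →
    (∀ s, f s + f (opp s) = f (next⁻¹ s) + f (next⁻¹ (opp s))) →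
    ∃ σ : R → ℤ, (Function.support σ).Finite ∧ ∀ s, σ (reg (lo s)) - σ (reg (ro s)) = f s

namespace CurveSystem

variable {S C R : Type*} (Γ : CurveSystem S C R)

/-- The region to the left of a strand. -/
def left (s : S) : R := Γ.reg (Γ.lo s)

/-- The region to the right of a strand. -/
def right (s : S) : R := Γ.reg (Γ.ro s)

/-- The strand `k` steps after `s`. -/
def go (s : S) (k : ℤ) : S := (Γ.next ^ k) s

/-- The reflected system, in which left and right are exchanged. -/
def mirror : CurveSystem S C R where
  next := Γ.next
  opp := Γ.opp
  pos s := ¬ Γ.pos s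
  lo := Γ.ro
  li := Γ.ri
  ro := Γ.lo
  ri := Γ.li
  reg := Γ.reg
  opp_opp := Γ.opp_opp
  pos_opp s := by rw [Γ.pos_opp]
  ro_eq s hs := by
    have := Γ.ro_eq (Γ.opp s) (by rwa [Γ.pos_opp]); rw [Γ.opp_opp] at this; exact this.symm
  lo_eq s hs := by
    have := Γ.ro_opp (Γ.opp s) (by rwa [Γ.pos_opp]); rw [Γ.opp_opp] at this; exact this
  ro_opp s hs := by
    have := Γ.lo_eq (Γ.opp s) (by rwa [Γ.pos_opp]); rw [Γ.opp_opp] at this; exact this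
  li_eq s hs := by
    have := Γ.li_eq (Γ.opp s) (by rwa [Γ.pos_opp]); rw [Γ.opp_opp] at this; exact this.symm
  reg_li := Γ.reg_ri
  reg_ri := Γ.reg_li
  finite_left := Γ.finite_right
  finite_right := Γ.finite_left
  connected := Γ.connected
  const σ h := Γ.const σ fun s => (h s).symm
  potential f hf := by
    obtain ⟨σ, h⟩ := Γ.potential f hf
    exact ⟨-σ, fun s => by have := h s; simp only [Pi.neg_apply]; linarith⟩
  finite_potential f hfin hf := by
    obtain ⟨σ, h1, h⟩ := Γ.finite_potential f hfin hf
    exact ⟨-σ, by simpa using h1, fun s => by have := h s; simp only [Pi.neg_apply]; linarith⟩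

/-- No curve meets itself, and no two curves lead from one crossing to another one. -/
structure Minimal : Prop where
  go_ne_opp : ∀ s k, Γ.go s k ≠ Γ.opp s
  bigon : ∀ (s : S) (n m : ℤ), 0 ≤ n → 0 ≤ m → Γ.go (Γ.opp s) m = Γ.opp (Γ.go s n) → Γ.go s n = s

variable {Γ}

theorem Minimal.mirror (h : Γ.Minimal) : Γ.mirror.Minimal := ⟨h.1, h.2⟩

@[simp] theorem go_zero (s : S) : Γ.go s 0 = s := rfl

theorem go_go (s : S) (a b : ℤ) : Γ.go (Γ.go s a) b = Γ.go s (a + b) := by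
  simp only [go]; rw [← Equiv.Perm.mul_apply, ← zpow_add, add_comm]

theorem inv_go (s : S) (k : ℤ) : Γ.next⁻¹ (Γ.go s k) = Γ.go s (k - 1) := by
  simp only [go]; rw [← Equiv.Perm.mul_apply, ← zpow_neg_one, ← zpow_add]; congr 2; ring

theorem next_go (s : S) (k : ℤ) : Γ.next (Γ.go s k) = Γ.go s (k + 1) := by
  simp only [go]; rw [← Equiv.Perm.mul_apply, ← zpow_one_add]; congr 2; ring

theorem go_inj {s t : S} {k : ℤ} : Γ.go s k = Γ.go t k ↔ s = t :=
  (Γ.next ^ k).injective.eq_iff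

theorem go_eq_iff {s t : S} {k l : ℤ} : Γ.go s k = Γ.go t l ↔ s = Γ.go t (l - k) := by
  rw [← go_inj (Γ := Γ) (s := s) (k := k), go_go]; congr! 2; ring

theorem opp_inj {s t : S} : Γ.opp s = Γ.opp t ↔ s = t :=
  ⟨fun h => by rw [← Γ.opp_opp s, h, Γ.opp_opp], fun h => by rw [h]⟩

theorem opp_eq_iff {s t : S} : Γ.opp s = t ↔ s = Γ.opp t :=
  ⟨fun h => by rw [← h, Γ.opp_opp], fun h => by rw [h, Γ.opp_opp]⟩

variable (Γ) in
/-- The function `K` on corners jumps by `fo s` at the start and by `fi s` at the end of `s`. -/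
def IsPot (K : C → ℤ) (fo fi : S → ℤ) : Prop :=
  ∀ s, K (Γ.lo s) - K (Γ.ro s) = fo s ∧ K (Γ.li s) - K (Γ.ri s) = fi s

/-- The corners to the left of a curve before and after a crossing are separated by one half of the
other curve: its incoming strand if `s` is positive, its outgoing strand otherwise. If neither half
carries a jump, the value on the left is kept. -/
theorem IsPot.step_left {K : C → ℤ} {fo fi : S → ℤ} (h : Γ.IsPot K fo fi) (s : S)
    (h1 : fo (Γ.opp s) = 0) (h2 : fi (Γ.next⁻¹ (Γ.opp s)) = 0) :
    K (Γ.lo s) = K (Γ.li (Γ.next⁻¹ s)) := by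
  by_cases hs : Γ.pos s
  · rw [Γ.lo_eq s hs, Γ.li_eq s hs]; have := (h (Γ.next⁻¹ (Γ.opp s))).2; omega
  · have hs' : Γ.pos (Γ.opp s) := by rwa [Γ.pos_opp]
    have e1 := Γ.ro_eq _ hs'
    have e2 := Γ.lo_eq _ hs'
    rw [Γ.opp_opp] at e1 e2
    rw [← e1, ← e2]; have := (h (Γ.opp s)).1; omega

/-- Two of the four corners cancel on each side, and both sides reduce to the difference of the
other two. So the jumps of any corner function satisfy the cocycle equation, and correcting a
cocycle by such jumps keeps it a cocycle. -/
theorem sum_corners (J : C → ℤ) (s : S) :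
    (J (Γ.lo s) - J (Γ.ro s)) + (J (Γ.lo (Γ.opp s)) - J (Γ.ro (Γ.opp s))) =
    (J (Γ.li (Γ.next⁻¹ s)) - J (Γ.ri (Γ.next⁻¹ s))) +
      (J (Γ.li (Γ.next⁻¹ (Γ.opp s))) - J (Γ.ri (Γ.next⁻¹ (Γ.opp s)))) := by
  by_cases hs : Γ.pos s
  · rw [Γ.lo_eq s hs, Γ.li_eq s hs, Γ.ro_eq s hs, Γ.ro_opp s hs]; ring
  · have hs' : Γ.pos (Γ.opp s) := by rwa [Γ.pos_opp]
    have e1 := Γ.ro_eq _ hs'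
    have e2 := Γ.lo_eq _ hs'
    have e3 := Γ.ro_opp _ hs'
    have e4 := Γ.li_eq _ hs'
    rw [Γ.opp_opp] at e1 e2 e3 e4
    rw [e1, e2, e3, e4]; ring

/-- A cocycle which is allowed to change along strands by the boundary of `J` has a potential. -/
theorem exists_isPot {fo fi : S → ℤ} {J : C → ℤ}
    (h1 : ∀ s, fo s + fo (Γ.opp s) = fi (Γ.next⁻¹ s) + fi (Γ.next⁻¹ (Γ.opp s)))
    (h2 : ∀ s, fi s - fo s = (J (Γ.li s) - J (Γ.ri s)) - (J (Γ.lo s) - J (Γ.ro s))) :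
    ∃ σ : R → ℤ, Γ.IsPot (fun c => σ (Γ.reg c) + J c) fo fi := by
  obtain ⟨σ, hσ⟩ := Γ.potential (fun s => fo s - (J (Γ.lo s) - J (Γ.ro s))) (fun s => by
    have a1 := h1 s
    have a2 := h2 (Γ.next⁻¹ s)
    have a3 := h2 (Γ.next⁻¹ (Γ.opp s))
    have a4 := sum_corners (Γ := Γ) J s
    linarith)
  refine ⟨σ, fun s => ⟨?_, ?_⟩⟩
  · have := hσ s; dsimp only at this ⊢; linarith
  · have := hσ s; have := h2 s; dsimp only at this ⊢; rw [Γ.reg_li, Γ.reg_ri]; linarith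

theorem finite_left_set {F : Set R} (hF : F.Finite) : {s | Γ.left s ∈ F}.Finite := by
  have : {s | Γ.left s ∈ F} = ⋃ r ∈ F, {s | Γ.reg (Γ.lo s) = r} := by ext; simp [left]
  rw [this]; exact hF.biUnion fun r _ => Γ.finite_left r

theorem finite_right_set {F : Set R} (hF : F.Finite) : {s | Γ.right s ∈ F}.Finite :=
  finite_left_set (Γ := Γ.mirror) hF

theorem exists_finite_isPot {fo fi : S → ℤ} {J : C → ℤ}
    (h1 : ∀ s, fo s + fo (Γ.opp s) = fi (Γ.next⁻¹ s) + fi (Γ.next⁻¹ (Γ.opp s)))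
    (h2 : ∀ s, fi s - fo s = (J (Γ.li s) - J (Γ.ri s)) - (J (Γ.lo s) - J (Γ.ro s)))
    (hf : (Function.support fo).Finite) (hJ : (Function.support J).Finite) :
    ∃ σ : R → ℤ, (Function.support σ).Finite ∧ Γ.IsPot (fun c => σ (Γ.reg c) + J c) fo fi := by
  obtain ⟨σ, hσ', hσ⟩ := Γ.finite_potential (fun s => fo s - (J (Γ.lo s) - J (Γ.ro s)))
    (by
      refine ((hf.union (finite_left_set (Γ := Γ) (hJ.image Γ.reg))).union
        (finite_right_set (Γ := Γ) (hJ.image Γ.reg))).subset fun s hs => ?_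
      by_contra hc
      simp only [Set.mem_union, not_or, Function.mem_support, not_not] at hc
      have e1 : J (Γ.lo s) = 0 := by
        by_contra h; exact hc.1.2 ⟨_, h, rfl⟩
      have e2 : J (Γ.ro s) = 0 := by
        by_contra h; exact hc.2 ⟨_, h, rfl⟩
      simp [hc.1.1, e1, e2] at hs)
    (fun s => by
    have a1 := h1 s
    have a2 := h2 (Γ.next⁻¹ s)
    have a3 := h2 (Γ.next⁻¹ (Γ.opp s))
    have a4 := sum_corners (Γ := Γ) J s
    linarith)
  refine ⟨σ, hσ', fun s => ⟨?_, ?_⟩⟩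
  · have := hσ s; dsimp only at this ⊢; linarith
  · have := hσ s; have := h2 s; dsimp only at this ⊢; rw [Γ.reg_li, Γ.reg_ri]; linarith

theorem const_up {h : ℤ → ℤ} {a : ℤ} (hh : ∀ k, a < k → h k = h (k - 1)) :
    ∀ k, a ≤ k → h k = h a := by
  intro k hk
  induction k, hk using Int.leInduction with
  | base => rfl
  | succ k hk ih => rw [hh _ (by omega), ← ih]; congr 1; ring

theorem const_down {h : ℤ → ℤ} {a : ℤ} (hh : ∀ k, k ≤ a → h k = h (k - 1)) :
    ∀ k, k ≤ a → h k = h a := by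
  intro k hk
  have := const_up (h := fun k => h (-k)) (a := -a) (fun k hk => by
    have := hh (-k+1) (by omega); rw [show -(k-1) = -k+1 by ring, this]; congr 1; ring)
    (-k) (by omega)
  simpa using this

/-- An injective curve visits a finite set only finitely often. In this sense it runs to infinity,
where finite potentials vanish. -/
theorem exists_ge {s : S} (hs : Function.Injective (Γ.go s)) {F : Set S} (hF : F.Finite) (a : ℤ) :
    ∃ k, a ≤ k ∧ ∀ l, k ≤ l → Γ.go s l ∉ F := by
  have h1 : {k | Γ.go s k ∈ F}.Finite := hF.preimage hs.injOn
  obtain ⟨b, hb⟩ := h1.bddAbove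
  refine ⟨max a (b + 1), le_max_left _ _, fun l hl hlF => ?_⟩
  have := hb hlF
  have := le_max_right a (b+1)
  omega

theorem exists_le {s : S} (hs : Function.Injective (Γ.go s)) {F : Set S} (hF : F.Finite) (a : ℤ) :
    ∃ k, k ≤ a ∧ ∀ l, l ≤ k → Γ.go s l ∉ F := by
  have h1 : {k | Γ.go s k ∈ F}.Finite := hF.preimage hs.injOn
  obtain ⟨b, hb⟩ := h1.bddBelow
  refine ⟨min a (b - 1), min_le_left _ _, fun l hl hlF => ?_⟩
  have := hb hlF
  have := min_le_right a (b-1)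
  omega

/-! ### Curves of a minimal system do not close up -/

section
open scoped Classical

namespace Minimal


theorem go_ne_opp_go (hΓ : Γ.Minimal) (s : S) (k l : ℤ) : Γ.go s k ≠ Γ.opp (Γ.go s l) := fun h =>
  hΓ.go_ne_opp (Γ.go s l) (k - l) (by rw [go_go, ← h]; congr 1; ring)

/-- A closed curve bounds: its indicator is a finite cocycle and has a finite potential. The curve
that crosses it at `s` changes sides there, and has to change back somewhere, because it either
closes up or leaves the support in both directions. The second crossing produces a bigon. -/
theorem go_ne_self (hΓ : Γ.Minimal) (s : S) {n : ℤ} (hn : 0 < n) : Γ.go s n ≠ s := by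
  intro hs
  have hper : ∀ j : ℤ, ∃ i, 0 ≤ i ∧ i < n ∧ Γ.go s i = Γ.go s j := fun j => by
    refine ⟨j % n, Int.emod_nonneg _ hn.ne', Int.emod_lt_of_pos _ hn, ?_⟩
    have key : ∀ m : ℕ, Γ.go s (n * m) = s := fun m => by
      induction m with
      | zero => simp
      | succ m ih => push_cast; rw [mul_add, ← go_go, ih, mul_one, hs]
    have key2 : ∀ m : ℤ, Γ.go s (n * m) = s := fun m => by
      obtain ⟨k, rfl | rfl⟩ := m.eq_nat_or_neg
      · exact key k
      · have := key k
        conv_lhs => rw [← this]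
        rw [go_go]; simp
    conv_rhs => rw [← Int.mul_ediv_add_emod j n, ← go_go, key2]
  set f : S → ℤ := fun v => if ∃ k, Γ.go s k = v then 1 else 0 with hf
  have hf1 : ∀ v, f (Γ.next⁻¹ v) = f v := fun v => by
    simp only [hf]; congr 1
    refine propext ⟨fun ⟨k, hk⟩ => ⟨k + 1, ?_⟩, fun ⟨k, hk⟩ => ⟨k - 1, ?_⟩⟩
    · rw [← next_go, hk]; simp
    · rw [← hk, inv_go]
  obtain ⟨σ, hfin, hσ⟩ := Γ.finite_potential f (by
    refine ((Set.finite_Ico 0 n).image (Γ.go s)).subset fun v hv => ?_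
    simp only [hf, Function.mem_support, ne_eq, ite_eq_right_iff, one_ne_zero, imp_false,
      not_not] at hv
    obtain ⟨k, hk⟩ := hv
    obtain ⟨i, h1, h2, h3⟩ := hper k
    exact ⟨i, ⟨h1, h2⟩, h3.trans hk⟩) (fun v => by rw [hf1, hf1])
  set u := Γ.opp s with hu
  have hpot : Γ.IsPot (fun c => σ (Γ.reg c)) f f := fun v =>
    ⟨hσ v, by dsimp only; rw [Γ.reg_li, Γ.reg_ri]; exact hσ v⟩
  set h : ℤ → ℤ := fun k => σ (Γ.left (Γ.go u k)) with hh
  have hfu : ∀ k, f (Γ.go u k) = 0 := fun k => by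
    simp only [hf]; rw [if_neg]; rintro ⟨j, hj⟩
    rw [go_eq_iff] at hj
    exact hΓ.go_ne_opp u (k - j) (by rw [← hj, hu, Γ.opp_opp])
  have hstep : ∀ k, f (Γ.opp (Γ.go u k)) = 0 → h k = h (k - 1) := fun k hk => by
    have := hpot.step_left (Γ.go u k) hk (by rw [hf1, hk])
    simp only [inv_go, Γ.reg_li] at this
    exact this
  -- The curve `u` changes sides where it crosses the closed curve at `s`, so the value on its left
  -- changes by one.
  have h0 : h 0 ≠ h (-1) := by
    have fs : f s = 1 := by simp only [hf]; rw [if_pos ⟨0, rfl⟩]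
    have e0 : Γ.go u (-1) = Γ.next⁻¹ u := rfl
    simp only [hh, left, go_zero, e0]
    by_cases hp : Γ.pos u
    · rw [← Γ.reg_li (Γ.next⁻¹ u), Γ.lo_eq u hp, Γ.li_eq u hp]
      have := (hpot (Γ.next⁻¹ (Γ.opp u))).2
      dsimp only at this
      rw [hf1, hu, Γ.opp_opp, fs] at this
      intro h; rw [hu, Γ.opp_opp] at h; omega
    · have hp' : Γ.pos (Γ.opp u) := by rwa [Γ.pos_opp]
      have e1 := Γ.ro_eq _ hp'
      have e2 := Γ.lo_eq _ hp'
      rw [Γ.opp_opp] at e1 e2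
      rw [← Γ.reg_li (Γ.next⁻¹ u), ← e1, ← e2]
      have := (hpot (Γ.opp u)).1
      dsimp only at this
      rw [hu, Γ.opp_opp, fs] at this
      intro h; omega
  -- On a closed curve every crossing is reached forwards from every other one. Whatever the
  -- direction in which `u` connects the two crossings, the closed curve connects them in the same
  -- direction, which is a bigon.
  have hmain : ∀ k, Γ.go u k ≠ u → f (Γ.opp (Γ.go u k)) = 0 := fun k hk => by
    simp only [hf]; rw [if_neg]; rintro ⟨j, hj⟩
    obtain ⟨i, hi0, -, hi⟩ := hper j
    rw [← hi] at hj
    rcases le_or_gt 0 k with hk0 | hk0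
    · have := hΓ.bigon s i k hi0 hk0 (by rw [← hu, hj, Γ.opp_opp])
      rw [this] at hj; apply hk; rw [hu, opp_eq_iff.1 hj.symm]
    · obtain ⟨i', hi0', -, hi'⟩ := hper (-i)
      have e1 : Γ.go (Γ.go s i) (i' ) = s := by
        rw [go_go, add_comm, ← go_go, hi', go_go]; simp
      have := hΓ.bigon (Γ.go s i) i' (-k) hi0' (by omega) (by
        rw [e1, hj, Γ.opp_opp, go_go]; simp [hu])
      rw [e1] at this; apply hk
      rw [hu, opp_eq_iff.1 (hj.symm.trans this.symm)]
  -- If `u` closes up, walking once around from step `0` reaches step `-1` without a jump. Otherwise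
  -- both ends of `u` arrive at potential zero. Either way `h 0 = h (-1)`.
  by_cases hu' : ∃ m : ℕ, 0 < m ∧ Γ.go u m = u
  · obtain ⟨hm, hm'⟩ := Nat.find_spec hu'
    have hmin : ∀ k : ℕ, k < Nat.find hu' → ¬ (0 < k ∧ Γ.go u k = u) :=
      fun k hk => Nat.find_min hu' hk
    set m := Nat.find hu'
    have : ∀ k : ℕ, k < m → h k = h 0 := fun k => by
      induction k with
      | zero => intro; rfl
      | succ k ih =>
        intro hk
        rw [hstep _ (hmain _ fun h => hmin (k+1) hk ⟨by omega, h⟩), ← ih (by omega)]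
        congr 1; push_cast; ring
    have e := this (m - 1) (by omega)
    apply h0
    rw [← e]; simp only [hh]
    rw [show ((m - 1 : ℕ) : ℤ) = m + (-1) by omega, ← go_go, hm']
  · have hinj : ∀ k : ℤ, k ≠ 0 → Γ.go u k ≠ u := fun k hk hk' => by
      apply hu'
      refine ⟨k.natAbs, by omega, ?_⟩
      rcases k.natAbs_eq with h | h
      · rw [← h, hk']
      · rw [show (k.natAbs : ℤ) = -k by omega]
        conv_lhs => rw [← hk']
        rw [go_go]; simp
    have hinj' : Function.Injective (Γ.go u) := fun a b hab => by
      by_contra hne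
      rw [go_eq_iff] at hab
      exact hinj (b - a) (by omega) hab.symm
    obtain ⟨a, ha, ha'⟩ := exists_ge hinj' (finite_left_set (Γ := Γ) hfin) 0
    obtain ⟨b, hb, hb'⟩ := exists_le hinj' (finite_left_set (Γ := Γ) hfin) (-1)
    have e1 := const_up (h := h) (a := 0) (fun k hk => hstep _ (hmain _ (hinj _ (by omega)))) a ha
    have e2 := const_down (h := h) (a := -1)
      (fun k hk => hstep _ (hmain _ (hinj _ (by omega)))) b hb
    have e3 := ha' a le_rfl
    have e4 := hb' b le_rfl
    replace e3 : σ _ = 0 := not_not.1 e3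
    replace e4 : σ _ = 0 := not_not.1 e4
    apply h0; rw [← e1, ← e2]; simp only [hh]; rw [e3, e4]

theorem injective_go (hΓ : Γ.Minimal) (s : S) : Function.Injective (Γ.go s) := fun a b hab => by
  rcases lt_trichotomy a b with h | h | h
  · rw [go_eq_iff] at hab; exact absurd hab.symm (hΓ.go_ne_self s (by omega))
  · exact h
  · rw [eq_comm, go_eq_iff] at hab; exact absurd hab.symm (hΓ.go_ne_self s (by omega))

theorem no_bigon (hΓ : Γ.Minimal) {s : S} {n m : ℤ} (hn : 0 ≤ n) (hm : 0 ≤ m)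
    (h : Γ.go (Γ.opp s) m = Γ.opp (Γ.go s n)) : n = 0 ∧ m = 0 := by
  have := hΓ.bigon s n m hn hm h
  rw [this] at h
  exact ⟨hΓ.injective_go s (by simpa using this), hΓ.injective_go _ (by simpa using h)⟩

end Minimal
end
end CurveSystem

/-! ### Loops closed by chords inside a region -/

namespace CurveSystem

variable {S C R : Type*} {Γ : CurveSystem S C R}

section
open scoped Classical

/-- The Kronecker delta. -/
noncomputable def kron {S : Type*} (a b : S) : ℤ := if a = b then 1 else 0

theorem kron_self (a : S) : kron a a = 1 := if_pos rfl

theorem kron_ne {a b : S} (h : a ≠ b) : kron a b = 0 := if_neg h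

theorem kron_opp (a b : S) : kron (Γ.opp a) b = kron a (Γ.opp b) := by
  simp only [kron, opp_eq_iff]

theorem Minimal.go_ne (hΓ : Γ.Minimal) (s : S) {k : ℤ} (hk : k ≠ 0) : Γ.go s k ≠ s :=
  fun h => hk (hΓ.injective_go s h)

variable (Γ) in
/-- `J` is the indicator of one side of a chord in a region from the middle of `s` to the middle of
`s'`, which it reaches from the left. -/
structure Chord (J : C → ℤ) (s s' : S) : Prop where
  finite : (Function.support J).Finite
  left : ∀ v, J (Γ.li v) - J (Γ.lo v) = kron v s - kron v s'
  right : ∀ v, J (Γ.ri v) = J (Γ.ro v)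

theorem Chord.symm {J : C → ℤ} {s s' : S} (h : Γ.Chord J s s') : Γ.Chord (-J) s' s :=
  ⟨by simpa using h.1, fun v => by have := h.2 v; simp only [Pi.neg_apply]; linarith,
    fun v => by have := h.3 v; simp only [Pi.neg_apply]; linarith⟩

variable (Γ) in
/-- Indicator of the strands `go s k` with `a ≤ k < b`. -/
noncomputable def arc (s : S) (a b : ℤ) (v : S) : ℤ := if ∃ k, a ≤ k ∧ k < b ∧ Γ.go s k = v then 1 else 0

variable (Γ) in
/-- Indicator of the strands `go s k` with `a ≤ k`. -/
noncomputable def rayFrom (s : S) (a : ℤ) (v : S) : ℤ := if ∃ k, a ≤ k ∧ Γ.go s k = v then 1 else 0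

theorem arc_inv (s : S) (a b : ℤ) (v : S) :
    Γ.arc s a b (Γ.next⁻¹ v) = Γ.arc s (a + 1) (b + 1) v := by
  simp only [arc]; congr 1
  refine propext ⟨fun ⟨k, h1, h2, h3⟩ => ⟨k + 1, by omega, by omega, ?_⟩,
    fun ⟨k, h1, h2, h3⟩ => ⟨k - 1, by omega, by omega, ?_⟩⟩
  · rw [← next_go, h3]; simp
  · rw [← h3, inv_go]

theorem rayFrom_inv (s : S) (a : ℤ) (v : S) :
    Γ.rayFrom s a (Γ.next⁻¹ v) = Γ.rayFrom s (a + 1) v := by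
  simp only [rayFrom]; congr 1
  refine propext ⟨fun ⟨k, h1, h3⟩ => ⟨k + 1, by omega, ?_⟩,
    fun ⟨k, h1, h3⟩ => ⟨k - 1, by omega, ?_⟩⟩
  · rw [← next_go, h3]; simp
  · rw [← h3, inv_go]

theorem arc_eq_zero {s : S} {a b : ℤ} {v : S} :
    Γ.arc s a b v = 0 ↔ ∀ k, a ≤ k → k < b → Γ.go s k ≠ v := by
  simp [arc]

theorem rayFrom_eq_zero {s : S} {a : ℤ} {v : S} :
    Γ.rayFrom s a v = 0 ↔ ∀ k, a ≤ k → Γ.go s k ≠ v := by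
  simp [rayFrom]

theorem rayFrom_go {s : S} {a k : ℤ} (h : a ≤ k) : Γ.rayFrom s a (Γ.go s k) = 1 := by
  simp only [rayFrom]; rw [if_pos ⟨k, h, rfl⟩]

theorem arc_support (s : S) (a b : ℤ) : (Function.support (Γ.arc s a b)).Finite := by
  refine ((Set.finite_Ico a b).image (Γ.go s)).subset fun v hv => ?_
  by_contra hc
  exact hv (arc_eq_zero.2 fun k h1 h2 h3 => hc ⟨k, ⟨h1, h2⟩, h3⟩)

theorem Minimal.arc_succ (hΓ : Γ.Minimal) (s : S) {a b : ℤ} (h : a ≤ b) (v : S) :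
    Γ.arc s a (b + 1) v = Γ.arc s a b v + kron v (Γ.go s b) := by
  have hi := hΓ.injective_go s
  by_cases h1 : v = Γ.go s b
  · subst h1
    rw [arc_eq_zero (a := a) (b := b).2 (fun k h1 h2 h3 => by have := hi h3; omega), arc,
      if_pos ⟨b, h, by omega, rfl⟩, kron_self]; simp
  · simp only [kron_ne h1, arc, add_zero]; congr 1
    refine propext ⟨fun ⟨k, a1, a2, a3⟩ => ⟨k, a1, ?_, a3⟩,
      fun ⟨k, a1, a2, a3⟩ => ⟨k, a1, by omega, a3⟩⟩
    rcases (show k < b ∨ k = b by omega) with h | h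
    · exact h
    · subst h; exact absurd a3.symm h1

theorem Minimal.arc_pred (hΓ : Γ.Minimal) (s : S) {a b : ℤ} (h : a < b) (v : S) :
    Γ.arc s a b v = Γ.arc s (a + 1) b v + kron v (Γ.go s a) := by
  have hi := hΓ.injective_go s
  by_cases h1 : v = Γ.go s a
  · subst h1
    rw [arc_eq_zero (a := a + 1) (b := b).2 (fun k h1 h2 h3 => by have := hi h3; omega), arc,
      if_pos ⟨a, le_rfl, by omega, rfl⟩, kron_self]; simp
  · simp only [kron_ne h1, arc, add_zero]; congr 1
    refine propext ⟨fun ⟨k, a1, a2, a3⟩ => ⟨k, ?_, a2, a3⟩,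
      fun ⟨k, a1, a2, a3⟩ => ⟨k, by omega, a2, a3⟩⟩
    rcases (show a + 1 ≤ k ∨ k = a by omega) with h | h
    · exact h
    · subst h; exact absurd a3.symm h1

theorem Minimal.rayFrom_pred (hΓ : Γ.Minimal) (s : S) (a : ℤ) (v : S) :
    Γ.rayFrom s a v = Γ.rayFrom s (a + 1) v + kron v (Γ.go s a) := by
  have hi := hΓ.injective_go s
  by_cases h1 : v = Γ.go s a
  · subst h1
    rw [rayFrom_eq_zero (a := a + 1).2 (fun k h1 h3 => by have := hi h3; omega), rayFrom,
      if_pos ⟨a, le_rfl, rfl⟩, kron_self]; simp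
  · simp only [kron_ne h1, rayFrom, add_zero]; congr 1
    refine propext ⟨fun ⟨k, a1, a3⟩ => ⟨k, ?_, a3⟩,
      fun ⟨k, a1, a3⟩ => ⟨k, by omega, a3⟩⟩
    rcases (show a + 1 ≤ k ∨ k = a by omega) with h | h
    · exact h
    · subst h; exact absurd a3.symm h1

theorem IsPot.const_past {K : C → ℤ} {fo fi : S → ℤ} (h : Γ.IsPot K fo fi) {s : S}
    (h1 : ∀ k, k ≤ 0 → fo (Γ.opp (Γ.go s k)) = 0 ∧ fi (Γ.next⁻¹ (Γ.opp (Γ.go s k))) = 0)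
    (h2 : ∀ k, k < 0 → K (Γ.li (Γ.go s k)) = K (Γ.lo (Γ.go s k))) :
    ∀ k, k ≤ 0 → K (Γ.lo (Γ.go s k)) = K (Γ.lo s) :=
  const_down (h := fun k => K (Γ.lo (Γ.go s k))) (a := 0) fun k hk => by
    rw [h.step_left _ (h1 k hk).1 (h1 k hk).2, inv_go, h2 _ (by omega)]

theorem IsPot.const_future {K : C → ℤ} {fo fi : S → ℤ} (h : Γ.IsPot K fo fi) {s : S} {a : ℤ}
    (h1 : ∀ k, a < k → fo (Γ.opp (Γ.go s k)) = 0 ∧ fi (Γ.next⁻¹ (Γ.opp (Γ.go s k))) = 0)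
    (h2 : ∀ k, a ≤ k → K (Γ.li (Γ.go s k)) = K (Γ.lo (Γ.go s k))) :
    ∀ k, a ≤ k → K (Γ.lo (Γ.go s k)) = K (Γ.lo (Γ.go s a)) :=
  const_up (h := fun k => K (Γ.lo (Γ.go s k))) (a := a) fun k hk => by
    rw [h.step_left _ (h1 k hk).1 (h1 k hk).2, inv_go, h2 _ (by omega)]

theorem finite_pot {σ : R → ℤ} {J : C → ℤ} (hσ : (Function.support σ).Finite)
    (hJ : (Function.support J).Finite) : {v | σ (Γ.reg (Γ.lo v)) + J (Γ.lo v) ≠ 0}.Finite := by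
  refine (finite_left_set (Γ := Γ) (hσ.union (hJ.image Γ.reg))).subset fun v hv => ?_
  by_contra hc
  simp only [left, Set.mem_ofPred_eq, Set.mem_union, not_or, Function.mem_support, not_not] at hc
  have e1 : J (Γ.lo v) = 0 := by by_contra h; exact hc.2 ⟨_, h, rfl⟩
  exact hv (by rw [hc.1, e1]; rfl)

namespace Minimal

/-- Forward rays on different curves that start next to the same region, on the same side, do not
cross. -/
theorem not_cross (hΓ : Γ.Minimal) {J : C → ℤ} {s s' : S} (hJ : Γ.Chord J s s') (hr : Γ.left s = Γ.left s')
    (hne : J (Γ.lo s) ≠ J (Γ.lo s')) (hd : ∀ k, Γ.go s k ≠ s') {n m : ℤ} (hn : 1 ≤ n)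
    (hm : 1 ≤ m) : Γ.go s' m ≠ Γ.opp (Γ.go s n) := by
  intro hz
  -- The loop follows `s` up to the crossing, returns along `s'` and closes along the chord. It
  -- begins and ends in the middle of `s` and `s'`, so these strands carry a jump at their ends
  -- (`fi`) but not at their starts (`fo`).
  set fo : S → ℤ := fun v => Γ.arc s 1 n v - Γ.arc s' 1 m v with hfo
  set fi : S → ℤ := fun v => Γ.arc s 0 n v - Γ.arc s' 0 m v with hfi
  have hd' : ∀ k l, Γ.go s k ≠ Γ.go s' l := fun k l h => by
    rw [eq_comm, go_eq_iff] at h; exact hd _ h.symm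
  have hii : ∀ v, fi (Γ.next⁻¹ v) = Γ.arc s 1 (n + 1) v - Γ.arc s' 1 (m + 1) v := fun v => by
    simp only [hfi]; rw [arc_inv, arc_inv]; rfl
  obtain ⟨σ, hσ, hpot⟩ := exists_finite_isPot (Γ := Γ) (fo := fo) (fi := fi) (J := J)
    (fun v => by
      simp only [hii]
      rw [hΓ.arc_succ s hn, hΓ.arc_succ s' hm, hΓ.arc_succ s hn, hΓ.arc_succ s' hm, hz]
      simp only [hfo, kron_opp, Γ.opp_opp]; ring)
    (fun v => by
      have := hJ.left v
      have := hJ.right v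
      simp only [hfo, hfi]
      rw [hΓ.arc_pred s (show (0:ℤ) < n by omega), hΓ.arc_pred s' (show (0:ℤ) < m by omega)]
      simp only [go_zero, zero_add]; linarith)
    (((arc_support s 1 n).union (arc_support s' 1 m)).subset fun v hv => by
      by_contra hc
      simp only [Set.mem_union, not_or, Function.mem_support, not_not] at hc
      exact hv (by simp only [hfo]; rw [hc.1, hc.2]; rfl)) hJ.finite
  set K : C → ℤ := fun c => σ (Γ.reg c) + J c with hK
  have hKl : ∀ v, K (Γ.li v) - K (Γ.lo v) =
      kron v s - kron v s' := fun v => by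
    rw [← hJ.left v]; simp only [hK, Γ.reg_li]; ring
  have fin := finite_pot (Γ := Γ) hσ hJ.finite
  -- A crossing of the past of `s` with the arc of `s'` would lead forwards, along both curves, to
  -- the assumed crossing: a bigon.
  have past : ∀ k, k ≤ 0 → K (Γ.lo (Γ.go s k)) = K (Γ.lo s) := by
    refine hpot.const_past (fun k hk => ?_) (fun k hk => ?_)
    · have h1 : ∀ l, 1 ≤ l → l ≤ m → Γ.go s' l ≠ Γ.opp (Γ.go s k) := fun l hl1 hl2 h => by
        have := hΓ.no_bigon (s := Γ.go s k) (n := n - k) (m := m - l) (by omega) (by omega)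
          (by rw [← h, go_go, go_go, show l + (m - l) = m by ring, hz]; congr 2; ring)
        omega
      have h2 : ∀ l, Γ.go s l ≠ Γ.opp (Γ.go s k) := fun l => hΓ.go_ne_opp_go s l k
      rw [hii]; simp only [hfo]
      rw [arc_eq_zero.2 (fun l _ _ => h2 l), arc_eq_zero.2 (fun l _ _ => h2 l),
        arc_eq_zero.2 (fun l _ _ => h1 l (by omega) (by omega)),
        arc_eq_zero.2 (fun l _ _ => h1 l (by omega) (by omega))]; simp
    · have := hKl (Γ.go s k)
      rw [kron_ne (hΓ.go_ne s (by omega)), kron_ne (hd k)] at this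
      omega
  have past' : ∀ k, k ≤ 0 → K (Γ.lo (Γ.go s' k)) = K (Γ.lo s') := by
    refine hpot.const_past (fun k hk => ?_) (fun k hk => ?_)
    · have h1 : ∀ l, 1 ≤ l → l ≤ n → Γ.go s l ≠ Γ.opp (Γ.go s' k) := fun l hl1 hl2 h => by
        have := hΓ.no_bigon (s := Γ.go s' k) (n := m - k) (m := n - l) (by omega) (by omega)
          (by rw [← h, go_go, go_go, show l + (n - l) = n by ring, show k + (m - k) = m by ring,
                hz, Γ.opp_opp])
        omega
      have h2 : ∀ l, Γ.go s' l ≠ Γ.opp (Γ.go s' k) := fun l => hΓ.go_ne_opp_go s' l k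
      rw [hii]; simp only [hfo]
      rw [arc_eq_zero.2 (fun l _ _ => h1 l (by omega) (by omega)),
        arc_eq_zero.2 (fun l _ _ => h1 l (by omega) (by omega)),
        arc_eq_zero.2 (fun l _ _ => h2 l), arc_eq_zero.2 (fun l _ _ => h2 l)]; simp
    · have := hKl (Γ.go s' k)
      rw [kron_ne (b := s) (fun h => hd' 0 k h.symm),
        kron_ne (hΓ.go_ne s' (by omega))] at this
      omega
  -- Both pasts run to infinity, so the potential vanishes to the left of the starts of `s` and
  -- `s'`. These corners lie in one region, so `J` takes the same value at both, against `hne`.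
  obtain ⟨a, ha, ha'⟩ := exists_le (hΓ.injective_go s) fin 0
  obtain ⟨b, hb, hb'⟩ := exists_le (hΓ.injective_go s') fin 0
  have e1 : K (Γ.lo (Γ.go s a)) = 0 := not_not.1 (ha' a le_rfl)
  have e2 : K (Γ.lo (Γ.go s' b)) = 0 := not_not.1 (hb' b le_rfl)
  rw [past a ha] at e1
  rw [past' b hb] at e2
  simp only [hK] at e1 e2
  have : σ (Γ.reg (Γ.lo s)) = σ (Γ.reg (Γ.lo s')) := congrArg σ hr
  omega

/-- The function on corners attached to the closed curve that runs from the middle of `s` to the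
middle of `go s d` and returns along a chord. -/
theorem exists_loop_pot (hΓ : Γ.Minimal) {J : C → ℤ} {s : S} {d : ℤ} (hd : 1 ≤ d)
    (hJ : Γ.Chord J s (Γ.go s d)) : ∃ σ : R → ℤ, (Function.support σ).Finite ∧
      Γ.IsPot (fun c => σ (Γ.reg c) + J c) (Γ.arc s 1 (d + 1)) (Γ.arc s 0 d) := by
  refine exists_finite_isPot (fun v => ?_) (fun v => ?_) (arc_support _ _ _) hJ.finite
  · rw [arc_inv, arc_inv]; rfl
  · have := hJ.left v
    have := hJ.right v
    rw [hΓ.arc_pred s (show (0:ℤ) < d by omega), hΓ.arc_succ s (show (1:ℤ) ≤ d by omega)]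
    simp only [go_zero, zero_add]; linarith

/-- The past of `s` does not meet the loop, so its left side has value `0`; beyond the foot of the
chord the value is `1`. The curve that branches off to the left at the end of `s` starts with value
`1` on its left. It cannot cross the loop again without forming a bigon, yet it runs to infinity. -/
theorem chord_ne_go (hΓ : Γ.Minimal) {J : C → ℤ} {s : S} {d : ℤ} (hd : 1 ≤ d)
    (hp : Γ.pos (Γ.opp (Γ.next s))) (hJ : Γ.Chord J s (Γ.go s d)) : False := by
  obtain ⟨σ, hσ, hpot⟩ := hΓ.exists_loop_pot hd hJ
  set K : C → ℤ := fun c => σ (Γ.reg c) + J c with hK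
  have hKl : ∀ v, K (Γ.li v) - K (Γ.lo v) =
      kron v s - kron v (Γ.go s d) := fun v => by
    rw [← hJ.left v]; simp only [hK, Γ.reg_li]; ring
  have fin := finite_pot (Γ := Γ) hσ hJ.finite
  have past : ∀ k, k ≤ 0 → K (Γ.lo (Γ.go s k)) = K (Γ.lo s) := by
    refine hpot.const_past (fun k hk => ?_) (fun k hk => ?_)
    · have h2 : ∀ l, Γ.go s l ≠ Γ.opp (Γ.go s k) := fun l => hΓ.go_ne_opp_go s l k
      rw [arc_inv, arc_eq_zero.2 (fun l _ _ => h2 l), arc_eq_zero.2 (fun l _ _ => h2 l)]; simp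
    · have := hKl (Γ.go s k)
      rw [kron_ne (hΓ.go_ne s (by omega)),
        kron_ne (hΓ.injective_go s |>.ne (by omega))] at this
      omega
  obtain ⟨a, ha, ha'⟩ := exists_le (hΓ.injective_go s) fin 0
  have e1 : K (Γ.lo (Γ.go s a)) = 0 := not_not.1 (ha' a le_rfl)
  rw [past a ha] at e1
  have e2 := hKl s
  rw [kron_self, kron_ne (hΓ.go_ne s (by omega)).symm] at e2
  set u := Γ.opp (Γ.next s) with hu
  have hu' : Γ.opp u = Γ.go s 1 := by rw [hu, Γ.opp_opp]; rfl
  have hud : ∀ k l, Γ.go s k ≠ Γ.go u l := fun k l h => by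
    rw [go_eq_iff] at h
    refine hΓ.go_ne_opp_go u (l - k + 1) 0 ?_
    rw [go_zero, hu', ← go_go, ← h]
  have e3 : K (Γ.lo u) = 1 := by
    rw [Γ.lo_eq u hp, hu, Γ.opp_opp,
      show Γ.next⁻¹ (Γ.next s) = s from Γ.next.symm_apply_apply s]; omega
  have fut : ∀ k, 0 ≤ k → K (Γ.lo (Γ.go u k)) = K (Γ.lo (Γ.go u 0)) := by
    refine hpot.const_future (fun k hk => ?_) (fun k hk => ?_)
    · have h2 : ∀ l, 1 ≤ l → Γ.go s l ≠ Γ.opp (Γ.go u k) := fun l hl h => by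
        have := hΓ.no_bigon (s := Γ.go s 1) (n := l - 1) (m := k) (by omega) (by omega)
          (by rw [← hu', Γ.opp_opp, hu', go_go, show 1 + (l - 1) = l by ring, h, Γ.opp_opp])
        omega
      rw [arc_inv, arc_eq_zero.2 (fun l hl _ => h2 l hl),
        arc_eq_zero.2 (fun l hl _ => h2 l (by omega))]; simp
    · have := hKl (Γ.go u k)
      rw [kron_ne (b := s) (fun h => hud 0 k h.symm), kron_ne (fun h => hud d k h.symm)] at this
      omega
  obtain ⟨b, hb, hb'⟩ := exists_ge (hΓ.injective_go u) fin 0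
  have e4 : K (Γ.lo (Γ.go u b)) = 0 := not_not.1 (hb' b le_rfl)
  rw [fut b hb, go_zero] at e4
  omega

/-- Different strands around a vertex belong to different curves. -/
theorem ne_go_of_chord (hΓ : Γ.Minimal) {J : C → ℤ} {s s' : S} (hp : Γ.pos (Γ.opp (Γ.next s)))
    (hp' : Γ.pos (Γ.opp (Γ.next s'))) (hne : s ≠ s') (hJ : Γ.Chord J s s') (d : ℤ) :
    Γ.go s d ≠ s' := by
  rintro rfl
  rcases lt_trichotomy d 0 with h | h | h
  · refine hΓ.chord_ne_go (J := -J) (s := Γ.go s d) (d := -d) (by omega) hp' ?_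
    rw [go_go]; simpa using hJ.symm
  · subst h; exact hne rfl
  · exact hΓ.chord_ne_go (by omega) hp hJ

/-- The loop formed by the curve of `s` and its chord has the two visits of the curve of `u` on
different sides of the chord. By `not_cross` the forward ray of `u` does not cross the arc of `s`,
so it cannot pass from one side to the other. -/
theorem not_abab_aux (hΓ : Γ.Minimal) {J J' : C → ℤ} {s u : S} {d d' : ℤ} (hd : 1 ≤ d) (hd' : 1 ≤ d')
    (hJ : Γ.Chord J s (Γ.go s d)) (hr : Γ.left s = Γ.left u)
    (hr' : Γ.left u = Γ.left (Γ.go u d')) (hsu : ∀ k, Γ.go s k ≠ u)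
    (hJu : J (Γ.lo u) ≠ J (Γ.lo (Γ.go u d')))
    (hJ' : Γ.Chord J' s u) (hne : J' (Γ.lo s) ≠ J' (Γ.lo u)) : False := by
  obtain ⟨σ, hσ, hpot⟩ := hΓ.exists_loop_pot hd hJ
  set K : C → ℤ := fun c => σ (Γ.reg c) + J c with hK
  have hKl : ∀ v, K (Γ.li v) - K (Γ.lo v) =
      kron v s - kron v (Γ.go s d) := fun v => by
    rw [← hJ.left v]; simp only [hK, Γ.reg_li]; ring
  have hud : ∀ k l, Γ.go s k ≠ Γ.go u l := fun k l h => by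
    rw [eq_comm, go_eq_iff] at h; exact hsu _ h.symm
  have fut : ∀ k, 0 ≤ k → K (Γ.lo (Γ.go u k)) = K (Γ.lo (Γ.go u 0)) := by
    refine hpot.const_future (fun k hk => ?_) (fun k hk => ?_)
    · have h2 : ∀ l, 1 ≤ l → Γ.go s l ≠ Γ.opp (Γ.go u k) := fun l hl h =>
        hΓ.not_cross hJ' hr hne hsu hl (show 1 ≤ k by omega) (by rw [h, Γ.opp_opp])
      rw [arc_inv, arc_eq_zero.2 (fun l hl _ => h2 l hl),
        arc_eq_zero.2 (fun l hl _ => h2 l (by omega))]; simp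
    · have := hKl (Γ.go u k)
      rw [kron_ne (b := s) (fun h => hud 0 k h.symm), kron_ne (fun h => hud d k h.symm)] at this
      omega
  have := fut d' (by omega)
  simp only [hK, go_zero] at this
  have e : σ (Γ.reg (Γ.lo u)) = σ (Γ.reg (Γ.lo (Γ.go u d'))) := congrArg σ hr'
  omega

end Minimal

/-! ### Local and global cyclic order -/

variable (Γ) in
/-- The forward ends of the curves through `a`, `b`, `c` are in counterclockwise order: some set of
regions is bounded by the ends of `b` and `a` and finitely many other strands, and contains the
end of `c`. -/
def Order (a b c : S) : Prop := ∃ (A : Set R) (N : ℤ),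
  (∀ k, N ≤ k → Γ.left (Γ.go a k) ∉ A ∧ Γ.right (Γ.go a k) ∈ A) ∧
  (∀ k, N ≤ k → Γ.left (Γ.go b k) ∈ A ∧ Γ.right (Γ.go b k) ∉ A) ∧
  (∀ k, N ≤ k → Γ.left (Γ.go c k) ∈ A ∧ Γ.right (Γ.go c k) ∈ A) ∧
  {s | (∀ k, N ≤ k → Γ.go a k ≠ s) ∧ (∀ k, N ≤ k → Γ.go b k ≠ s) ∧
    ¬ (Γ.left s ∈ A ↔ Γ.right s ∈ A)}.Finite

theorem Order.of_mirror {a b c : S} (h : Γ.mirror.Order a b c) : Γ.Order b a c := by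
  obtain ⟨A, N, h1, h2, h3, h4⟩ := h
  exact ⟨A, N, fun k hk => (h2 k hk).symm, fun k hk => (h1 k hk).symm, fun k hk => (h3 k hk).symm,
    h4.subset fun s ⟨q1, q2, q3⟩ => ⟨q2, q1, fun q => q3 q.symm⟩⟩

theorem finite_corner {J : C → ℤ} (hJ : (Function.support J).Finite) :
    {v | J (Γ.lo v) ≠ 0 ∨ J (Γ.ro v) ≠ 0}.Finite := by
  refine ((finite_left_set (Γ := Γ) (hJ.image Γ.reg)).union
    (finite_right_set (Γ := Γ) (hJ.image Γ.reg))).subset ?_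
  rintro v (hv | hv)
  · exact Or.inl ⟨_, hv, rfl⟩
  · exact Or.inr ⟨_, hv, rfl⟩

/-- The ray of `a` traversed backwards, the chord and the ray of `b` form a line. The three rays are
pairwise disjoint, so the potential of this line is constant along each of them and can be read off
in the common region. A superlevel set of the potential is the required sector. -/
theorem Minimal.order_of_chord (hΓ : Γ.Minimal) {J : C → ℤ} {a b c : S} (hJ : Γ.Chord J a b)
    (hab : Γ.left a = Γ.left b) (hac : Γ.left a = Γ.left c)
    (ja : J (Γ.lo a) = 0) (jb : J (Γ.lo b) = 1) (jc : J (Γ.lo c) = 0)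
    (dab : ∀ k, Γ.go a k ≠ b) (dac : ∀ k, Γ.go a k ≠ c) (dbc : ∀ k, Γ.go b k ≠ c)
    (nab : ∀ n m : ℤ, 1 ≤ n → 1 ≤ m → Γ.go b m ≠ Γ.opp (Γ.go a n))
    (nac : ∀ n m : ℤ, 1 ≤ n → 1 ≤ m → Γ.go c m ≠ Γ.opp (Γ.go a n))
    (nbc : ∀ n m : ℤ, 1 ≤ n → 1 ≤ m → Γ.go c m ≠ Γ.opp (Γ.go b n)) : Γ.Order a b c := by
  have dif : ∀ {s t : S}, (∀ k, Γ.go s k ≠ t) → ∀ k l, Γ.go s k ≠ Γ.go t l := fun h k l e => by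
    rw [eq_comm, go_eq_iff] at e; exact h _ e.symm
  set fo : S → ℤ := fun v => Γ.rayFrom b 1 v - Γ.rayFrom a 1 v with hfo
  set fi : S → ℤ := fun v => Γ.rayFrom b 0 v - Γ.rayFrom a 0 v with hfi
  have hii : ∀ v, fi (Γ.next⁻¹ v) = fo v := fun v => by
    simp only [hfi]; rw [rayFrom_inv, rayFrom_inv]; rfl
  obtain ⟨σ, hpot⟩ := exists_isPot (Γ := Γ) (fo := fo) (fi := fi) (J := -J)
    (fun v => by rw [hii, hii])
    (fun v => by
      have := hJ.left v
      have := hJ.right v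
      simp only [hfo, hfi, Pi.neg_apply]
      rw [hΓ.rayFrom_pred a 0, hΓ.rayFrom_pred b 0]
      simp only [go_zero, zero_add]; linarith)
  set K : C → ℤ := fun c => σ (Γ.reg c) + (-J) c with hK
  have hKl : ∀ v, K (Γ.li v) - K (Γ.lo v) = kron v b - kron v a := fun v => by
    have := hJ.left v
    simp only [hK, Γ.reg_li, Pi.neg_apply]; linarith
  obtain ⟨N, hN1, hN⟩ : ∃ N, 1 ≤ N ∧ ∀ s ∈ ({a, b, c} : Set S), ∀ k, N ≤ k →
      J (Γ.lo (Γ.go s k)) = 0 ∧ J (Γ.ro (Γ.go s k)) = 0 := by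
    have hf := finite_corner (Γ := Γ) hJ.finite
    obtain ⟨Na, ha, ha'⟩ := exists_ge (hΓ.injective_go a) hf 1
    obtain ⟨Nb, hb, hb'⟩ := exists_ge (hΓ.injective_go b) hf Na
    obtain ⟨Nc, hc, hc'⟩ := exists_ge (hΓ.injective_go c) hf Nb
    have red : ∀ v, v ∉ {v | J (Γ.lo v) ≠ 0 ∨ J (Γ.ro v) ≠ 0} →
        J (Γ.lo v) = 0 ∧ J (Γ.ro v) = 0 := fun v hv => by
      by_contra h; rw [not_and_or] at h; exact hv h
    refine ⟨Nc, by omega, ?_⟩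
    rintro s (rfl | rfl | rfl) k hk
    · exact red _ (ha' k (by omega))
    · exact red _ (hb' k (by omega))
    · exact red _ (hc' k (by omega))
  have ray1 : ∀ (s : S), (∀ k, 1 ≤ k → fo (Γ.opp (Γ.go s k)) = 0) →
      (∀ k, 1 ≤ k → kron (Γ.go s k) b = 0 ∧ kron (Γ.go s k) a = 0) →
      ∀ k, 1 ≤ k → K (Γ.lo (Γ.go s k)) = K (Γ.li s) := by
    intro s h1 h2 k hk
    have hs : K (Γ.lo (Γ.go s 1)) = K (Γ.li s) := by
      rw [hpot.step_left _ (h1 1 le_rfl) (by rw [hii]; exact h1 1 le_rfl), inv_go]; simp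
    rw [← hs]
    refine hpot.const_future (a := 1) (fun k hk => ⟨h1 k hk.le, by rw [hii]; exact h1 k hk.le⟩)
      (fun k hk => ?_) k hk
    have := hKl (Γ.go s k)
    rw [(h2 k hk).1, (h2 k hk).2] at this; omega
  have sl : ∀ v, σ (Γ.left v) = K (Γ.lo v) + J (Γ.lo v) := fun v => by simp [hK, left]
  have sr : ∀ v, σ (Γ.right v) = K (Γ.lo v) - fo v + J (Γ.ro v) := fun v => by
    have := (hpot v).1; rw [← this]; simp [hK, right]
  have Ka : ∀ k, 1 ≤ k → K (Γ.lo (Γ.go a k)) = K (Γ.li a) :=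
    ray1 a (fun k hk => by
      simp only [hfo]; rw [rayFrom_eq_zero.2 fun l hl => nab k l hk hl,
        rayFrom_eq_zero.2 fun l hl => hΓ.go_ne_opp_go a l k]; rfl)
      (fun k hk => ⟨kron_ne (dab k), kron_ne (hΓ.go_ne a (by omega))⟩)
  have Kb : ∀ k, 1 ≤ k → K (Γ.lo (Γ.go b k)) = K (Γ.li b) :=
    ray1 b (fun k hk => by
      simp only [hfo]; rw [rayFrom_eq_zero (s := a).2 fun l hl h => nab l k hl hk
        (by rw [h, Γ.opp_opp]), rayFrom_eq_zero.2 fun l hl => hΓ.go_ne_opp_go b l k]; rfl)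
      (fun k hk => ⟨kron_ne (hΓ.go_ne b (by omega)), kron_ne (dif dab 0 k).symm⟩)
  have Kc : ∀ k, 1 ≤ k → K (Γ.lo (Γ.go c k)) = K (Γ.li c) :=
    ray1 c (fun k hk => by
      simp only [hfo]; rw [rayFrom_eq_zero (s := a).2 fun l hl h => nac l k hl hk
        (by rw [h, Γ.opp_opp]), rayFrom_eq_zero.2 fun l hl h => nbc l k hl hk
        (by rw [h, Γ.opp_opp])]; rfl)
      (fun k hk => ⟨kron_ne (dif dbc 0 k).symm, kron_ne (dif dac 0 k).symm⟩)
  have foa : ∀ k, 1 ≤ k → fo (Γ.go a k) = -1 := fun k hk => by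
    simp only [hfo]; rw [rayFrom_go hk, rayFrom_eq_zero.2 fun l _ => (dif dab k l).symm]; rfl
  have fob : ∀ k, 1 ≤ k → fo (Γ.go b k) = 1 := fun k hk => by
    simp only [hfo]; rw [rayFrom_go hk, rayFrom_eq_zero.2 fun l _ => dif dab l k]; rfl
  have foc : ∀ k, 1 ≤ k → fo (Γ.go c k) = 0 := fun k hk => by
    simp only [hfo]; rw [rayFrom_eq_zero.2 fun l _ => dif dac l k,
      rayFrom_eq_zero.2 fun l _ => dif dbc l k]; rfl
  have la := hKl a
  have lb := hKl b
  have lc := hKl c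
  have ab : a ≠ b := dab 0
  have ac : a ≠ c := dac 0
  have bc : b ≠ c := dbc 0
  rw [kron_self, kron_ne ab] at la
  rw [kron_self, kron_ne ab.symm] at lb
  rw [kron_ne ac.symm, kron_ne bc.symm] at lc
  have sa := sl a
  have sb := sl b
  have sc := sl c
  rw [← hab] at sb
  rw [← hac] at sc
  -- With `x` the value of `σ` in the common region, far out `σ` takes the values `x - 1` left and
  -- `x` right of `a`, `x` left and `x - 1` right of `b`, and `x` on both sides of `c`.
  refine ⟨{r | σ (Γ.left a) ≤ σ r}, N, fun k hk => ?_, fun k hk => ?_, fun k hk => ?_, ?_⟩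
  · obtain ⟨j1, j2⟩ := hN a (by simp) k hk
    simp only [Set.mem_ofPred_eq]
    rw [sl (Γ.go a k), sr, j1, j2, foa k (by omega), Ka k (by omega)]; omega
  · obtain ⟨j1, j2⟩ := hN b (by simp) k hk
    simp only [Set.mem_ofPred_eq]
    rw [sl (Γ.go b k), sr, j1, j2, fob k (by omega), Kb k (by omega)]; omega
  · obtain ⟨j1, j2⟩ := hN c (by simp) k hk
    simp only [Set.mem_ofPred_eq]
    rw [sl (Γ.go c k), sr, j1, j2, foc k (by omega), Kc k (by omega)]; omega
  · refine ((finite_corner (Γ := Γ) hJ.finite).union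
      (((arc_support (Γ := Γ) a 1 N).union (arc_support (Γ := Γ) b 1 N)))).subset ?_
    rintro v ⟨h1, h2, h3⟩
    by_contra hc
    simp only [Set.mem_union, Set.mem_ofPred_eq, Function.mem_support, not_or, not_not] at hc
    have f0 : fo v = 0 := by
      simp only [hfo]
      rw [rayFrom_eq_zero.2 fun k hk e => ?_, rayFrom_eq_zero.2 fun k hk e => ?_]; · rfl
      · rcases lt_or_ge k N with h | h
        · exact arc_eq_zero.1 hc.2.1 k hk h e
        · exact h1 k h e
      · rcases lt_or_ge k N with h | h
        · exact arc_eq_zero.1 hc.2.2 k hk h e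
        · exact h2 k h e
    apply h3
    simp only [Set.mem_ofPred_eq]
    rw [sl v, sr v, f0, hc.1.1, hc.1.2, sub_zero]

end
end CurveSystem

/-! ### Cyclic order of angles -/

theorem btw_coe_angle {x y z : ℝ} : btw (x : Real.Angle) (y : Real.Angle) (z : Real.Angle) ↔
    toIcoMod Real.two_pi_pos x y ≤ toIocMod Real.two_pi_pos x z :=
  @QuotientAddGroup.btw_coe_iff ℝ _ _ _ _ (2 * π) ⟨Real.two_pi_pos⟩ x y z

theorem btw_coe_of_lt {x y z : ℝ} (hxy : x ≤ y) (hyz : y ≤ z) (hxz : z ≤ x + 2 * π) :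
    btw (x : Real.Angle) (y : Real.Angle) (z : Real.Angle) := by
  rw [btw_coe_angle]
  rcases hxy.eq_or_lt with rfl | hxy
  · rw [toIcoMod_apply_left]; exact (left_lt_toIocMod _ _ _).le
  rw [(toIocMod_eq_self Real.two_pi_pos).2 ⟨hxy.trans_le hyz, hxz⟩]
  refine le_trans ?_ hyz
  rcases lt_or_ge y (x + 2 * π) with h | h
  · rw [(toIcoMod_eq_self Real.two_pi_pos).2 ⟨hxy.le, h⟩]
  · exact (toIcoMod_lt_right _ _ _).le.trans h

/-! ### Sector functions and the single end of the surface -/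

namespace CurveSystem

variable {S C R : Type*} {Γ : CurveSystem S C R}

section
open scoped Classical

/-- A flow from the crossing of `s` to the crossing of `t`. -/
theorem exists_flow (s t : S) : ∃ p : S → ℤ, (Function.support p).Finite ∧ ∀ v,
    p v + p (Γ.opp v) - p (Γ.next⁻¹ v) - p (Γ.next⁻¹ (Γ.opp v)) =
      (kron v s + kron (Γ.opp v) s) - (kron v t + kron (Γ.opp v) t) := by
  have hk : ∀ u : S, (Function.support fun v => kron v u).Finite := fun u =>
    (Set.finite_singleton u).subset fun v hv => by
      by_contra h; exact hv (kron_ne h)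
  have hn : ∀ v u : S, kron (Γ.next⁻¹ v) u = kron v (Γ.next u) := fun v u => by
    simp only [kron]; congr 1; exact propext (Equiv.Perm.inv_eq_iff_eq (f := Γ.next))
  refine Γ.connected (fun t => ∃ p : S → ℤ, (Function.support p).Finite ∧ ∀ v,
    p v + p (Γ.opp v) - p (Γ.next⁻¹ v) - p (Γ.next⁻¹ (Γ.opp v)) =
      (kron v s + kron (Γ.opp v) s) - (kron v t + kron (Γ.opp v) t)) (fun t => ⟨?_, ?_⟩) ?_ s t
    ⟨0, by simp, fun v => by simp⟩
  · rintro ⟨p, hp, h⟩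
    refine ⟨fun v => p v + kron v t, (hp.union (hk t)).subset (Function.support_add _ _),
      fun v => ?_⟩
    have := h v
    simp only [hn]; linarith [kron_opp (Γ := Γ) v t]
  · rintro ⟨p, hp, h⟩
    refine ⟨fun v => p v - kron v t, (hp.union (hk t)).subset (Function.support_sub _ _),
      fun v => ?_⟩
    have := h v
    simp only [hn]; linarith [kron_opp (Γ := Γ) v t]
  · rintro t ⟨p, hp, h⟩
    refine ⟨p, hp, fun v => ?_⟩
    rw [h, kron_opp v t, kron_opp v (Γ.opp t), Γ.opp_opp]; ring

variable (Γ) in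
/-- The jump of a function on regions across a strand. -/
def jump (h : R → ℤ) (s : S) : ℤ := h (Γ.left s) - h (Γ.right s)

variable (Γ) in
/-- `h` is a sector function from the end of `a` to the end of `b`: it increases by one across the
ray of `b`, decreases by one across the ray of `a`, and jumps across finitely many other strands. -/
def IsSector (a b : S) (h : R → ℤ) : Prop :=
  {s | Γ.jump h s ≠ Γ.rayFrom b 0 s - Γ.rayFrom a 0 s}.Finite

theorem jump_isPot (h : R → ℤ) : Γ.IsPot (fun c => h (Γ.reg c)) (Γ.jump h) (Γ.jump h) :=
  fun s => ⟨rfl, by dsimp only; rw [Γ.reg_li, Γ.reg_ri]; rfl⟩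

theorem jump_cocycle (h : R → ℤ) (s : S) :
    Γ.jump h s + Γ.jump h (Γ.opp s) = Γ.jump h (Γ.next⁻¹ s) + Γ.jump h (Γ.next⁻¹ (Γ.opp s)) := by
  have := sum_corners (Γ := Γ) (fun c => h (Γ.reg c)) s
  simp only [Γ.reg_li, Γ.reg_ri] at this
  exact this

/-- The surface has one end. -/
theorem const_off_finite {h : R → ℤ} (hh : {s | Γ.jump h s ≠ 0}.Finite) :
    ∃ c, {r | h r ≠ c}.Finite := by
  rcases isEmpty_or_nonempty R with hR | ⟨⟨r₀⟩⟩
  · exact ⟨0, Set.toFinite _⟩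
  obtain ⟨σ, hσ, hs⟩ := Γ.finite_potential (Γ.jump h) hh (jump_cocycle h)
  have hc := Γ.const (fun r => h r - σ r) fun s => by have := hs s; simp only [jump, left, right] at this; linarith
  refine ⟨h r₀ - σ r₀, hσ.subset fun r hr hr' => hr ?_⟩
  have := hc r r₀
  simp only [hr'] at this; linarith

namespace Minimal

/-- Two rays alone violate the cocycle equation at their starting crossings. A finite flow from one
crossing to the other, available by connectedness, repairs this and changes only finitely many
jumps. -/
theorem exists_sector (hΓ : Γ.Minimal) (a b : S) : ∃ h : R → ℤ, Γ.IsSector a b h := by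
  obtain ⟨p, hp, hp'⟩ := exists_flow (Γ := Γ) a b
  obtain ⟨h, hh⟩ := Γ.potential (fun v => Γ.rayFrom b 0 v - Γ.rayFrom a 0 v + p v) (fun v => by
    have := hp' v
    simp only [rayFrom_inv]
    rw [hΓ.rayFrom_pred a 0 v, hΓ.rayFrom_pred b 0 v, hΓ.rayFrom_pred a 0 (Γ.opp v),
      hΓ.rayFrom_pred b 0 (Γ.opp v)]
    simp only [go_zero]; linarith)
  refine ⟨h, hp.subset fun s hs h0 => hs ?_⟩
  have := hh s
  simp only [h0] at this
  simpa [jump, left, right] using this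

/-- The jumps of a function are divergence-free, while a ray has a source at its start. Summing the
finitely supported difference over all strands cancels everything else and leaves `2 = 0`, each
crossing being counted from both of its strands. -/
theorem not_jump_ray (hΓ : Γ.Minimal) (h : R → ℤ) (b : S) : ¬ {s | Γ.jump h s ≠ Γ.rayFrom b 0 s}.Finite := by
  intro hf
  set q : S → ℤ := fun s => Γ.jump h s - Γ.rayFrom b 0 s with hq
  have hq' : Function.HasFiniteSupport q := hf.subset fun s hs h0 => hs (by simp [hq, h0])
  have hk : Function.HasFiniteSupport (fun v => kron v b) :=
    (Set.finite_singleton b).subset fun v hv => by by_contra h; exact hv (kron_ne h)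
  let e : Equiv.Perm S := ⟨Γ.opp, Γ.opp, Γ.opp_opp, Γ.opp_opp⟩
  have comp : ∀ (f : S → ℤ) (e : Equiv.Perm S), Function.HasFiniteSupport f →
      Function.HasFiniteSupport fun v => f (e v) := fun f e hf =>
    Set.Finite.preimage e.injective.injOn hf
  have key : ∀ v, q v + q (e v) + (kron v b + kron (e v) b) =
      q (Γ.next⁻¹ v) + q (Γ.next⁻¹ (e v)) := fun v => by
    have := jump_cocycle (Γ := Γ) h v
    simp only [hq, rayFrom_inv]
    rw [hΓ.rayFrom_pred b 0 v, hΓ.rayFrom_pred b 0 (e v)]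
    simp only [go_zero, e, Equiv.coe_fn_mk]; linarith
  have hs := finsum_congr key
  have f1 := comp q e hq'
  have f2 := comp _ e hk
  have f3 := comp q Γ.next⁻¹ hq'
  have f4 := comp _ e f3
  rw [finsum_add_distrib (f := fun v => q v + q (e v))
    (g := fun v => kron v b + kron (e v) b) (hq'.add f1) (hk.add f2),
    finsum_add_distrib hq' f1, finsum_add_distrib hk f2, finsum_add_distrib f3 f4,
    finsum_comp_equiv e (f := q), finsum_comp_equiv e (f := fun v => kron v b),
    finsum_comp_equiv e (f := fun v => q (Γ.next⁻¹ v)), finsum_comp_equiv Γ.next⁻¹ (f := q),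
    finsum_eq_single (fun v => kron v b) b (fun v hv => kron_ne hv), kron_self] at hs
  omega

theorem eventually_not_mem (hΓ : Γ.Minimal) (s : S) {F : Set S} (hF : F.Finite) :
    ∀ᶠ k : ℤ in Filter.atTop, Γ.go s k ∉ F := by
  obtain ⟨k, -, hk⟩ := exists_ge (hΓ.injective_go s) hF 0
  exact Filter.eventually_atTop.2 ⟨k, hk⟩

theorem eventually_right (hΓ : Γ.Minimal) (s : S) {F : Set R} (hF : F.Finite) :
    ∀ᶠ k : ℤ in Filter.atTop, Γ.right (Γ.go s k) ∉ F :=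
  hΓ.eventually_not_mem s (finite_right_set hF)

/-- The forward ends of two curves are eventually disjoint. -/
theorem eventually_not_cross (hΓ : Γ.Minimal) (a b : S) :
    ∀ᶠ k : ℤ in Filter.atTop, ∀ l, 0 ≤ l → Γ.go b l ≠ Γ.opp (Γ.go a k) := by
  by_cases h : ∃ k l : ℤ, 0 ≤ k ∧ 0 ≤ l ∧ Γ.go b l = Γ.opp (Γ.go a k)
  · obtain ⟨k0, l0, hk0, hl0, h0⟩ := h
    have hF : ((fun l => Γ.opp (Γ.go b l)) '' Set.Icc 0 l0).Finite := (Set.finite_Icc 0 l0).image _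
    filter_upwards [hΓ.eventually_not_mem a hF, Filter.eventually_gt_atTop k0] with k hk hk' l hl e
    -- After one common crossing of the forward rays, another one that lies later on both would
    -- complete a bigon.
    rcases le_or_gt l l0 with h | h
    · exact hk ⟨l, ⟨hl, h⟩, by simp only [e, Γ.opp_opp]⟩
    · have := hΓ.no_bigon (s := Γ.go a k0) (n := k - k0) (m := l - l0) (by omega) (by omega)
        (by rw [← h0, go_go, go_go, show l0 + (l - l0) = l by ring, e]; congr 2; ring)
      omega
  · push Not at h
    filter_upwards [Filter.eventually_ge_atTop 0] with k hk l hl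
    exact h k l hk hl

end Minimal

variable (Γ) in
/-- Far along the curve of `c` the function `h` is equal to `w` on the right and to `w + ε` on the
left. -/
def Far (h : R → ℤ) (c : S) (ε w : ℤ) : Prop :=
  ∀ᶠ k : ℤ in Filter.atTop, h (Γ.left (Γ.go c k)) = w + ε ∧ h (Γ.right (Γ.go c k)) = w

theorem Far.unique {h : R → ℤ} {c : S} {ε ε' w w' : ℤ} (h1 : Γ.Far h c ε w)
    (h2 : Γ.Far h c ε' w') : ε = ε' ∧ w = w' := by
  obtain ⟨k, ⟨h1, h2⟩, h3, h4⟩ := (h1.and h2).exists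
  omega

theorem Far.sub {h h' : R → ℤ} {c : S} {ε ε' w w' : ℤ} (h1 : Γ.Far h c ε w)
    (h2 : Γ.Far h' c ε' w') : Γ.Far (h - h') c (ε - ε') (w - w') := by
  filter_upwards [h1, h2] with k hk hk'
  simp only [Pi.sub_apply]; omega

theorem exists_far {h : R → ℤ} {c : S} {ε : ℤ}
    (h1 : ∀ᶠ k : ℤ in Filter.atTop, Γ.jump h (Γ.go c k) = ε)
    (h2 : ∀ᶠ k : ℤ in Filter.atTop, Γ.jump h (Γ.opp (Γ.go c k)) = 0)
    (h3 : ∀ᶠ k : ℤ in Filter.atTop, Γ.jump h (Γ.next⁻¹ (Γ.opp (Γ.go c k))) = 0) :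
    ∃ w, Γ.Far h c ε w := by
  obtain ⟨N, hN⟩ := Filter.eventually_atTop.1 (h1.and (h2.and h3))
  have := (jump_isPot (Γ := Γ) h).const_future (s := c) (a := N) (fun k hk => (hN k hk.le).2)
    (fun k hk => by rw [Γ.reg_li])
  refine ⟨h (Γ.left (Γ.go c N)) - ε, Filter.eventually_atTop.2 ⟨N, fun k hk => ?_⟩⟩
  have e1 := this k hk
  have e2 := (hN k hk).1
  simp only [jump, left] at e1 e2 ⊢
  constructor <;> linarith

theorem eventually_ray_self (a : S) : ∀ᶠ k : ℤ in Filter.atTop, Γ.rayFrom a 0 (Γ.go a k) = 1 := by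
  filter_upwards [Filter.eventually_ge_atTop 0] with k hk
  exact rayFrom_go hk

theorem ray_of_ne {a c : S} (h : ∀ k, Γ.go a k ≠ c) (k : ℤ) : Γ.rayFrom a 0 (Γ.go c k) = 0 :=
  rayFrom_eq_zero.2 fun l _ e => by rw [eq_comm, go_eq_iff] at e; exact h _ e.symm

/-- Far out, `h` passes between `m` and `m + 1` across the ray of `b` and between `m' - 1` and `m'`
across that of `a`. Truncation at level `n` therefore sees the ray of `b` only for `n = m + 1` and
that of `a` only for `n = m'`; the latter is excluded. -/
theorem level_jump {a b : S} {h : R → ℤ} (hh : Γ.IsSector a b h) {m m' : ℤ}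
    (hb : Γ.Far h b 1 m) (ha : Γ.Far h a (-1) m') (n : ℤ) (hn : m' ≠ n) {g : R → ℤ}
    (hg : g = fun r => if n ≤ h r then 1 else 0) :
    {s | Γ.jump g s ≠ if m + 1 = n then Γ.rayFrom b 0 s else 0}.Finite := by
  obtain ⟨N, hN⟩ := Filter.eventually_atTop.1 (hb.and ha)
  refine ((hh.union (arc_support (Γ := Γ) a 0 N)).union (arc_support (Γ := Γ) b 0 N)).subset
    fun s hs => ?_
  by_contra hc
  simp only [Set.mem_union, Set.mem_ofPred_eq, Function.mem_support, not_or, not_not] at hc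
  obtain ⟨⟨h1, h2⟩, h3⟩ := hc
  apply hs
  rw [arc_eq_zero] at h2 h3
  have hra : Γ.rayFrom a 0 s = 0 ∨ ∃ k, N ≤ k ∧ Γ.go a k = s := by
    by_cases h : ∃ k, 0 ≤ k ∧ Γ.go a k = s
    · obtain ⟨k, hk, e⟩ := h
      exact Or.inr ⟨k, not_lt.1 fun hl => h2 k hk hl e, e⟩
    · left; rw [rayFrom, if_neg h]
  have hrb : Γ.rayFrom b 0 s = 0 ∨ Γ.rayFrom b 0 s = 1 ∧ ∃ k, N ≤ k ∧ Γ.go b k = s := by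
    by_cases h : ∃ k, 0 ≤ k ∧ Γ.go b k = s
    · obtain ⟨k, hk, e⟩ := h
      exact Or.inr ⟨by rw [rayFrom, if_pos ⟨k, hk, e⟩], ⟨k, not_lt.1 fun hl => h3 k hk hl e, e⟩⟩
    · left; rw [rayFrom, if_neg h]
  simp only [jump, hg]
  rcases hrb with hb0 | ⟨hb1, k, hk, rfl⟩
  · rw [hb0]
    rcases hra with ha0 | ⟨k, hk, rfl⟩
    · rw [ha0, hb0, jump] at h1
      have : h (Γ.left s) = h (Γ.right s) := by linarith
      rw [this]; simp
    · have := (hN k hk).2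
      rw [this.1, this.2]
      split_ifs <;> omega
  · have := (hN k hk).1
    rw [this.1, this.2, hb1]
    split_ifs <;> omega

namespace Minimal

/-- Far out, the curve of `c` crosses neither ray and none of the finitely many exceptional strands,
so nothing changes the values beside it. -/
theorem sector_far (hΓ : Γ.Minimal) {a b : S} {h : R → ℤ} (hh : Γ.IsSector a b h) (c : S) {ε : ℤ}
    (hε : ∀ᶠ k : ℤ in Filter.atTop, Γ.rayFrom b 0 (Γ.go c k) - Γ.rayFrom a 0 (Γ.go c k) = ε) :
    ∃ w, Γ.Far h c ε w := by
  have hinj : Function.Injective Γ.opp := fun _ _ => opp_inj.1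
  have hs : ∀ s, ∀ᶠ k : ℤ in Filter.atTop, Γ.rayFrom s 0 (Γ.opp (Γ.go c k)) = 0 := fun s => by
    filter_upwards [hΓ.eventually_not_cross c s] with k hk
    exact rayFrom_eq_zero.2 hk
  have hs' : ∀ s, ∀ᶠ k : ℤ in Filter.atTop, Γ.rayFrom s 0 (Γ.next⁻¹ (Γ.opp (Γ.go c k))) = 0 :=
    fun s => by
      filter_upwards [hΓ.eventually_not_cross c s] with k hk
      rw [rayFrom_inv]
      exact rayFrom_eq_zero.2 fun l hl => hk l (by omega)
  refine exists_far ?_ ?_ ?_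
  · filter_upwards [hε, hΓ.eventually_not_mem c hh] with k hk hk'
    rw [← hk]; exact not_not.1 hk'
  · filter_upwards [hs a, hs b, hΓ.eventually_not_mem c (hh.preimage hinj.injOn)] with k ha hb hk
    have : Γ.jump h _ = _ := not_not.1 hk
    rw [this, ha, hb]; rfl
  · filter_upwards [hs' a, hs' b, hΓ.eventually_not_mem c
      (hh.preimage (f := fun s => Γ.next⁻¹ (Γ.opp s)) (Γ.next⁻¹.injective.comp hinj).injOn)]
      with k ha hb hk
    have : Γ.jump h _ = _ := not_not.1 hk
    rw [this, ha, hb]; rfl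

/-- Because the surface has one end, `h` is constant off a finite set of regions, which both curves
eventually leave. -/
theorem far_const (hΓ : Γ.Minimal) {h : R → ℤ} (hh : {s | Γ.jump h s ≠ 0}.Finite) {a b : S} {ε ε' w w' : ℤ}
    (ha : Γ.Far h a ε w) (hb : Γ.Far h b ε' w') : w = w' := by
  obtain ⟨c, hc⟩ := const_off_finite hh
  obtain ⟨k, ⟨-, h1⟩, h2⟩ := (ha.and (hΓ.eventually_right a hc)).exists
  obtain ⟨l, ⟨-, h3⟩, h4⟩ := (hb.and (hΓ.eventually_right b hc)).exists
  have h2 : h _ = c := not_not.1 h2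
  have h4 : h _ = c := not_not.1 h4
  rw [← h1, ← h3, h2, h4]

/-- Off a finite set, a sector function takes two values. -/
theorem sector_right (hΓ : Γ.Minimal) {a b : S} {h : R → ℤ} (hh : Γ.IsSector a b h) {m m' : ℤ}
    (hb : Γ.Far h b 1 m) (ha : Γ.Far h a (-1) m') : m' = m + 1 := by
  by_contra hne
  -- Otherwise the superlevel set at `m + 1` would have the ray of `b` as its only infinite
  -- boundary.
  have := level_jump hh hb ha (m + 1) hne rfl
  simp only [if_true] at this
  exact hΓ.not_jump_ray _ b this

/-- For a threshold different from `m + 1` the superlevel set has finitely many boundary strands, so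
`m` and `w` lie on the same side of it. The thresholds `m` and `m + 2` leave only the two values. -/
theorem sector_two (hΓ : Γ.Minimal) {a b : S} {h : R → ℤ} (hh : Γ.IsSector a b h) {m m' : ℤ}
    (hb : Γ.Far h b 1 m) (ha : Γ.Far h a (-1) m') {c : S} {w : ℤ} (hc : Γ.Far h c 0 w) :
    w = m ∨ w = m + 1 := by
  have hm := hΓ.sector_right hh hb ha
  have lev : ∀ n, n ≠ m + 1 → ((n ≤ m) ↔ (n ≤ w)) := fun n hn => by
    have h1 := level_jump hh hb ha n (by omega) rfl
    simp only [if_neg (show m + 1 ≠ n by omega)] at h1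
    have fb : Γ.Far (fun r => if n ≤ h r then 1 else 0) b 0 (if n ≤ m then 1 else 0) := by
      filter_upwards [hb] with k hk
      rw [hk.1, hk.2]; split_ifs <;> omega
    have fc : Γ.Far (fun r => if n ≤ h r then 1 else 0) c 0 (if n ≤ w then 1 else 0) := by
      filter_upwards [hc] with k hk
      rw [hk.1, hk.2]; simp
    have := hΓ.far_const h1 fb fc
    split_ifs at this <;> omega
  have h1 := lev m (by omega)
  have h2 := lev (m + 2) (by omega)
  omega

end Minimal
end
end CurveSystem

/-! ### Embedding the ends of the curves in the circle -/

namespace CurveSystem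

variable {S C R : Type*} {Γ : CurveSystem S C R}

section
open scoped Classical

theorem IsSector.sub {a b c : S} {h h' : R → ℤ} (hb : Γ.IsSector a b h) (hc : Γ.IsSector a c h') :
    Γ.IsSector b c (h' - h) := by
  refine (hb.union hc).subset fun s hs => ?_
  by_contra hn
  simp only [Set.mem_union, Set.mem_ofPred_eq, not_or, not_not] at hn
  refine hs ?_
  simp only [jump, Pi.sub_apply] at hn ⊢
  linarith

theorem Order.isSector {a b c : S} (h : Γ.Order a b c) (hab : ∀ k, Γ.go a k ≠ b) :
    ∃ g : R → ℤ, Γ.IsSector a b g ∧ Γ.Far g b 1 0 ∧ Γ.Far g c 0 1 := by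
  obtain ⟨A, N, ha, hb, hc, hf⟩ := h
  refine ⟨fun r => if r ∈ A then 1 else 0, ?_, ?_, ?_⟩
  -- The rays in `Order` start at time `N`, those in `IsSector` at time `0`; the strands in between
  -- form finite arcs.
  · refine ((hf.union (arc_support (Γ := Γ) a (min N 0) (max N 0))).union
      (arc_support (Γ := Γ) b (min N 0) (max N 0))).subset fun s hs => ?_
    by_contra hn
    simp only [Set.mem_union, Function.mem_support, not_or, not_not] at hn
    obtain ⟨⟨h1, h2⟩, h3⟩ := hn
    rw [arc_eq_zero] at h2 h3
    refine hs ?_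
    have dif : ∀ k l, Γ.go a k ≠ Γ.go b l := fun k l e => by
      rw [eq_comm, go_eq_iff] at e; exact hab _ e.symm
    simp only [jump]
    by_cases ea : ∃ k, 0 ≤ k ∧ Γ.go a k = s
    · obtain ⟨k, hk, rfl⟩ := ea
      have := ha k (not_lt.1 fun hl => h2 k (by omega) (by omega) rfl)
      rw [rayFrom_go hk, rayFrom_eq_zero.2 fun l _ => (dif k l).symm, if_neg this.1, if_pos this.2]
    · have ea0 : Γ.rayFrom a 0 s = 0 := by rw [rayFrom, if_neg ea]
      by_cases eb : ∃ k, 0 ≤ k ∧ Γ.go b k = s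
      · obtain ⟨k, hk, rfl⟩ := eb
        have := hb k (not_lt.1 fun hl => h3 k (by omega) (by omega) rfl)
        rw [ea0, rayFrom_go hk, if_pos this.1, if_neg this.2]
      · have eb0 : Γ.rayFrom b 0 s = 0 := by rw [rayFrom, if_neg eb]
        rw [ea0, eb0]
        have : Γ.left s ∈ A ↔ Γ.right s ∈ A := by
          by_contra hc
          refine h1 ⟨fun k hk e => ?_, fun k hk e => ?_, hc⟩
          · rcases le_or_gt 0 k with h | h
            · exact ea ⟨k, h, e⟩
            · exact h2 k (by omega) (by omega) e
          · rcases le_or_gt 0 k with h | h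
            · exact eb ⟨k, h, e⟩
            · exact h3 k (by omega) (by omega) e
        rw [if_congr this rfl rfl]; simp
  · refine Filter.eventually_atTop.2 ⟨N, fun k hk => ?_⟩
    have := hb k hk
    simp [this]
  · refine Filter.eventually_atTop.2 ⟨N, fun k hk => ?_⟩
    have := hc k hk
    simp [this]

theorem IsSector.add_const {a b : S} {h : R → ℤ} (hb : Γ.IsSector a b h) (c : ℤ) :
    Γ.IsSector a b fun r => h r - c := by
  simpa [IsSector, jump] using hb

/-- The curves of a minimal system have an injective angle map that respects the cyclic order of
their forward ends. -/
theorem Minimal.exists_monotone (hΓ : Γ.Minimal) {T : Type*} [Countable T] (rep : T → S)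
    (hrep : ∀ t u, t ≠ u → ∀ k, Γ.go (rep t) k ≠ rep u) :
    ∃ α : T → Real.Angle, Function.Injective α ∧ ∀ t u w, t ≠ u → u ≠ w → t ≠ w →
      Γ.Order (rep t) (rep u) (rep w) → btw (α t) (α u) (α w) := by
  rcases isEmpty_or_nonempty T with hT | ⟨⟨o⟩⟩
  · exact ⟨fun _ => 0, fun t => hT.elim t, fun t => hT.elim t⟩
  have hray : ∀ t u, ∀ᶠ k : ℤ in Filter.atTop,
      Γ.rayFrom (rep t) 0 (Γ.go (rep u) k) = if t = u then 1 else 0 := fun t u => by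
    by_cases h : t = u
    · subst h; simpa using eventually_ray_self (Γ := Γ) (rep t)
    · exact Filter.Eventually.of_forall fun k => by rw [ray_of_ne (hrep t u h), if_neg h]
  -- The base curve `o` cuts the circle of ends open. The sector function from `o` to `t` is
  -- normalised to be `0` far along the right of `t`; below, `r t u` is its value far along the
  -- right of `u`.
  have hφ : ∀ t, ∃ h : R → ℤ, Γ.IsSector (rep o) (rep t) h ∧
      (t ≠ o → Γ.Far h (rep t) 1 0) ∧ (t = o → h = 0) := fun t => by
    by_cases ht : t = o
    · subst ht
      exact ⟨0, by simp [IsSector, jump], fun h => absurd rfl h, fun _ => rfl⟩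
    · obtain ⟨h, hh⟩ := hΓ.exists_sector (rep o) (rep t)
      obtain ⟨w, hw⟩ := hΓ.sector_far hh (rep t) (ε := 1) (by
        filter_upwards [hray t t, hray o t] with k h1 h2
        rw [h1, h2, if_pos rfl, if_neg (Ne.symm ht)]; rfl)
      refine ⟨fun r => h r - w, hh.add_const w, fun _ => ?_, fun h => absurd h ht⟩
      filter_upwards [hw] with k hk
      rw [hk.1, hk.2]; omega
  choose φ hφs hφ1 hφ0 using hφ
  have hr : ∀ t u, ∃ w, Γ.Far (φ t) (rep u) ((if t = u then 1 else 0) - if o = u then 1 else 0) w :=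
    fun t u => hΓ.sector_far (hφs t) (rep u) (by
      filter_upwards [hray t u, hray o u] with k h1 h2
      rw [h1, h2])
  choose r hr using hr
  have r_o : ∀ u, r o u = 0 := fun u => by
    have h1 : Γ.Far (φ o) (rep u) 0 0 := by
      rw [hφ0 o rfl]; exact Filter.Eventually.of_forall fun k => by simp
    exact ((hr o u).unique h1).2
  have r_self : ∀ u, r u u = 0 := fun u => by
    by_cases hu : u = o
    · rw [hu, r_o]
    · exact ((hr u u).unique (hφ1 u hu)).2
  have far_b : ∀ t u, t ≠ u → Γ.Far (φ u - φ t) (rep u) 1 (-r t u) := fun t u h => by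
    have := (hr u u).sub (hr t u)
    simp only [if_neg h, if_true, r_self] at this
    convert this using 1 <;> ring
  have far_a : ∀ t u, t ≠ u → Γ.Far (φ u - φ t) (rep t) (-1) (r u t) := fun t u h => by
    have := (hr u t).sub (hr t t)
    simp only [if_neg h.symm, if_true, r_self] at this
    convert this using 1 <;> ring
  have far_c : ∀ t u w, t ≠ w → u ≠ w → Γ.Far (φ u - φ t) (rep w) 0 (r u w - r t w) :=
    fun t u w h1 h2 => by
      have := (hr u w).sub (hr t w)
      simp only [if_neg h1, if_neg h2] at this
      convert this using 1; ring
  -- Differences of sector functions based at `o` are sector functions between the two other curves,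
  -- so `sector_right` and `sector_two` apply to them.
  have hsum : ∀ t u, t ≠ u → r u t = -r t u + 1 := fun t u h =>
    hΓ.sector_right ((hφs t).sub (hφs u)) (far_b t u h) (far_a t u h)
  have htwo : ∀ t u w, t ≠ u → t ≠ w → u ≠ w →
      r u w - r t w = -r t u ∨ r u w - r t w = -r t u + 1 := fun t u w h1 h2 h3 =>
    hΓ.sector_two ((hφs t).sub (hφs u)) (far_b t u h1) (far_a t u h1) (far_c t u w h2 h3)
  have h01 : ∀ t u, t ≠ u → r t u = 0 ∨ r t u = 1 := fun t u h => by
    by_cases ht : t = o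
    · rw [ht, r_o]; simp
    by_cases hu : u = o
    · have := hsum o t (Ne.symm ht)
      rw [r_o] at this; rw [hu]; right; simpa using this
    · have := htwo o t u (Ne.symm ht) (Ne.symm hu) h
      rw [r_o, r_o] at this; simpa using this
  -- The sector given by `Order` and `φ u - φ t` have the same jumps up to finitely many. Their
  -- difference has the same limit along `u` and along `w`, which relates the three values of `r`.
  have hord : ∀ t u w, t ≠ u → u ≠ w → t ≠ w → Γ.Order (rep t) (rep u) (rep w) →
      r t u + r u w = 1 + r t w := fun t u w h1 h2 h3 h => by
    obtain ⟨g, hg, hgu, hgw⟩ := h.isSector (hrep t u h1)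
    have hs := (hφs t).sub (hφs u)
    have := hΓ.far_const (h := g - (φ u - φ t)) (by
      refine (hg.union hs).subset fun s hs => ?_
      by_contra hn
      simp only [Set.mem_union, Set.mem_ofPred_eq, not_or, not_not] at hn
      refine hs ?_
      simp only [jump, Pi.sub_apply] at hn ⊢
      linarith) (hgu.sub (far_b t u h1)) (hgw.sub (far_c t u w h3 h2))
    omega
  -- This says that the end of `u` lies counterclockwise between those of `t` and `o`; the base `o`
  -- is the last element.
  let lt : T → T → Prop := fun t u => r t u = 1
  have hirr : ∀ t, ¬ lt t t := fun t h => by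
    have : r t t = 1 := h
    rw [r_self] at this; omega
  have hsto : IsStrictTotalOrder T lt :=
    { irrefl := hirr
      trans := fun t u w h1 h2 => by
        have d1 : t ≠ u := fun h => by rw [h] at h1; exact hirr u h1
        have d2 : u ≠ w := fun h => by rw [h] at h2; exact hirr w h2
        have h1' : r t u = 1 := h1
        have h2' : r u w = 1 := h2
        have d3 : t ≠ w := fun h => by
          have := hsum t u d1; rw [h] at this h1'; omega
        have e1 := htwo t u w d1 d3 d2
        have e2 := h01 t w d3
        change r t w = 1
        omega
      trichotomous := fun t u h1 h2 => by
        by_contra h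
        have e1 := hsum t u h
        have e2 := h01 t u h
        have : ¬ (r t u = 1) := h1
        have : ¬ (r u t = 1) := h2
        omega }
  let _ : LinearOrder T := linearOrderOfSTO lt
  -- Countability gives a strictly monotone map to the line, and `2 * arctan` carries the line into
  -- `(-π, π)`, which injects into the circle. Cyclically ordered triples are rotations of
  -- increasing ones.
  obtain ⟨f⟩ := Order.embedding_from_countable_to_dense T ℝ
  have hlt : ∀ t u, r t u = 1 → f t < f u := fun t u h => f.lt_iff_lt.2 h
  set a : T → ℝ := fun t => 2 * Real.arctan (f t) with ha
  have hmono : ∀ t u, r t u = 1 → a t < a u := fun t u h => by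
    have := Real.arctan_strictMono (hlt t u h); simp only [ha]; linarith
  have hlo : ∀ t, -π < a t := fun t => by
    have := Real.neg_pi_div_two_lt_arctan (f t); simp only [ha]; linarith
  have hhi : ∀ t, a t < π := fun t => by
    have := Real.arctan_lt_pi_div_two (f t); simp only [ha]; linarith
  refine ⟨fun t => (a t : Real.Angle), fun t u h => ?_, fun t u w h1 h2 h3 h => ?_⟩
  · have h' := congrArg Real.Angle.toReal h
    rw [Real.Angle.toReal_coe_eq_self_iff.2 ⟨hlo t, (hhi t).le⟩,
      Real.Angle.toReal_coe_eq_self_iff.2 ⟨hlo u, (hhi u).le⟩] at h'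
    exact f.injective (Real.arctan_injective (by simpa [ha] using h'))
  · have key : ∀ x y z, r x y = 1 → r y z = 1 →
        btw (a x : Real.Angle) (a y : Real.Angle) (a z : Real.Angle) := fun x y z hxy hyz =>
      btw_coe_of_lt (hmono x y hxy).le (hmono y z hyz).le
        (by have := hlo x; have := hhi z; linarith)
    have e := hord t u w h1 h2 h3 h
    have e1 := h01 t u h1
    have e2 := h01 u w h2
    have e3 := h01 t w h3
    have f1 := hsum t u h1
    have f2 := hsum u w h2
    have f3 := hsum t w h3
    by_cases c1 : r t u = 1
    · by_cases c2 : r u w = 1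
      · exact key t u w c1 c2
      · exact btw_cyclic_left (key w t u (by omega) c1)
    · exact btw_cyclic_left (btw_cyclic_left (key u w t (by omega) (by omega)))

/-- The half-plane to the left of a curve. -/
theorem Minimal.exists_half (hΓ : Γ.Minimal) (a : S) : ∃ σ : R → ℤ,
    (∀ v, (∀ k, Γ.go a k ≠ v) → σ (Γ.left v) = σ (Γ.right v)) ∧
    (∀ k, σ (Γ.left (Γ.go a k)) = 1 ∧ σ (Γ.right (Γ.go a k)) = 0) ∧
    ∀ b, (∀ k, Γ.go a k ≠ b) → (∀ k l, Γ.go a k ≠ Γ.opp (Γ.go b l)) →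
      ∀ k, σ (Γ.left (Γ.go b k)) = σ (Γ.left b) ∧ σ (Γ.right (Γ.go b k)) = σ (Γ.left b) := by
  set f : S → ℤ := fun v => if ∃ k, Γ.go a k = v then 1 else 0 with hf
  have f0 : ∀ v, (∀ k, Γ.go a k ≠ v) → f v = 0 := fun v h => by
    simp only [hf]; rw [if_neg]; rintro ⟨k, hk⟩; exact h k hk
  have hf1 : ∀ v, f (Γ.next⁻¹ v) = f v := fun v => by
    simp only [hf]; congr 1
    refine propext ⟨fun ⟨k, hk⟩ => ⟨k + 1, ?_⟩, fun ⟨k, hk⟩ => ⟨k - 1, ?_⟩⟩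
    · rw [← next_go, hk]; simp
    · rw [← hk, inv_go]
  obtain ⟨σ', hσ'⟩ := Γ.potential f (fun v => by rw [hf1, hf1])
  set σ : R → ℤ := fun r => σ' r - σ' (Γ.right a) with hσd
  have hσ : ∀ v, σ (Γ.left v) - σ (Γ.right v) = f v := fun v => by
    rw [← hσ' v]; simp only [hσd, left, right]; ring
  have hpot : Γ.IsPot (fun c => σ (Γ.reg c)) f f := fun v =>
    ⟨hσ v, by dsimp only; rw [Γ.reg_li, Γ.reg_ri]; exact hσ v⟩
  have hconst : ∀ b, (∀ k l, Γ.go a k ≠ Γ.opp (Γ.go b l)) →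
      ∀ k, σ (Γ.left (Γ.go b k)) = σ (Γ.left b) := fun b hb k => by
    rcases le_total 0 k with hk | hk
    · exact hpot.const_future (s := b) (a := 0)
        (fun k _ => ⟨f0 _ fun l => hb l k, by rw [hf1]; exact f0 _ fun l => hb l k⟩)
        (fun k _ => by rw [Γ.reg_li]) k hk
    · exact hpot.const_past (s := b)
        (fun k _ => ⟨f0 _ fun l => hb l k, by rw [hf1]; exact f0 _ fun l => hb l k⟩)
        (fun k _ => by rw [Γ.reg_li]) k hk
  have fa : ∀ k, f (Γ.go a k) = 1 := fun k => by simp only [hf]; rw [if_pos ⟨k, rfl⟩]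
  refine ⟨σ, fun v hv => by have := hσ v; rw [f0 v hv] at this; omega, fun k => ?_,
    fun b hb hb' k => ⟨hconst b hb' k, ?_⟩⟩
  · have h1 := hσ (Γ.go a k)
    have h2 := hσ a
    have h3 := hconst a (fun k l => hΓ.go_ne_opp_go a k l) k
    have h4 : σ (Γ.right a) = 0 := by simp [hσd]
    have h5 := fa 0
    rw [fa] at h1
    rw [go_zero] at h5
    omega
  · have := hσ (Γ.go b k)
    rw [f0 _ fun l e => by rw [eq_comm, go_eq_iff] at e; exact hb _ e.symm, hconst b hb'] at this
    omega

end
end CurveSystem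

/-! ### Orbits of permutations -/

theorem Equiv.Perm.app_inv {E : Type*} (p : Equiv.Perm E) (x : E) : p (p⁻¹ x) = x :=
  p.apply_symm_apply x

theorem Equiv.Perm.inv_app {E : Type*} (p : Equiv.Perm E) (x : E) : p⁻¹ (p x) = x :=
  p.symm_apply_apply x

section Orbits

variable {E M : Type*} [AddCommMonoid M]

theorem Equiv.Perm.pow_minimalPeriod_apply (p : Equiv.Perm E) (x : E) :
    (p ^ Function.minimalPeriod p x) x = x := by
  rw [Equiv.Perm.coe_pow]
  exact Function.isPeriodicPt_minimalPeriod p x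

/-- The sum of a function over the orbit of a point. -/
noncomputable def orbitSum (p : Equiv.Perm E) (h : E → M) (x : E) : M :=
  ∑ i ∈ Finset.range (Function.minimalPeriod p x), h ((p ^ i) x)

theorem orbitSum_apply (p : Equiv.Perm E) (h : E → M) (x : E) :
    orbitSum p (fun y => h (p y)) x = orbitSum p h x := by
  have h1 := Finset.sum_range_succ (fun i => h ((p ^ i) x)) (Function.minimalPeriod p x)
  have h2 := Finset.sum_range_succ' (fun i => h ((p ^ i) x)) (Function.minimalPeriod p x)
  rcases Nat.eq_zero_or_pos (Function.minimalPeriod p x) with h0 | h0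
  · simp [orbitSum, h0]
  obtain ⟨n, hn⟩ := Nat.exists_eq_succ_of_ne_zero h0.ne'
  have key := p.pow_minimalPeriod_apply x
  rw [hn] at key
  simp only [orbitSum, hn, Nat.succ_eq_add_one] at *
  rw [Finset.sum_range_succ, Finset.sum_range_succ' (fun i => h ((p ^ i) x))]
  congr 1
  · refine Finset.sum_congr rfl fun i _ => ?_
    rw [pow_succ', Equiv.Perm.mul_apply]
  · rw [pow_zero, Equiv.Perm.one_apply, ← Equiv.Perm.mul_apply, ← pow_succ', key]

theorem orbitSum_inv_apply (p : Equiv.Perm E) (h : E → M) (x : E) :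
    orbitSum p (fun y => h (p⁻¹ y)) x = orbitSum p h x := by
  rw [← orbitSum_apply]; simp

theorem finite_sameCycle {p : Equiv.Perm E} {x : E} (hx : x ∈ Function.periodicPts p) :
    {y | p.SameCycle x y}.Finite := by
  have hpos := Function.minimalPeriod_pos_of_mem_periodicPts hx
  refine ((Set.finite_lt_nat (Function.minimalPeriod p x)).image fun i => (p ^ i) x).subset ?_
  rintro y ⟨i, rfl⟩
  have hn : (0 : ℤ) < Function.minimalPeriod p x := by exact_mod_cast hpos
  have h0 := Int.emod_nonneg i hn.ne'
  have h1 := Int.emod_lt_of_pos i hn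
  refine ⟨(i % Function.minimalPeriod p x).toNat, by simp only [Set.mem_ofPred_eq]; omega, ?_⟩
  have hk := p.pow_minimalPeriod_apply x
  rw [← zpow_natCast] at hk
  dsimp only
  rw [← zpow_natCast, Int.toNat_of_nonneg h0]
  conv_rhs => rw [← Int.emod_add_mul_ediv i (Function.minimalPeriod p x), zpow_add, zpow_mul,
    Equiv.Perm.mul_apply, Equiv.Perm.zpow_apply_eq_self_of_apply_eq_self hk]

theorem apply_eq_of_sameCycle {α : Type*} {p : Equiv.Perm E} {f : E → α} (hf : ∀ x, f (p x) = f x)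
    {x y : E} (h : p.SameCycle x y) : f x = f y := by
  obtain ⟨i, rfl⟩ := h
  have hf' : ∀ x, f (p⁻¹ x) = f x := fun x => by rw [← hf (p⁻¹ x)]; simp
  induction i using Int.induction_on with
  | zero => rfl
  | succ i ih => rw [add_comm, zpow_add, zpow_one, Equiv.Perm.mul_apply, hf]; exact ih
  | pred i ih => rw [sub_eq_neg_add, zpow_add, zpow_neg_one, Equiv.Perm.mul_apply, hf']; exact ih

end Orbits

/-! ### Potentials on the plane graph and its curve system -/

/-- The corners at the edge `e`: at its white end, in the face to its left, at its black end, and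
in the face to its right. -/
inductive EdgeCorner (E : Type*) where
  | white (e : E) : EdgeCorner E
  | left (e : E) : EdgeCorner E
  | black (e : E) : EdgeCorner E
  | right (e : E) : EdgeCorner E

namespace BipartitePlaneGraph

variable {E : Type*} (G : BipartitePlaneGraph E)

theorem rotF_apply (e : E) : G.rotF e = G.rotW⁻¹ (G.rotB⁻¹ e) := rfl

theorem rotF_rotB (e : E) : G.rotF (G.rotB e) = G.rotW⁻¹ e := by simp [rotF_apply]

@[simp] theorem rotW_rotF (e : E) : G.rotW (G.rotF e) = G.rotB⁻¹ e := by simp [rotF_apply]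

theorem induct {P : E → Prop} (hW : ∀ e, P e ↔ P (G.rotW e)) (hB : ∀ e, P e ↔ P (G.rotB e))
    {e₀ : E} (h : P e₀) (e : E) : P e := by
  have := G.connected
  obtain ⟨⟨g, hg⟩, rfl⟩ := MulAction.exists_smul_eq (Subgroup.closure {G.rotW, G.rotB}) e₀ e
  have : ∀ e, P e ↔ P (g e) := by
    induction hg using Subgroup.closure_induction with
    | mem x hx =>
      rcases hx with rfl | rfl
      · exact hW
      · exact hB
    | one => exact fun e => Iff.rfl
    | mul x y _ _ hx hy => exact fun e => (hy e).trans (hx (y e))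
    | inv x _ hx => exact fun e => by have := hx (x⁻¹ e); simp at this; exact this.symm
  exact (this e₀).1 h

section Potential

variable {c g q : E → ℤ}

/-- Discrete Stokes: `c` is the boundary of a finite 2-chain `n`, and summation by parts moves the
boundary operator to `g`. By `hg` the contribution of each face telescopes along its orbit, on which
`n` is constant. -/
theorem pairing_eq_zero (hc : (Function.support c).Finite) (hw : ∀ e, orbitSum G.rotW c e = 0)
    (hb : ∀ e, orbitSum G.rotB c e = 0)
    (hg : ∀ e, g e - g (G.rotB⁻¹ e) = q e - q (G.rotF e)) : ∑ᶠ e, c e * g e = 0 := by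
  obtain ⟨n, hn, hn', hcn⟩ := G.planar c hc hw hb
  have fin : ∀ (p : Equiv.Perm E) (r : E → ℤ), Function.HasFiniteSupport fun e => n (p e) * r e :=
    fun p r => (hn.preimage p.injective.injOn).subset fun e he h => he (by
      simp only at h ⊢; rw [h, zero_mul])
  have fin' : ∀ r : E → ℤ, Function.HasFiniteSupport fun e => n e * r e := fin 1
  have e1 : ∑ᶠ e, c e * g e = ∑ᶠ e, n e * g e - ∑ᶠ e, n (G.rotB e) * g e := by
    rw [← finsum_sub_distrib (fin' g) (fin G.rotB g)]
    exact finsum_congr fun e => by rw [hcn]; ring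
  have e2 : ∑ᶠ e, n (G.rotB e) * g e = ∑ᶠ e, n e * g (G.rotB⁻¹ e) := by
    rw [← finsum_comp_equiv G.rotB (f := fun e => n e * g (G.rotB⁻¹ e))]; simp
  have e3 : ∑ᶠ e, n e * q e = ∑ᶠ e, n e * q (G.rotF e) := by
    rw [← finsum_comp_equiv G.rotF (f := fun e => n e * q e)]
    exact finsum_congr fun e => by
      rw [show n (G.rotF e) = n e from hn' e]
  have e4 : ∑ᶠ e, n e * g e - ∑ᶠ e, n e * g (G.rotB⁻¹ e) =
      ∑ᶠ e, n e * q e - ∑ᶠ e, n e * q (G.rotF e) := by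
    rw [← finsum_sub_distrib (fin' g) (fin' fun e => g (G.rotB⁻¹ e)),
      ← finsum_sub_distrib (fin' q) (fin' fun e => q (G.rotF e))]
    exact finsum_congr fun e => by
      have := hg e; rw [← mul_sub, ← mul_sub, this]
  rw [e1, e2, e4, e3, sub_self]

-- An edge path from the white end of `e₀` to that of `e`, as a 1-chain: passing from `e` to `rotB
-- e` goes along one edge to the black vertex and back along the other.
open scoped Classical in
theorem exists_chain (e₀ e : E) : ∃ c : E → ℤ, (Function.support c).Finite ∧
    (∀ x, orbitSum G.rotW c x = orbitSum G.rotW (Pi.single e 1) x -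
      orbitSum G.rotW (Pi.single e₀ 1) x) ∧ ∀ x, orbitSum G.rotB c x = 0 := by
  have hs : ∀ (p : Equiv.Perm E) (e x : E), orbitSum p (Pi.single (p e) (1 : ℤ)) x =
      orbitSum p (Pi.single e 1) x := fun p e x => by
    rw [← orbitSum_apply]; congr 1; funext y; simp [Pi.single_apply]
  have hf : ∀ e : E, (Function.support (Pi.single e (1 : ℤ) : E → ℤ)).Finite := fun e =>
    (Set.finite_singleton e).subset Pi.support_single_subset
  have hadd : ∀ (p : Equiv.Perm E) (c d d' : E → ℤ) (x : E), orbitSum p (c + d - d') x =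
      orbitSum p c x + orbitSum p d x - orbitSum p d' x := fun p c d d' x => by
    simp [orbitSum, Finset.sum_add_distrib, Finset.sum_sub_distrib]
  refine G.induct (P := fun e => ∃ c : E → ℤ, (Function.support c).Finite ∧
    (∀ x, orbitSum G.rotW c x = orbitSum G.rotW (Pi.single e 1) x -
      orbitSum G.rotW (Pi.single e₀ 1) x) ∧ ∀ x, orbitSum G.rotB c x = 0)
    (fun e => by simp only [hs]) (fun e => ⟨?_, ?_⟩) (e₀ := e₀)
    ⟨0, by simp, by simp [orbitSum], by simp [orbitSum]⟩ e
  all_goals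
    rintro ⟨c, h1, h2, h3⟩
  · refine ⟨c + Pi.single (G.rotB e) 1 - Pi.single e 1, ?_, fun x => ?_, fun x => ?_⟩
    · exact ((h1.union (hf _)).subset (Function.support_add _ _)).union (hf e) |>.subset
        (Function.support_sub _ _)
    · rw [hadd, h2]; ring
    · rw [hadd, h3, hs]; ring
  · refine ⟨c + Pi.single e 1 - Pi.single (G.rotB e) 1, ?_, fun x => ?_, fun x => ?_⟩
    · exact ((h1.union (hf _)).subset (Function.support_add _ _)).union (hf (G.rotB e)) |>.subset
        (Function.support_sub _ _)
    · rw [hadd, h2]; ring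
    · rw [hadd, h3, hs]; ring

-- The potential is the integral of `g` along a path from a base vertex. Different choices of path
-- differ by cycles, on which `g` integrates to zero.
open scoped Classical in
theorem exists_white_potential
    (hg : ∀ e, g e - g (G.rotB⁻¹ e) = q e - q (G.rotF e)) : ∃ w : E → ℤ,
    (∀ e, w (G.rotW e) = w e) ∧ ∀ e, w (G.rotB e) - g (G.rotB e) = w e - g e := by
  obtain ⟨e₀⟩ := G.infinite.nonempty
  choose c hc hw hb using G.exists_chain e₀
  have hs : ∀ (p : Equiv.Perm E) (e x : E), orbitSum p (Pi.single (p e) (1 : ℤ)) x =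
      orbitSum p (Pi.single e 1) x := fun p e x => by
    rw [← orbitSum_apply]; congr 1; funext y; simp [Pi.single_apply]
  have hf : ∀ e : E, (Function.support (Pi.single e (1 : ℤ) : E → ℤ)).Finite := fun e =>
    (Set.finite_singleton e).subset Pi.support_single_subset
  have hsub : ∀ (p : Equiv.Perm E) (c d : E → ℤ) (x : E), orbitSum p (c - d) x =
      orbitSum p c x - orbitSum p d x := fun p c d x => by
    simp [orbitSum, Finset.sum_sub_distrib]
  have fin : ∀ {c : E → ℤ}, (Function.support c).Finite →
      Function.HasFiniteSupport fun e => c e * g e := fun hc =>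
    hc.subset fun e he h => he (by simp only at h ⊢; rw [h, zero_mul])
  have fsub : ∀ {c d : E → ℤ}, (Function.support c).Finite → (Function.support d).Finite →
      ∑ᶠ e, (c - d) e * g e = ∑ᶠ e, c e * g e - ∑ᶠ e, d e * g e := fun hc hd => by
    rw [← finsum_sub_distrib (fin hc) (fin hd)]
    exact finsum_congr fun e => by simp only [Pi.sub_apply]; ring
  have fone : ∀ e, ∑ᶠ x, (Pi.single e (1 : ℤ) : E → ℤ) x * g x = g e := fun e => by
    rw [finsum_eq_single _ e (fun x hx => by simp [hx])]; simp
  have fs : ∀ {c d : E → ℤ}, (Function.support c).Finite → (Function.support d).Finite →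
      (Function.support (c - d)).Finite := fun hc hd =>
    (hc.union hd).subset (Function.support_sub _ _)
  refine ⟨fun e => ∑ᶠ x, c e x * g x, fun e => ?_, fun e => ?_⟩
  · have := G.pairing_eq_zero (fs (hc (G.rotW e)) (hc e))
      (fun x => by rw [hsub, hw, hw, hs]; ring) (fun x => by rw [hsub, hb, hb, sub_self]) hg
    rw [fsub (hc _) (hc _)] at this
    exact sub_eq_zero.1 this
  · have := G.pairing_eq_zero (fs (fs (hc (G.rotB e)) (hf (G.rotB e))) (fs (hc e) (hf e)))
      (fun x => by rw [hsub, hsub, hsub, hw, hw]; ring)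
      (fun x => by rw [hsub, hsub, hsub, hb, hb, hs]; ring) hg
    rw [fsub (fs (hc _) (hf _)) (fs (hc _) (hf _)), fsub (hc _) (hf _), fsub (hc _) (hf _), fone,
      fone] at this
    exact sub_eq_zero.1 this

end Potential

/-- The two strands that start at an edge. -/
def oppStrand : Strand E → Strand E
  | .white e => .black e
  | .black e => .white e

variable {G} in
/-- A function on regions given by its values on white vertices, black vertices and faces. -/
def regionFun (w b f : E → ℤ) (hw : ∀ e, w (G.rotW e) = w e) (hb : ∀ e, b (G.rotB e) = b e)
    (hf : ∀ e, f (G.rotF e) = f e) : G.Region → ℤ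
  | .inl (.inl v) => Quotient.lift w (fun _ _ h => apply_eq_of_sameCycle hw h) v
  | .inl (.inr v) => Quotient.lift b (fun _ _ h => apply_eq_of_sameCycle hb h) v
  | .inr v => Quotient.lift f (fun _ _ h => apply_eq_of_sameCycle hf h) v

theorem next_white (e : E) : G.next (.white e) = .black (G.rotW e) := rfl
theorem next_black (e : E) : G.next (.black e) = .white (G.rotB⁻¹ e) := rfl
theorem inv_white (e : E) : G.next⁻¹ (.white e) = .black (G.rotB e) := rfl
theorem inv_black (e : E) : G.next⁻¹ (.black e) = .white (G.rotW⁻¹ e) := rfl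

variable {G} in
theorem white_eq_iff {e e' : E} : (Quotient.mk _ e : G.WhiteVertex) = Quotient.mk _ e' ↔
    G.rotW.SameCycle e e' := Quotient.eq
variable {G} in
theorem black_eq_iff {e e' : E} : (Quotient.mk _ e : G.BlackVertex) = Quotient.mk _ e' ↔
    G.rotB.SameCycle e e' := Quotient.eq
variable {G} in
theorem face_eq_iff {e e' : E} : (Quotient.mk _ e : G.Face) = Quotient.mk _ e' ↔
    G.rotF.SameCycle e e' := Quotient.eq

theorem exists_region (r : G.Region) : (∃ e, r = .inl (.inl (Quotient.mk _ e))) ∨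
    (∃ e, r = .inl (.inr (Quotient.mk _ e))) ∨ ∃ e, r = .inr (Quotient.mk _ e) := by
  rcases r with (v | v) | v
  all_goals
    induction v using Quotient.inductionOn with | _ e => ?_
  · exact Or.inl ⟨e, rfl⟩
  · exact Or.inr (Or.inl ⟨e, rfl⟩)
  · exact Or.inr (Or.inr ⟨e, rfl⟩)

theorem cocycle_black {f : Strand E → ℤ}
    (hf : ∀ s, f s + f (oppStrand s) = f (G.next⁻¹ s) + f (G.next⁻¹ (oppStrand s))) (e : E) :
    f (.white e) + f (.black e) = f (.black (G.rotB e)) + f (.white (G.rotW⁻¹ e)) :=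
  hf (.white e)

/-- Going from the white to the black end of `e` through the face on its left adds up the jumps of
both strands that start at `e`. The cocycle equation makes this sum telescope around faces, so it
integrates to values on white vertices; those on black vertices and faces are then forced. -/
theorem exists_potential {f : Strand E → ℤ}
    (hf : ∀ s, f s + f (oppStrand s) = f (G.next⁻¹ s) + f (G.next⁻¹ (oppStrand s))) :
    ∃ σ : G.Region → ℤ, ∀ s, σ (G.left s) - σ (G.right s) = f s := by
  have hg : ∀ e, (f (.white e) + f (.black e)) -
      (f (.white (G.rotB⁻¹ e)) + f (.black (G.rotB⁻¹ e))) =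
      f (.white e) - f (.white (G.rotF e)) := fun e => by
    have := G.cocycle_black hf (G.rotB⁻¹ e)
    rw [this, rotF_apply, G.rotB.app_inv]; ring
  obtain ⟨w, hw, hb⟩ := G.exists_white_potential
    (g := fun e => f (.white e) + f (.black e)) (q := fun e => f (.white e)) hg
  refine ⟨regionFun w (fun e => w e - (f (.white e) + f (.black e)))
    (fun e => w e - f (.white e)) hw hb (fun e => ?_), ?_⟩
  · have h1 := hb (G.rotB⁻¹ e)
    have h2 := hw (G.rotF e)
    have h3 := hg e
    simp only [rotW_rotF, Equiv.Perm.app_inv] at h1 h2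
    linarith
  · rintro (e | e)
    · change w e - (w e - f (.white e)) = _; ring
    · change (w e - f (.white e)) - (w e - (f (.white e) + f (.black e))) = _; ring

/-- The required difference between the two faces beside `e`, computed around the black end of `e`,
defines a finite 1-cycle. A finite 2-chain bounding it supplies the values on faces, which keeps the
potential finitely supported. -/
theorem exists_finite_potential {f : Strand E → ℤ} (hfin : (Function.support f).Finite)
    (hf : ∀ s, f s + f (oppStrand s) = f (G.next⁻¹ s) + f (G.next⁻¹ (oppStrand s))) :
    ∃ σ : G.Region → ℤ, (Function.support σ).Finite ∧
      ∀ s, σ (G.left s) - σ (G.right s) = f s := by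
  set c : E → ℤ := fun e => f (.black e) - f (.black (G.rotB e)) with hc
  have hc' : ∀ e, c e = f (.white (G.rotW⁻¹ e)) - f (.white e) := fun e => by
    have := G.cocycle_black hf e; simp only [hc]; linarith
  have fb : (Function.support fun e => f (.black e)).Finite :=
    hfin.preimage (f := Strand.black) (fun _ _ _ _ h => by cases h; rfl)
  have fw : (Function.support fun e => f (.white e)).Finite :=
    hfin.preimage (f := Strand.white) (fun _ _ _ _ h => by cases h; rfl)
  have hsub : ∀ (p : Equiv.Perm E) (c d : E → ℤ) (x : E), orbitSum p (fun e => c e - d e) x =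
      orbitSum p c x - orbitSum p d x := fun p c d x => by
    simp [orbitSum, Finset.sum_sub_distrib]
  obtain ⟨n, hn, hn', hcn⟩ := G.planar c
    ((fb.union (fb.preimage G.rotB.injective.injOn)).subset (Function.support_sub _ _))
    (fun e => by
      change orbitSum G.rotW c e = 0
      rw [show c = _ from funext hc', hsub,
        orbitSum_inv_apply G.rotW (fun e => f (.white e)), sub_self])
    (fun e => by
      change orbitSum G.rotB c e = 0
      rw [hc, hsub, orbitSum_apply G.rotB (fun e => f (.black e)), sub_self])
  have hnW : ∀ e, n (G.rotB e) = n (G.rotW⁻¹ e) := fun e => by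
    have := hn' (G.rotB e); simp at this; exact this.symm
  have hw : ∀ e, n (G.rotW e) + f (.white (G.rotW e)) = n e + f (.white e) := fun e => by
    have h1 := hcn (G.rotW e)
    rw [hc', hnW] at h1; simp at h1; linarith
  have hb : ∀ e, n (G.rotB e) - f (.black (G.rotB e)) = n e - f (.black e) := fun e => by
    have h1 := hcn e
    simp only [hc] at h1; linarith
  refine ⟨regionFun (fun e => n e + f (.white e)) (fun e => n e - f (.black e)) n hw hb hn',
    ?_, ?_⟩
  · refine (((((hn.union fw).image fun e => (.inl (.inl (Quotient.mk _ e)) : G.Region)).union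
      ((hn.union fb).image fun e => (.inl (.inr (Quotient.mk _ e)) : G.Region))).union
      (hn.image fun e => (.inr (Quotient.mk _ e) : G.Region)))).subset fun r hr => ?_
    rcases G.exists_region r with ⟨e, rfl⟩ | ⟨e, rfl⟩ | ⟨e, rfl⟩
    · exact Or.inl (Or.inl ⟨e, Function.support_add _ _ hr, rfl⟩)
    · exact Or.inl (Or.inr ⟨e, Function.support_sub _ _ hr, rfl⟩)
    · exact Or.inr ⟨e, hr, rfl⟩
  · rintro (e | e)
    · change (n e + f (.white e)) - n e = _; ring
    · change n e - (n e - f (.black e)) = _; ring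

theorem finite_strands (p : Strand E → Prop) (h1 : {e | p (.white e)}.Finite)
    (h2 : {e | p (.black e)}.Finite) : {s | p s}.Finite := by
  refine ((h1.image Strand.white).union (h2.image Strand.black)).subset ?_
  rintro (e | e) he
  · exact Or.inl ⟨e, he, rfl⟩
  · exact Or.inr ⟨e, he, rfl⟩

theorem finite_white_vertex (v : G.WhiteVertex) : {e | Quotient.mk _ e = v}.Finite := by
  induction v using Quotient.inductionOn with | _ e₀ => ?_
  exact (finite_sameCycle (G.finite_white e₀)).subset fun e he => (white_eq_iff.1 he).symm

theorem finite_black_vertex (v : G.BlackVertex) : {e | Quotient.mk _ e = v}.Finite := by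
  induction v using Quotient.inductionOn with | _ e₀ => ?_
  exact (finite_sameCycle (G.finite_black e₀)).subset fun e he => (black_eq_iff.1 he).symm

theorem finite_face_edges (v : G.Face) : {e | Quotient.mk _ e = v}.Finite := by
  induction v using Quotient.inductionOn with | _ e₀ => ?_
  exact (finite_sameCycle (G.finite_face e₀)).subset fun e he => (face_eq_iff.1 he).symm

theorem finite_left_strands (r : G.Region) : {s | G.left s = r}.Finite := by
  rcases r with (v | v) | v
  · exact finite_strands _ ((G.finite_white_vertex v).subset fun e he =>
      Sum.inl_injective (Sum.inl_injective he)) (Set.finite_empty.subset fun e he => by cases he)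
  · exact finite_strands _ (Set.finite_empty.subset fun e he => by cases he)
      (Set.finite_empty.subset fun e he => by cases he)
  · exact finite_strands _ (Set.finite_empty.subset fun e he => by cases he)
      ((G.finite_face_edges v).subset fun e he => Sum.inr_injective he)

theorem finite_right_strands (r : G.Region) : {s | G.right s = r}.Finite := by
  rcases r with (v | v) | v
  · exact finite_strands _ (Set.finite_empty.subset fun e he => by cases he)
      (Set.finite_empty.subset fun e he => by cases he)
  · exact finite_strands _ (Set.finite_empty.subset fun e he => by cases he)
      ((G.finite_black_vertex v).subset fun e he => Sum.inr_injective (Sum.inl_injective he))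
  · exact finite_strands _ ((G.finite_face_edges v).subset fun e he => Sum.inr_injective he)
      (Set.finite_empty.subset fun e he => by cases he)

theorem region_const {α : Type*} (σ : G.Region → α) (h : ∀ s, σ (G.left s) = σ (G.right s))
    (r r' : G.Region) : σ r = σ r' := by
  obtain ⟨e₀⟩ := G.infinite.nonempty
  have hW : ∀ e, σ (.inl (.inl (Quotient.mk _ (G.rotW e)))) = σ (.inl (.inl (Quotient.mk _ e))) :=
    fun e => by
      rw [white_eq_iff.2 (show G.rotW.SameCycle (G.rotW e) e from
        (Equiv.Perm.sameCycle_apply_left).2 (Equiv.Perm.SameCycle.refl _ _))]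
  have hWF : ∀ e, σ (.inl (.inl (Quotient.mk _ e))) = σ (.inr (Quotient.mk _ e)) := fun e =>
    h (.white e)
  have hFB : ∀ e, σ (.inr (Quotient.mk _ e)) = σ (.inl (.inr (Quotient.mk _ e))) := fun e =>
    h (.black e)
  have hB : ∀ e, σ (.inl (.inr (Quotient.mk _ (G.rotB e)))) = σ (.inl (.inr (Quotient.mk _ e))) :=
    fun e => by
      rw [black_eq_iff.2 (show G.rotB.SameCycle (G.rotB e) e from
        (Equiv.Perm.sameCycle_apply_left).2 (Equiv.Perm.SameCycle.refl _ _))]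
  have key := G.induct (P := fun e => σ (.inl (.inl (Quotient.mk _ e))) =
    σ (.inl (.inl (Quotient.mk _ e₀)))) (fun e => by rw [hW])
    (fun e => by rw [hWF (G.rotB e), hFB, hB, ← hFB, ← hWF]) (e₀ := e₀) rfl
  have all : ∀ r, σ r = σ (.inl (.inl (Quotient.mk _ e₀))) := fun r => by
    rcases G.exists_region r with ⟨e, rfl⟩ | ⟨e, rfl⟩ | ⟨e, rfl⟩
    · exact key e
    · rw [← hFB, ← hWF]; exact key e
    · rw [← hWF]; exact key e
  rw [all r, all r']

/-- The curve system formed by the train-tracks. -/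
def curves : CurveSystem (Strand E) (EdgeCorner E) G.Region where
  next := G.next
  opp := oppStrand
  pos
    | .white _ => True
    | .black _ => False
  lo
    | .white e => .white e
    | .black e => .left e
  li
    | .white e => .white (G.rotW e)
    | .black e => .right (G.rotB⁻¹ e)
  ro
    | .white e => .left e
    | .black e => .black e
  ri
    | .white e => .right (G.rotW e)
    | .black e => .black (G.rotB⁻¹ e)
  reg
    | .white e => .inl (.inl (Quotient.mk _ e))
    | .left e => .inr (Quotient.mk _ e)
    | .black e => .inl (.inr (Quotient.mk _ e))
    | .right e => .inr (Quotient.mk _ (G.rotB e))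
  opp_opp s := by cases s <;> rfl
  pos_opp s := by cases s <;> simp [oppStrand]
  ro_eq s hs := by cases s; · rfl
                   · exact hs.elim
  lo_eq s hs := by cases s; · simp [oppStrand, inv_black]
                   · exact hs.elim
  ro_opp s hs := by cases s; · simp [oppStrand, inv_white]
                    · exact hs.elim
  li_eq s hs := by cases s; · simp [oppStrand, inv_white, inv_black]
                   · exact hs.elim
  reg_li s := by
    cases s with
    | white e =>
      simp only
      rw [white_eq_iff.2 (Equiv.Perm.sameCycle_apply_left.2 (Equiv.Perm.SameCycle.refl _ _))]
    | black e =>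
      simp only
      rw [G.rotB.app_inv]
  reg_ri s := by
    cases s with
    | white e =>
      simp only
      rw [face_eq_iff.2 (show G.rotF.SameCycle (G.rotB (G.rotW e)) e from ⟨1, by simp [rotF_rotB]⟩)]
    | black e =>
      simp only
      rw [black_eq_iff.2 (show G.rotB.SameCycle (G.rotB⁻¹ e) e from ⟨1, by simp⟩)]
  finite_left r := (G.finite_left_strands r).subset fun s hs => by cases s <;> exact hs
  finite_right r := (G.finite_right_strands r).subset fun s hs => by cases s <;> exact hs
  connected P hn ho s t hs := by
    have hoo : ∀ e, P (.white e) ↔ P (.black e) := fun e => ⟨ho (.white e), ho (.black e)⟩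
    have hsrc : P (.white s.source) := by
      cases s
      · exact hs
      · exact (hoo _).2 hs
    have := G.induct (P := fun e => P (.white e))
      (fun e => (hn (.white e)).trans (hoo (G.rotW e)).symm)
      (fun e => by
        have := hn (.black (G.rotB e))
        rw [next_black] at this
        simp only [Equiv.Perm.inv_app] at this
        rw [← this, ← hoo]) hsrc t.source
    cases t
    · exact this
    · exact (hoo _).1 this
  const σ h := G.region_const σ fun s => by have := h s; cases s <;> exact this
  potential f hf := by
    obtain ⟨σ, h⟩ := G.exists_potential hf
    exact ⟨σ, fun s => by have := h s; cases s <;> exact this⟩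
  finite_potential f hfin hf := by
    obtain ⟨σ, h0, h⟩ := G.exists_finite_potential hfin hf
    exact ⟨σ, h0, fun s => by have := h s; cases s <;> exact this⟩

theorem curves_left (s : Strand E) : G.curves.left s = G.left s := by cases s <;> rfl
theorem curves_right (s : Strand E) : G.curves.right s = G.right s := by cases s <;> rfl

end BipartitePlaneGraph

/-! ### Cyclic positions in an orbit, and fans of strands -/

namespace CurveSystem

variable {S C R E : Type*} {Γ : CurveSystem S C R} {p : Equiv.Perm E}

/-- `j` is the indicator of the arc after `a` up to `b` in cyclically ordered orbits of `p`. -/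
structure IsArc (p : Equiv.Perm E) (a b : E) (j : E → ℤ) : Prop where
  finite : (Function.support j).Finite
  diff : ∀ y, j (p y) - j y = kron y a - kron y b

theorem IsArc.symm {a b : E} {j : E → ℤ} (h : IsArc p a b j) : IsArc p b a (-j) :=
  ⟨by simpa using h.1, fun y => by have := h.2 y; simp only [Pi.neg_apply]; linarith⟩

theorem IsArc.inv {a b : E} {j : E → ℤ} (h : IsArc p a b j) :
    IsArc p⁻¹ b a (fun y => j (p y)) :=
  ⟨h.1.preimage p.injective.injOn, fun y => by
    have := h.2 y; simp only [p.app_inv]; linarith⟩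

/-- `a` and `b` belong to the same orbit of `p` and are different. -/
def Pair (p : Equiv.Perm E) (a b : E) : Prop :=
  a ≠ b ∧ p.SameCycle a b ∧ ∃ j, IsArc p a b j ∧ j b = j a + 1

theorem Pair.symm {a b : E} (h : Pair p a b) : Pair p b a := by
  obtain ⟨hne, hs, j, h1, h2⟩ := h
  exact ⟨hne.symm, hs.symm, -j, h1.symm, by simp only [Pi.neg_apply]; omega⟩

theorem Pair.inv {a b : E} (h : Pair p a b) : Pair p⁻¹ a b := by
  obtain ⟨hne, hs, j, h1, h2⟩ := h
  refine Pair.symm ⟨hne.symm, Equiv.Perm.sameCycle_inv.2 hs.symm, _, h1.inv, ?_⟩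
  have e1 := h1.diff a
  have e2 := h1.diff b
  rw [kron_self, kron_ne hne] at e1
  rw [kron_self, kron_ne hne.symm] at e2
  omega

/-- `a`, `b`, `c` are in this cyclic order in an orbit of `p`. -/
def Between (p : Equiv.Perm E) (a b c : E) : Prop :=
  a ≠ b ∧ a ≠ c ∧ b ≠ c ∧ p.SameCycle a b ∧ p.SameCycle a c ∧
    ∃ j, IsArc p a b j ∧ j a = 0 ∧ j b = 1 ∧ j c = 0

theorem Between.inv {a b c : E} (h : Between p a b c) : Between p⁻¹ b a c := by
  obtain ⟨hab, hac, hbc, sab, sac, j, h1, h2, h3, h4⟩ := h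
  refine ⟨hab.symm, hbc, hac, Equiv.Perm.sameCycle_inv.2 sab.symm,
    Equiv.Perm.sameCycle_inv.2 (sab.symm.trans sac), _, h1.inv, ?_⟩
  have e1 := h1.diff a
  have e2 := h1.diff b
  have e3 := h1.diff c
  rw [kron_self, kron_ne hab] at e1
  rw [kron_self, kron_ne hab.symm] at e2
  rw [kron_ne hac.symm, kron_ne hbc.symm] at e3
  omega

/-- `a` and `c` separate `b` and `d` in an orbit of `p`. -/
def Sep (p : Equiv.Perm E) (a c b d : E) : Prop :=
  (a ≠ b ∧ a ≠ d ∧ c ≠ b ∧ c ≠ d) ∧ a ≠ c ∧ b ≠ d ∧ p.SameCycle a b ∧ p.SameCycle b d ∧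
    p.SameCycle a c ∧ ∃ j, IsArc p a c j ∧ j b ≠ j d

theorem Sep.inv {a b c d : E} (h : Sep p a c b d) : Sep p⁻¹ a c b d := by
  obtain ⟨⟨hab, had, hcb, hcd⟩, hac, hbd, sab, sbd, sac, j, h1, h2⟩ := h
  refine ⟨⟨hab, had, hcb, hcd⟩, hac, hbd, Equiv.Perm.sameCycle_inv.2 sab,
    Equiv.Perm.sameCycle_inv.2 sbd, Equiv.Perm.sameCycle_inv.2 sac, _, h1.inv.symm, ?_⟩
  have e1 := h1.diff b
  have e2 := h1.diff d
  rw [kron_ne hab.symm, kron_ne hcb.symm] at e1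
  rw [kron_ne had.symm, kron_ne hcd.symm] at e2
  simp only [Pi.neg_apply]; omega

theorem Sep.swap {a b c d : E} (h : Sep p a c b d) : Sep p c a b d := by
  obtain ⟨⟨hab, had, hcb, hcd⟩, hac, hbd, sab, sbd, sac, j, h1, h2⟩ := h
  exact ⟨⟨hcb, hcd, hab, had⟩, hac.symm, hbd, sac.symm.trans sab, sbd, sac.symm, -j, h1.symm, by simp only [Pi.neg_apply]; omega⟩

theorem Sep.swap' {a b c d : E} (h : Sep p a c b d) : Sep p a c d b := by
  obtain ⟨⟨hab, had, hcb, hcd⟩, hac, hbd, sab, sbd, sac, j, h1, h2⟩ := h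
  exact ⟨⟨had, hab, hcd, hcb⟩, hac, hbd.symm, sab.trans sbd, sbd.symm, sac, j, h1, h2.symm⟩

open scoped Classical in
theorem exists_arc {x : E} {i j : ℕ} (hij : i < j) (hj : j < Function.minimalPeriod p x) :
    ∃ a : E → ℤ, IsArc p ((p ^ i) x) ((p ^ j) x) a ∧ ∀ k < Function.minimalPeriod p x,
      a ((p ^ k) x) = if i < k ∧ k ≤ j then 1 else 0 := by
  have inj : ∀ k < Function.minimalPeriod p x, ∀ l < Function.minimalPeriod p x,
      (p ^ k) x = (p ^ l) x → k = l := fun k hk l hl h => by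
    simp only [Equiv.Perm.coe_pow] at h
    exact (Function.iterate_injOn_Iio_minimalPeriod (f := p) (x := x)) hk hl h
  -- Half-open on purpose: the step from `y` to `p y` passes the strand of `y`, so the indicator
  -- switches on after position `i` and off after position `j`.
  set a : E → ℤ := fun y => if ∃ k, i < k ∧ k ≤ j ∧ (p ^ k) x = y then 1 else 0 with ha
  have hval : ∀ k < Function.minimalPeriod p x, a ((p ^ k) x) = if i < k ∧ k ≤ j then 1 else 0 :=
    fun k hk => by
      simp only [ha]; congr 1
      refine propext ⟨fun ⟨l, h1, h2, h3⟩ => ?_, fun h => ⟨k, h.1, h.2, rfl⟩⟩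
      rw [← inj l (by omega) k hk h3]; exact ⟨h1, h2⟩
  refine ⟨a, ⟨?_, fun y => ?_⟩, hval⟩
  · refine ((Set.finite_Iic j).image fun k => (p ^ k) x).subset fun y hy => ?_
    simp only [ha, Function.mem_support, ne_eq, ite_eq_right_iff, one_ne_zero, imp_false,
      not_not] at hy
    obtain ⟨k, -, hk, rfl⟩ := hy
    exact ⟨k, hk, rfl⟩
  · by_cases hy : ∃ k < Function.minimalPeriod p x, (p ^ k) x = y
    · obtain ⟨k, hk, rfl⟩ := hy
      have hkr : ∀ l < Function.minimalPeriod p x, kron ((p ^ k) x) ((p ^ l) x) =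
          if k = l then 1 else 0 := fun l hl => by
        simp only [kron]; congr 1; exact propext ⟨inj k hk l hl, fun h => by rw [h]⟩
      rw [hval k hk, hkr i (by omega), hkr j hj, ← Equiv.Perm.mul_apply, ← pow_succ']
      rcases Nat.lt_or_ge (k + 1) (Function.minimalPeriod p x) with h | h
      · rw [hval _ h]; split_ifs <;> omega
      · rw [show k + 1 = Function.minimalPeriod p x by omega, p.pow_minimalPeriod_apply]
        have := hval 0 (by omega)
        rw [pow_zero, Equiv.Perm.one_apply] at this
        rw [this]; split_ifs <;> omega
    · have h1 : ∀ k < Function.minimalPeriod p x, y ≠ (p ^ k) x := fun k hk h => hy ⟨k, hk, h.symm⟩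
      have h2 : a y = 0 := by
        simp only [ha]; rw [if_neg]; rintro ⟨k, -, h3, h4⟩; exact h1 k (by omega) h4.symm
      have h3 : a (p y) = 0 := by
        simp only [ha]; rw [if_neg]; rintro ⟨k, h0, h3, h4⟩
        obtain ⟨l, rfl⟩ := Nat.exists_eq_succ_of_ne_zero (by omega : k ≠ 0)
        rw [pow_succ', Equiv.Perm.mul_apply] at h4
        exact h1 l (by omega) (p.injective h4).symm
      rw [h2, h3, kron_ne (h1 i (by omega)), kron_ne (h1 j hj)]

section Positions

variable {x : E}

theorem sameCycle_pow (i j : ℕ) : p.SameCycle ((p ^ i) x) ((p ^ j) x) := by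
  simp only [Equiv.Perm.sameCycle_pow_left, Equiv.Perm.sameCycle_pow_right]
  exact Equiv.Perm.SameCycle.refl _ _

theorem pow_ne {i j : ℕ} (hij : i < j) (hj : j < Function.minimalPeriod p x) :
    (p ^ i) x ≠ (p ^ j) x := fun h => by
  simp only [Equiv.Perm.coe_pow] at h
  have := (Function.iterate_injOn_Iio_minimalPeriod (f := p) (x := x))
    (show i < _ by omega) hj h
  omega

theorem pair_pow {i j : ℕ} (hij : i < j) (hj : j < Function.minimalPeriod p x) :
    Pair p ((p ^ i) x) ((p ^ j) x) := by
  obtain ⟨a, ha, h⟩ := exists_arc hij hj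
  refine ⟨pow_ne hij hj, sameCycle_pow _ _, a, ha, ?_⟩
  rw [h j hj, h i (by omega)]; split_ifs <;> omega

theorem between_pow {i j k : ℕ} (hij : i < j) (hjk : j < k)
    (hk : k < Function.minimalPeriod p x) : Between p ((p ^ i) x) ((p ^ j) x) ((p ^ k) x) := by
  obtain ⟨a, ha, h⟩ := exists_arc (p := p) (x := x) hij (by omega)
  refine ⟨pow_ne hij (by omega), pow_ne (by omega) hk, pow_ne hjk hk, sameCycle_pow _ _,
    sameCycle_pow _ _, a, ha, ?_⟩
  rw [h i (by omega), h j (by omega), h k hk]; split_ifs <;> omega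

theorem sep_pow {i j k l : ℕ} (hij : i < j) (hjk : j < k) (hkl : k < l)
    (hl : l < Function.minimalPeriod p x) :
    Sep p ((p ^ i) x) ((p ^ k) x) ((p ^ j) x) ((p ^ l) x) := by
  obtain ⟨a, ha, h⟩ := exists_arc (p := p) (x := x) (show i < k by omega) (by omega)
  refine ⟨⟨pow_ne hij (by omega), pow_ne (by omega) hl, (pow_ne hjk (by omega)).symm,
    pow_ne hkl hl⟩, pow_ne (by omega) (by omega), pow_ne (by omega) hl, sameCycle_pow _ _,
    sameCycle_pow _ _, sameCycle_pow _ _, a, ha, ?_⟩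
  rw [h j (by omega), h l hl]; split_ifs <;> omega

end Positions

variable (Γ) in
/-- The strands `st e`, for `e` in an orbit of `p`, are strands around a region that lies to their
left, in the cyclic order given by `p`. -/
structure Fan (p : Equiv.Perm E) (st : E → S) : Prop where
  inj : Function.Injective st
  left : ∀ e, Γ.left (st (p e)) = Γ.left (st e)
  lift : ∀ j : E → ℤ, (Function.support j).Finite → ∃ J : C → ℤ, (Function.support J).Finite ∧
    (∀ e, J (Γ.lo (st e)) = j e) ∧ (∀ e, J (Γ.li (st e)) = j (p e)) ∧
    (∀ v, (∀ e, st e ≠ v) → J (Γ.li v) = J (Γ.lo v)) ∧ ∀ v, J (Γ.ri v) = J (Γ.ro v)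

namespace Fan

variable {st : E → S}

theorem exists_chord (F : Γ.Fan p st) {a b : E} {j : E → ℤ} (h : IsArc p a b j) :
    ∃ J : C → ℤ, Γ.Chord J (st a) (st b) ∧ ∀ e, J (Γ.lo (st e)) = j e := by
  obtain ⟨J, h1, h2, h3, h4, h5⟩ := F.lift j h.finite
  refine ⟨J, ⟨h1, fun v => ?_, h5⟩, h2⟩
  have hk : ∀ e e' : E, kron (st e) (st e') = kron e e' := fun e e' => by
    simp only [kron]; congr 1; exact propext F.inj.eq_iff
  by_cases hv : ∃ e, st e = v
  · obtain ⟨e, rfl⟩ := hv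
    rw [h2, h3, h.diff, hk, hk]
  · push Not at hv
    rw [h4 v hv, kron_ne (hv a).symm, kron_ne (hv b).symm]; ring

theorem left_eq (F : Γ.Fan p st) {a b : E} (h : p.SameCycle a b) : Γ.left (st a) = Γ.left (st b) :=
  apply_eq_of_sameCycle (f := fun e => Γ.left (st e)) F.left h

theorem not_cross (F : Γ.Fan p st) (hΓ : Γ.Minimal) {a b : E} (h : Pair p a b)
    (hd : ∀ k, Γ.go (st a) k ≠ st b) (n m : ℤ) (hn : 1 ≤ n) (hm : 1 ≤ m) :
    Γ.go (st b) m ≠ Γ.opp (Γ.go (st a) n) := by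
  obtain ⟨hne, hs, j, h1, h2⟩ := h
  obtain ⟨J, hJ, hJ'⟩ := F.exists_chord h1
  exact hΓ.not_cross hJ (F.left_eq hs) (by rw [hJ', hJ']; omega) hd hn hm

theorem order (F : Γ.Fan p st) (hΓ : Γ.Minimal) {a b c : E} (h : Between p a b c) (hab : Pair p a b)
    (hac : Pair p a c) (hbc : Pair p b c) (dab : ∀ k, Γ.go (st a) k ≠ st b)
    (dac : ∀ k, Γ.go (st a) k ≠ st c) (dbc : ∀ k, Γ.go (st b) k ≠ st c) :
    Γ.Order (st a) (st b) (st c) := by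
  obtain ⟨-, -, -, sab, sac, j, h1, h2, h3, h4⟩ := h
  obtain ⟨J, hJ, hJ'⟩ := F.exists_chord h1
  exact hΓ.order_of_chord hJ (F.left_eq sab) (F.left_eq sac) (by rw [hJ', h2]) (by rw [hJ', h3])
    (by rw [hJ', h4]) dab dac dbc (F.not_cross hΓ hab dab) (F.not_cross hΓ hac dac)
    (F.not_cross hΓ hbc dbc)

theorem go_ne (F : Γ.Fan p st) (hΓ : Γ.Minimal) {a b : E} (h : Pair p a b)
    (hpos : ∀ e, Γ.pos (Γ.opp (Γ.next (st e)))) (k : ℤ) : Γ.go (st a) k ≠ st b := by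
  obtain ⟨hne, hs, j, h1, h2⟩ := h
  obtain ⟨J, hJ, hJ'⟩ := F.exists_chord h1
  exact hΓ.ne_go_of_chord (hpos a) (hpos b) (fun h => hne (F.inj h)) hJ k

theorem not_abab_of_lt (F : Γ.Fan p st) (hΓ : Γ.Minimal) {a b c d : E} (h : Sep p a c b d) (hab : Pair p a b)
    {k l : ℤ} (hk : 0 < k) (hl : 0 < l) (hac : Γ.go (st a) k = st c) (hbd : Γ.go (st b) l = st d)
    (hd : ∀ k, Γ.go (st a) k ≠ st b) : False := by
  obtain ⟨-, -, -, sab, sbd, -, j, h1, h2⟩ := h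
  obtain ⟨J, hJ, hJ'⟩ := F.exists_chord h1
  obtain ⟨-, -, j', h3, h4⟩ := hab
  obtain ⟨J', hJ₂, hJ₂'⟩ := F.exists_chord h3
  rw [← hac] at hJ
  exact hΓ.not_abab_aux (show 1 ≤ k by omega) (show 1 ≤ l by omega) hJ (F.left_eq sab)
    (by rw [hbd]; exact F.left_eq sbd) hd (by rw [hbd, hJ', hJ']; exact h2) hJ₂
    (by rw [hJ₂', hJ₂']; omega)

/-- `not_abab_of_lt` requires both returns to lie in the future. Exchanging the two visits of a
curve changes the sign of its time difference, and `Sep` is invariant under these exchanges. -/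
theorem not_abab (F : Γ.Fan p st) (hΓ : Γ.Minimal) {a b c d : E} (h : Sep p a c b d) (hab : Pair p a b)
    (had : Pair p a d) (hcb : Pair p c b) (hcd : Pair p c d) {k l : ℤ}
    (hac : Γ.go (st a) k = st c) (hbd : Γ.go (st b) l = st d)
    (hd : ∀ k, Γ.go (st a) k ≠ st b) : False := by
  have hk : k ≠ 0 := fun h0 => h.2.1 (F.inj (by rw [← hac, h0, go_zero]))
  have hl : l ≠ 0 := fun h0 => h.2.2.1 (F.inj (by rw [← hbd, h0, go_zero]))
  have hca : Γ.go (st c) (-k) = st a := by rw [← hac, go_go]; simp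
  have hdb : Γ.go (st d) (-l) = st b := by rw [← hbd, go_go]; simp
  have hd1 : ∀ i, Γ.go (st c) i ≠ st b := fun i => by rw [← hac, go_go]; exact hd _
  have hd2 : ∀ {t}, (∀ i, Γ.go t i ≠ st b) → ∀ i, Γ.go t i ≠ st d := fun ht i e =>
    ht (i - l) (by rw [sub_eq_add_neg, ← go_go, e, hdb])
  rcases hk.lt_or_gt with hk | hk <;> rcases hl.lt_or_gt with hl | hl
  · exact F.not_abab_of_lt hΓ h.swap.swap' hcd (by omega) (by omega) hca hdb (hd2 hd1)
  · exact F.not_abab_of_lt hΓ h.swap hcb (by omega) hl hca hbd hd1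
  · exact F.not_abab_of_lt hΓ h.swap' had hk (by omega) hac hdb (hd2 hd)
  · exact F.not_abab_of_lt hΓ h hab hk hl hac hbd hd

end Fan
end CurveSystem

/-! ### The four fans: white and black vertices, and both kinds of strands of a face -/

namespace BipartitePlaneGraph

open CurveSystem

variable {E : Type*} (G : BipartitePlaneGraph E)

theorem fan_white : G.curves.Fan G.rotW Strand.white where
  inj _ _ h := by cases h; rfl
  left e := by
    rw [curves_left, curves_left]
    exact congrArg (fun v => (Sum.inl (Sum.inl v) : G.Region)) (white_eq_iff.2
      (Equiv.Perm.sameCycle_apply_left.2 (Equiv.Perm.SameCycle.refl _ _)))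
  lift j hj := by
    refine ⟨fun | .white e => j e | _ => 0, ?_, fun e => rfl, fun e => rfl, ?_, ?_⟩
    · refine (hj.image EdgeCorner.white).subset ?_
      rintro (e | e | e | e) he
      · exact ⟨e, he, rfl⟩
      all_goals exact absurd rfl he
    · rintro (e | e) h
      · exact absurd rfl (h e)
      · rfl
    · rintro (e | e) <;> rfl

/-- A black strand has its vertex on the right and turns clockwise, so the fan lives in the mirror
image and runs along the inverse rotation. The white strands of a face, which have the face on their
right, are treated in the same way. -/
theorem fan_black : G.curves.mirror.Fan G.rotB⁻¹ Strand.black where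
  inj _ _ h := by cases h; rfl
  left e := by
    change G.right (.black _) = G.right (.black _)
    exact congrArg (fun v => (Sum.inl (Sum.inr v) : G.Region)) (black_eq_iff.2
      (show G.rotB.SameCycle (G.rotB⁻¹ e) e from ⟨1, by simp⟩))
  lift j hj := by
    refine ⟨fun | .black e => j e | _ => 0, ?_, fun e => rfl, fun e => rfl, ?_, ?_⟩
    · refine (hj.image EdgeCorner.black).subset ?_
      rintro (e | e | e | e) he
      any_goals exact absurd rfl he
      exact ⟨e, he, rfl⟩
    · rintro (e | e) h
      · rfl
      · exact absurd rfl (h e)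
    · rintro (e | e) <;> rfl

theorem fan_face_black : G.curves.Fan G.rotF Strand.black where
  inj _ _ h := by cases h; rfl
  left e := by
    change G.left (.black _) = G.left (.black _)
    exact congrArg (fun v => (Sum.inr v : G.Region)) (face_eq_iff.2
      (Equiv.Perm.sameCycle_apply_left.2 (Equiv.Perm.SameCycle.refl _ _)))
  lift j hj := by
    -- At its end, `black e` has on its left the `right` corner of `rotB⁻¹ e`; the shift by `rotW⁻¹`
    -- turns this label into `rotF e`.
    refine ⟨fun | .left e => j e | .right e => j (G.rotW⁻¹ e) | _ => 0, ?_, fun e => rfl,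
      fun e => rfl, ?_, ?_⟩
    · refine ((hj.image EdgeCorner.left).union
        ((hj.preimage G.rotW⁻¹.injective.injOn).image EdgeCorner.right)).subset ?_
      rintro (e | e | e | e) he
      any_goals exact absurd rfl he
      · exact Or.inl ⟨e, he, rfl⟩
      · exact Or.inr ⟨e, he, rfl⟩
    · rintro (e | e) h
      · rfl
      · exact absurd rfl (h e)
    · rintro (e | e)
      · exact congrArg j (G.rotW.inv_app e)
      · rfl

theorem fan_face_white : G.curves.mirror.Fan G.rotF⁻¹ Strand.white where
  inj _ _ h := by cases h; rfl
  left e := by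
    change G.right (.white _) = G.right (.white _)
    exact congrArg (fun v => (Sum.inr v : G.Region)) (face_eq_iff.2
      (show G.rotF.SameCycle (G.rotF⁻¹ e) e from ⟨1, by simp⟩))
  lift j hj := by
    refine ⟨fun | .left e => j e | .right e => j (G.rotB e) | _ => 0, ?_, fun e => rfl,
      fun e => ?_, ?_, ?_⟩
    · refine ((hj.image EdgeCorner.left).union
        ((hj.preimage G.rotB.injective.injOn).image EdgeCorner.right)).subset ?_
      rintro (e | e | e | e) he
      any_goals exact absurd rfl he
      · exact Or.inl ⟨e, he, rfl⟩
      · exact Or.inr ⟨e, he, rfl⟩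
    · rfl
    · rintro (e | e) h
      · exact absurd rfl (h e)
      · rfl
    · rintro (e | e)
      · rfl
      · exact congrArg j (G.rotB.app_inv e)

end BipartitePlaneGraph

/-! ### Monotone cyclic sequences of angles -/

section Cyclic

variable {E : Type*} {p : Equiv.Perm E} {x : E}

theorem Equiv.Perm.zpow_apply_eq_pow (p : Equiv.Perm E) {x : E}
    (hx : x ∈ Function.periodicPts p) (m : ℤ) :
    (p ^ m) x = (p ^ (m % Function.minimalPeriod p x).toNat) x := by
  have hn : (0 : ℤ) < Function.minimalPeriod p x := by
    exact_mod_cast Function.minimalPeriod_pos_of_mem_periodicPts hx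
  have hk := p.pow_minimalPeriod_apply x
  rw [← zpow_natCast] at hk
  rw [← zpow_natCast, Int.toNat_of_nonneg (Int.emod_nonneg m hn.ne')]
  conv_lhs => rw [← Int.emod_add_mul_ediv m (Function.minimalPeriod p x), zpow_add, zpow_mul,
    Equiv.Perm.mul_apply, Equiv.Perm.zpow_apply_eq_self_of_apply_eq_self hk]

theorem exists_pow_of_sameCycle (hx : x ∈ Function.periodicPts p) {y : E}
    (h : p.SameCycle x y) : ∃ i < Function.minimalPeriod p x, (p ^ i) x = y := by
  obtain ⟨m, rfl⟩ := h
  have hn : (0 : ℤ) < Function.minimalPeriod p x := by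
    exact_mod_cast Function.minimalPeriod_pos_of_mem_periodicPts hx
  have h0 := Int.emod_nonneg m hn.ne'
  have h1 := Int.emod_lt_of_pos m hn
  exact ⟨_, by omega, (p.zpow_apply_eq_pow hx m).symm⟩

/-- The finite lift is continued by adding `2π` per turn: the remainder is the position and the
quotient counts the turns. The comparison from the last position to the next turn is `h3`. -/
theorem cyclicMonotone_of_nat {f : E → Real.Angle} (hx : x ∈ Function.periodicPts p) (l : ℕ → ℝ)
    (h1 : ∀ k, k + 1 < Function.minimalPeriod p x → l k ≤ l (k + 1))
    (h2 : ∀ k < Function.minimalPeriod p x, (l k : Real.Angle) = f ((p ^ k) x))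
    (h3 : l (Function.minimalPeriod p x - 1) ≤ l 0 + 2 * π) :
    BipartitePlaneGraph.CyclicMonotone p f x := by
  have hn : (0 : ℤ) < Function.minimalPeriod p x := by
    exact_mod_cast Function.minimalPeriod_pos_of_mem_periodicPts hx
  have hmod : ∀ m : ℤ, (m % Function.minimalPeriod p x).toNat < Function.minimalPeriod p x :=
    fun m => by
      have h0 := Int.emod_nonneg m hn.ne'
      have h1 := Int.emod_lt_of_pos m hn
      omega
  refine ⟨fun m => l (m % Function.minimalPeriod p x).toNat +
    2 * π * (m / Function.minimalPeriod p x : ℤ), monotone_int_of_le_succ fun m => ?_,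
    fun m => ?_, fun m => ?_⟩
  · have h0 := Int.emod_nonneg m hn.ne'
    have h1' := Int.emod_lt_of_pos m hn
    have key := Int.emod_add_mul_ediv m (Function.minimalPeriod p x)
    set r := m % Function.minimalPeriod p x
    set q := m / Function.minimalPeriod p x
    rcases (show r + 1 ≤ _ from h1').lt_or_eq with h | h
    · obtain ⟨e1, e2⟩ : (m + 1) / (Function.minimalPeriod p x : ℤ) = q ∧
          (m + 1) % (Function.minimalPeriod p x : ℤ) = r + 1 :=
        (Int.ediv_emod_unique hn).2 ⟨by linarith, by omega, h⟩
      rw [e1, e2, show (r + 1).toNat = r.toNat + 1 by omega]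
      have := h1 r.toNat (by omega)
      linarith
    · obtain ⟨e1, e2⟩ : (m + 1) / (Function.minimalPeriod p x : ℤ) = q + 1 ∧
          (m + 1) % (Function.minimalPeriod p x : ℤ) = 0 :=
        (Int.ediv_emod_unique hn).2 ⟨by rw [mul_add]; linarith, le_rfl, hn⟩
      rw [e1, e2, show r.toNat = Function.minimalPeriod p x - 1 by omega]
      push_cast
      linarith
  · rw [p.zpow_apply_eq_pow hx, ← h2 _ (hmod m), Real.Angle.coe_add]
    have : ((2 * π * (m / Function.minimalPeriod p x : ℤ) : ℝ) : Real.Angle) = 0 := by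
      rw [mul_comm, ← zsmul_eq_mul, Real.Angle.coe_zsmul, Real.Angle.coe_two_pi, smul_zero]
    rw [this, add_zero]
  · dsimp only
    rw [Int.add_emod_right, Int.add_ediv_of_dvd_right (dvd_refl _), Int.ediv_self hn.ne']
    push_cast; ring

open BipartitePlaneGraph in
theorem angleLift_nonneg (θ : Real.Angle) : 0 ≤ angleLift θ := left_le_toIcoMod _ _ _

open BipartitePlaneGraph in
theorem angleLift_lt (θ : Real.Angle) : angleLift θ < 2 * π := by
  have := toIcoMod_lt_right Real.two_pi_pos 0 θ.toReal
  rwa [zero_add] at this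

open BipartitePlaneGraph in
theorem coe_angleLift (θ : Real.Angle) : (angleLift θ : Real.Angle) = θ := by
  rw [angleLift, Real.Angle.coe_toIcoMod, Real.Angle.coe_toReal]

open BipartitePlaneGraph in
theorem angleLift_coe {r : ℝ} (h0 : 0 ≤ r) (h1 : r < 2 * π) : angleLift r = r := by
  rw [angleLift, Real.Angle.toReal_coe, toIcoMod_toIocMod, toIcoMod_eq_self]
  exact ⟨h0, by rwa [zero_add]⟩

open BipartitePlaneGraph in
theorem angleLift_eq_zero {θ : Real.Angle} : angleLift θ = 0 ↔ θ = 0 :=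
  ⟨fun h => by rw [← coe_angleLift θ, h, Real.Angle.coe_zero], fun h => by
    rw [h, ← Real.Angle.coe_zero, angleLift_coe le_rfl Real.two_pi_pos]⟩

theorem le_of_btw_zero {a b : ℝ} (ha : 0 ≤ a) (ha' : a < 2 * π) (hb : 0 < b) (hb' : b < 2 * π)
    (h : btw ((0 : ℝ) : Real.Angle) (a : Real.Angle) (b : Real.Angle)) : a ≤ b := by
  rw [btw_coe_angle, (toIcoMod_eq_self Real.two_pi_pos).2 ⟨ha, by rwa [zero_add]⟩,
    (toIocMod_eq_self Real.two_pi_pos).2 ⟨hb, by rw [zero_add]; exact hb'.le⟩] at h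
  exact h

theorem btw_sub {a b c d : Real.Angle} (h : btw a b c) : btw (a - d) (b - d) (c - d) := by
  obtain ⟨a, rfl⟩ := QuotientAddGroup.mk_surjective a
  obtain ⟨b, rfl⟩ := QuotientAddGroup.mk_surjective b
  obtain ⟨c, rfl⟩ := QuotientAddGroup.mk_surjective c
  obtain ⟨d, rfl⟩ := QuotientAddGroup.mk_surjective d
  change btw (a : Real.Angle) (b : Real.Angle) (c : Real.Angle) at h
  change btw ((a : Real.Angle) - (d : Real.Angle)) ((b : Real.Angle) - (d : Real.Angle))
    ((c : Real.Angle) - (d : Real.Angle))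
  rw [← Real.Angle.coe_sub, ← Real.Angle.coe_sub, ← Real.Angle.coe_sub]
  rw [btw_coe_angle] at h ⊢
  rw [toIcoMod_sub_eq_sub, toIocMod_sub_eq_sub]
  simpa using h

open BipartitePlaneGraph in
/-- Finite cyclic sequences of angles with correctly ordered triples and without interlacing
pairs of equal values are monotone. -/
theorem cyclicMonotone_of_btw {f : E → Real.Angle} (hx : x ∈ Function.periodicPts p)
    (h3 : ∀ i j k, i < j → j < k → k < Function.minimalPeriod p x →
      btw (f ((p ^ i) x)) (f ((p ^ j) x)) (f ((p ^ k) x)))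
    (h4 : ∀ i j k l, i < j → j < k → k < l → l < Function.minimalPeriod p x →
      f ((p ^ i) x) = f ((p ^ k) x) → f ((p ^ j) x) = f ((p ^ l) x) →
      f ((p ^ i) x) = f ((p ^ j) x)) : CyclicMonotone p f x := by
  classical
  set d : ℕ → ℝ := fun i => angleLift (f ((p ^ i) x) - f x) with hd
  have d0 : d 0 = 0 := by simp [hd, angleLift_eq_zero]
  have dn : ∀ i, 0 ≤ d i := fun i => angleLift_nonneg _
  have dl : ∀ i, d i < 2 * π := fun i => angleLift_lt _
  have dc : ∀ i, (d i : Real.Angle) = f ((p ^ i) x) - f x := fun i => coe_angleLift _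
  have deq : ∀ {i j}, d i = d j → f ((p ^ i) x) = f ((p ^ j) x) := fun {i j} h => by
    have := congrArg (fun r : ℝ => (r : Real.Angle)) h
    simp only [dc] at this
    exact sub_left_injective this
  have h3' : ∀ i j k, i < j → j < k → k < Function.minimalPeriod p x →
      btw (d i : Real.Angle) (d j : Real.Angle) (d k : Real.Angle) := fun i j k hij hjk hk => by
    simp only [dc]; exact btw_sub (h3 i j k hij hjk hk)
  have hle : ∀ j k, j < k → k < Function.minimalPeriod p x → d k ≠ 0 → d j ≤ d k :=
    fun j k hjk hk hne => by
      rcases Nat.eq_zero_or_pos j with rfl | hj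
      · rw [d0]; exact dn k
      · have := h3' 0 j k hj hjk hk
        rw [d0] at this
        exact le_of_btw_zero (dn j) (dl j) ((dn k).lt_of_ne hne.symm) (dl k) this
  -- A value equal to that at `x` is lifted to `0` at first, but to `2 * π` once some other value
  -- has occurred.
  refine cyclicMonotone_of_nat hx (fun m => (f x).toReal +
    if d m = 0 ∧ ∃ j < m, d j ≠ 0 then 2 * π else d m) (fun m hm => ?_) (fun m hm => ?_) ?_
  · refine add_le_add le_rfl ?_
    by_cases c1 : d (m + 1) = 0 ∧ ∃ j < m + 1, d j ≠ 0
    · rw [if_pos c1]; split_ifs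
      · exact le_rfl
      · exact (dl m).le
    rw [if_neg c1]
    by_cases c2 : d m = 0 ∧ ∃ j < m, d j ≠ 0
    -- The sequence has come back to its first value at `m` and leaves it again. The triples `0, j,
    -- m + 1` and `j, m, m + 1` force equal values at `j` and `m + 1`, so the equal pairs `0, m` and
    -- `j, m + 1` interlace.
    · exfalso
      obtain ⟨e, j, hj, hne⟩ := c2
      have hne' : d (m + 1) ≠ 0 := fun h => c1 ⟨h, j, by omega, hne⟩
      have b1 := hle j (m + 1) (by omega) hm hne'
      have b2 := h3' j m (m + 1) hj (by omega) hm
      rw [e] at b2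
      have b3 := le_of_btw_zero (dn _) (dl _) ((dn j).lt_of_ne hne.symm) (dl j)
        (btw_cyclic_left b2)
      have hj0 : 0 < j := Nat.pos_of_ne_zero fun h => hne (by rw [h, d0])
      have := h4 0 j m (m + 1) hj0 hj (by omega) hm (deq (by rw [d0, e])) (deq (by linarith))
      apply hne
      simp only [pow_zero, Equiv.Perm.one_apply] at this
      simp only [hd]; rw [angleLift_eq_zero, ← this, sub_self]
    · rw [if_neg c2]
      by_cases c3 : d (m + 1) = 0
      · rw [c3]
        by_contra hc
        exact c1 ⟨c3, m, by omega, fun h => hc (by rw [h])⟩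
      · exact hle _ _ (by omega) hm c3
  · rw [Real.Angle.coe_add, Real.Angle.coe_toReal]
    split_ifs with h
    · have e := deq (h.1.trans d0.symm)
      simp only [pow_zero, Equiv.Perm.one_apply] at e
      rw [e, Real.Angle.coe_two_pi, add_zero]
    · rw [dc]; abel
  · have : (if d 0 = 0 ∧ ∃ j < 0, d j ≠ 0 then 2 * π else d 0) = 0 := by simp [d0]
    rw [this, add_zero]
    refine add_le_add le_rfl ?_
    split_ifs
    · exact le_rfl
    · exact (dl _).le

end Cyclic

/-! ### Consequences of the fan structure for strands at one region -/

namespace CurveSystem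

variable {S C R E : Type*} {Γ : CurveSystem S C R} {p : Equiv.Perm E} {st : E → S}

theorem pair_of_sameCycle {a b : E} (ha : a ∈ Function.periodicPts p) (h : p.SameCycle a b)
    (hne : a ≠ b) : Pair p a b := by
  obtain ⟨i, hi, rfl⟩ := exists_pow_of_sameCycle ha h
  have h0 : 0 < i := Nat.pos_of_ne_zero fun h => hne (by rw [h]; rfl)
  exact pair_pow (i := 0) h0 hi

variable (Γ) in
/-- The local picture at a region: triples of strands on different curves are correctly ordered,
and pairs of strands on two curves do not interlace. -/
structure FanOrder (p : Equiv.Perm E) (st : E → S) : Prop where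
  order : ∀ x i j k, i < j → j < k → k < Function.minimalPeriod p x →
    (∀ l, Γ.go (st ((p ^ i) x)) l ≠ st ((p ^ j) x)) →
    (∀ l, Γ.go (st ((p ^ i) x)) l ≠ st ((p ^ k) x)) →
    (∀ l, Γ.go (st ((p ^ j) x)) l ≠ st ((p ^ k) x)) →
    Γ.Order (st ((p ^ i) x)) (st ((p ^ j) x)) (st ((p ^ k) x))
  not_abab : ∀ x i j k l, i < j → j < k → k < l → l < Function.minimalPeriod p x → ∀ m n,
    Γ.go (st ((p ^ i) x)) m = st ((p ^ k) x) → Γ.go (st ((p ^ j) x)) n = st ((p ^ l) x) →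
    ∃ d, Γ.go (st ((p ^ i) x)) d = st ((p ^ j) x)

theorem go_symm {a b : S} (h : ∀ l, Γ.go a l ≠ b) (l : ℤ) : Γ.go b l ≠ a := fun e =>
  h (-l) (by rw [← e, go_go]; simp)

theorem Fan.fanOrder (F : Γ.Fan p st) (hΓ : Γ.Minimal) : Γ.FanOrder p st where
  order x i j k hij hjk hk h1 h2 h3 := F.order hΓ (between_pow hij hjk hk)
    (pair_pow hij (by omega)) (pair_pow (by omega) hk) (pair_pow hjk hk) h1 h2 h3
  not_abab x i j k l hij hjk hkl hl m n h1 h2 := by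
    by_contra hd
    push Not at hd
    exact F.not_abab hΓ (sep_pow hij hjk hkl hl) (pair_pow hij (by omega))
      (pair_pow (by omega) hl) (pair_pow hjk (by omega)).symm (pair_pow hkl hl) h1 h2 hd

theorem Fan.fanOrder_of_mirror (F : Γ.mirror.Fan p⁻¹ st) (hΓ : Γ.Minimal) : Γ.FanOrder p st where
  order x i j k hij hjk hk h1 h2 h3 := Order.of_mirror <|
    F.order hΓ.mirror (between_pow hij hjk hk).inv (pair_pow hij (by omega)).inv.symm
      (pair_pow hjk hk).inv (pair_pow (by omega) hk).inv (go_symm h1) h3 h2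
  not_abab x i j k l hij hjk hkl hl m n h1 h2 := by
    by_contra hd
    push Not at hd
    exact F.not_abab hΓ.mirror (sep_pow hij hjk hkl hl).inv (pair_pow hij (by omega)).inv
      (pair_pow (by omega) hl).inv (pair_pow hjk (by omega)).symm.inv (pair_pow hkl hl).inv h1 h2 hd

end CurveSystem

/-! ### From train-tracks to curve systems; non-emptiness of `X` -/

namespace BipartitePlaneGraph

open CurveSystem

variable {E : Type*} {G : BipartitePlaneGraph E}

theorem track_eq_iff {s t : Strand E} : G.track s = G.track t ↔ ∃ k, G.curves.go s k = t :=
  Quotient.eq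

theorem track_ne {s t : Strand E} (h : G.track s ≠ G.track t) (k : ℤ) : G.curves.go s k ≠ t :=
  fun e => h (track_eq_iff.2 ⟨k, e⟩)

theorem track_go (s : Strand E) (k : ℤ) : G.track (G.curves.go s k) = G.track s :=
  (track_eq_iff.2 ⟨k, rfl⟩).symm

theorem eq_or_eq_opp {s t : Strand E} (h : s.source = t.source) : s = t ∨ s = oppStrand t := by
  cases s <;> cases t <;> simp_all [Strand.source, oppStrand]

@[simp] theorem source_opp (s : Strand E) : (oppStrand s).source = s.source := by cases s <;> rfl

theorem hasSelfIntersection_of_opp {s : Strand E} (h : G.track s = G.track (oppStrand s)) :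
    G.HasSelfIntersection := by
  cases s with
  | white e => exact ⟨e, h⟩
  | black e => exact ⟨e, h.symm⟩

theorem leads_go (s : Strand E) {n : ℤ} (hn : 0 ≤ n) :
    G.Leads (G.track s) s.source (G.curves.go s n).source :=
  ⟨s, rfl, rfl, n.toNat, by rw [← zpow_natCast, Int.toNat_of_nonneg hn]; rfl⟩

theorem IsMinimal.curves (h : G.IsMinimal) : G.curves.Minimal where
  go_ne_opp s k hk := h.1 (hasSelfIntersection_of_opp (track_eq_iff.2 ⟨k, hk⟩))
  bigon s n m hn hm e := by
    by_contra hne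
    have hs : G.track s ≠ G.track (oppStrand s) := fun e => h.1 (hasSelfIntersection_of_opp e)
    refine h.2 ⟨_, _, s.source, (G.curves.go s n).source, hs, fun hx => ?_, leads_go s hn, ?_⟩
    · rcases eq_or_eq_opp hx with h' | h'
      · exact hne h'.symm
      · apply h.1
        refine hasSelfIntersection_of_opp (s := G.curves.go s n) ?_
        rw [← h', track_go]
    · have := leads_go (G := G) (oppStrand s) hm
      rw [source_opp] at this
      rw [show G.curves.go (oppStrand s) m = oppStrand (G.curves.go s n) from e, source_opp] at this
      exact this

/-- By connectedness every edge is the image of a fixed one under a finite word in the rotations.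
Countability is what allows the order of the train-tracks to be embedded in `ℝ`. -/
theorem countable_edges (G : BipartitePlaneGraph E) : Countable E := by
  have := G.infinite
  obtain ⟨e₀⟩ : Nonempty E := inferInstance
  let act : Bool × Bool → Equiv.Perm E := fun b =>
    if b.2 then (if b.1 then G.rotW else G.rotB) else (if b.1 then G.rotW⁻¹ else G.rotB⁻¹)
  refine Function.Surjective.countable (f := fun w : List (Bool × Bool) => (w.map act).prod e₀) ?_
  refine G.induct (P := fun e => ∃ w : List (Bool × Bool), (w.map act).prod e₀ = e)
    (fun e => ⟨fun ⟨w, hw⟩ => ⟨(true, true) :: w, ?_⟩, fun ⟨w, hw⟩ => ⟨(true, false) :: w, ?_⟩⟩)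
    (fun e => ⟨fun ⟨w, hw⟩ => ⟨(false, true) :: w, ?_⟩, fun ⟨w, hw⟩ => ⟨(false, false) :: w, ?_⟩⟩)
    (e₀ := e₀) ⟨[], rfl⟩
  all_goals
    rw [List.map_cons, List.prod_cons, Equiv.Perm.mul_apply, hw]
    simp [act]

theorem countable_tracks (G : BipartitePlaneGraph E) : Countable G.TrainTrack := by
  have := G.countable_edges
  refine Function.Surjective.countable
    (f := fun x : E ⊕ E => Sum.elim (fun e => G.track (.white e)) (fun e => G.track (.black e)) x) ?_
  intro t
  obtain ⟨s, rfl⟩ := Quotient.exists_rep t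
  cases s with
  | white e => exact ⟨.inl e, rfl⟩
  | black e => exact ⟨.inr e, rfl⟩

theorem mem_ray {s v : Strand E} : v ∈ G.ray s ↔ ∃ k : ℤ, 0 ≤ k ∧ G.curves.go s k = v := by
  constructor
  · rintro ⟨n, rfl⟩; exact ⟨n, by omega, by simp only [CurveSystem.go, zpow_natCast]; rfl⟩
  · rintro ⟨k, hk, rfl⟩
    exact ⟨k.toNat, by dsimp only; rw [← zpow_natCast, Int.toNat_of_nonneg hk]; rfl⟩

theorem outgoingOrder_of_order {a b c : Strand E} (h : G.curves.Order a b c) :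
    G.OutgoingOrder (G.track a) (G.track b) (G.track c) := by
  obtain ⟨A, N, h1, h2, h3, h4⟩ := h
  simp only [curves_left, curves_right] at h1 h2 h3 h4
  refine ⟨G.curves.go a N, G.curves.go b N, G.curves.go c N, A, track_go _ _, track_go _ _,
    track_go _ _, ?_, ?_, ?_, h4.subset ?_⟩
  · rintro s hs
    obtain ⟨k, hk, rfl⟩ := mem_ray.1 hs
    rw [go_go]; exact h1 _ (by omega)
  · rintro s hs
    obtain ⟨k, hk, rfl⟩ := mem_ray.1 hs
    rw [go_go]; exact h2 _ (by omega)
  · rintro s hs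
    obtain ⟨k, hk, rfl⟩ := mem_ray.1 hs
    rw [go_go]; exact h3 _ (by omega)
  · rintro s ⟨q1, q2, q3⟩
    refine ⟨fun k hk e => q1 (mem_ray.2 ⟨k - N, by omega, ?_⟩),
      fun k hk e => q2 (mem_ray.2 ⟨k - N, by omega, ?_⟩), q3⟩
    all_goals rw [go_go, ← e]; congr 1; ring

theorem order_of_outgoingOrder {a b c : Strand E}
    (h : G.OutgoingOrder (G.track a) (G.track b) (G.track c)) : G.curves.Order a b c := by
  obtain ⟨s, t, u, A, ha, hb, hc, h1, h2, h3, h4⟩ := h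
  obtain ⟨i, rfl⟩ := track_eq_iff.1 ha.symm
  obtain ⟨j, rfl⟩ := track_eq_iff.1 hb.symm
  obtain ⟨l, rfl⟩ := track_eq_iff.1 hc.symm
  have hr : ∀ (v : Strand E) (m k : ℤ), m ≤ k → G.curves.go v k ∈ G.ray (G.curves.go v m) :=
    fun v m k hk => mem_ray.2 ⟨k - m, by omega, by rw [go_go]; congr 1; ring⟩
  refine ⟨A, max i (max j l), fun k hk => ?_, fun k hk => ?_, fun k hk => ?_, ?_⟩
  · rw [curves_left, curves_right]; exact h1 _ (hr _ _ _ (by omega))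
  · rw [curves_left, curves_right]; exact h2 _ (hr _ _ _ (by omega))
  · rw [curves_left, curves_right]; exact h3 _ (hr _ _ _ (by omega))
  · refine ((h4.union ((Set.finite_Ico i (max i (max j l))).image (G.curves.go a))).union
      ((Set.finite_Ico j (max i (max j l))).image (G.curves.go b))).subset ?_
    rintro s ⟨q1, q2, q3⟩
    rw [curves_left, curves_right] at q3
    by_cases c1 : s ∈ G.ray (G.curves.go a i)
    · obtain ⟨k, hk, rfl⟩ := mem_ray.1 c1
      rw [go_go] at q1 ⊢
      refine Or.inl (Or.inr ⟨i + k, ⟨by omega, ?_⟩, rfl⟩)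
      by_contra hc; exact q1 (i + k) (by omega) rfl
    by_cases c2 : s ∈ G.ray (G.curves.go b j)
    · obtain ⟨k, hk, rfl⟩ := mem_ray.1 c2
      rw [go_go] at q2 ⊢
      refine Or.inr ⟨j + k, ⟨by omega, ?_⟩, rfl⟩
      by_contra hc; exact q2 (j + k) (by omega) rfl
    exact Or.inl (Or.inl ⟨c1, c2, q3⟩)

/-- The angle map supplied by `exists_monotone` is injective, so the conditions on intersecting and
anti-parallel pairs hold automatically. -/
theorem IsMinimal.nonempty_X (h : G.IsMinimal) : G.X.Nonempty := by
  have := G.countable_tracks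
  have hout : ∀ t : G.TrainTrack, G.track t.out = t := fun t => Quotient.out_eq t
  obtain ⟨α, h1, h2⟩ := h.curves.exists_monotone (fun t : G.TrainTrack => t.out)
    (fun t u htu k hk => htu (by rw [← hout t, ← hout u]; exact track_eq_iff.2 ⟨k, hk⟩))
  refine ⟨α, fun t u w ho => ?_, fun t u htu e => ?_⟩
  · by_cases c1 : t = u
    · rw [c1]; exact btw_refl_left _ _
    by_cases c2 : u = w
    · rw [c2]; exact btw_refl_right _ _
    by_cases c3 : t = w
    · rw [c3]; exact btw_refl_left_right _ _
    have := ho.2.2.2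
    rw [← hout t, ← hout u, ← hout w] at this
    exact h2 t u w c1 c2 c3 (order_of_outgoingOrder this)
  · have e := h1 e
    rcases htu with h | h | h
    · exact h.1 e
    · exact h.1 e
    · exact h.1.1 e

end BipartitePlaneGraph

/-! ### The inclusion of `X` in `Y` -/

namespace BipartitePlaneGraph

open CurveSystem

variable {E : Type*} {G : BipartitePlaneGraph E}

/-- Some region lies to the left of both strands, or to the right of both. -/
def SameSide (a b : Strand E) (G : BipartitePlaneGraph E) : Prop :=
  G.left a = G.left b ∨ G.right a = G.right b

/-- Distinct tracks beside one region either intersect or are disjoint. In the second case the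
region itself, as a path of length zero, shows that they are anti-parallel. -/
theorem ne_of_mem_X {α : G.TrainTrack → Real.Angle} (hα : α ∈ G.X) {a b : Strand E}
    (h : SameSide a b G) (hne : G.track a ≠ G.track b) : α (G.track a) ≠ α (G.track b) := by
  refine hα.2 _ _ ?_
  by_cases hc : ∃ e, G.Crosses (G.track a) e ∧ G.Crosses (G.track b) e
  · exact Or.inl ⟨hne, hc⟩
  · push Not at hc
    refine Or.inr (Or.inr ⟨⟨hne, fun e h => hc e h.1 h.2⟩, a, b, rfl, rfl, ?_⟩)
    rcases h with h | h
    · right; rw [h]; exact Relation.ReflTransGen.refl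
    · left; rw [h]; exact Relation.ReflTransGen.refl

/-- One of the two crossings precedes the other on `t`; agreement of the directions makes `u` lead
the same way, which is a parallel bigon. -/
theorem IsMinimal.leads_total (h : G.IsMinimal) {t u : G.TrainTrack} (htu : t ≠ u) {e e' : E}
    (hne : e ≠ e') (h1 : G.Crosses t e) (h2 : G.Crosses t e')
    (hl : ∀ x ∈ ({e, e'} : Set E), ∀ y ∈ ({e, e'} : Set E), (G.Leads t x y ↔ G.Leads u x y)) :
    False := by
  obtain ⟨s, rfl, rfl⟩ := h1
  obtain ⟨s', rfl, ht⟩ := h2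
  obtain ⟨k, rfl⟩ := track_eq_iff.1 ht.symm
  rcases le_total 0 k with hk | hk
  · have := leads_go (G := G) s hk
    exact h.2 ⟨_, _, _, _, htu, hne, this, (hl _ (by simp) _ (by simp)).1 this⟩
  · have := leads_go (G := G) (G.curves.go s k) (n := -k) (by omega)
    rw [track_go, go_go, add_neg_cancel, go_zero] at this
    exact h.2 ⟨_, _, _, _, htu, hne.symm, this, (hl _ (by simp) _ (by simp)).1 this⟩

theorem Joined.eq_of_forall {t u : G.TrainTrack} {r r' : G.Region} (h : G.Joined t u r r')
    {σ : G.Region → ℤ} (hσ : ∀ s, G.track s ≠ t → σ (G.left s) = σ (G.right s)) : σ r = σ r' := by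
  induction h with
  | refl => rfl
  | tail _ h ih =>
    obtain ⟨s, h1, -, ⟨rfl, rfl⟩ | ⟨rfl, rfl⟩⟩ := h
    · rw [ih, hσ s h1]
    · rw [ih, hσ s h1]

theorem Joined.symm {t u : G.TrainTrack} {r r' : G.Region} (h : G.Joined t u r r') :
    G.Joined u t r r' := by
  refine Relation.ReflTransGen.mono ?_ _ _ h
  rintro x y ⟨s, h1, h2, h3⟩
  exact ⟨s, h2, h1, h3⟩

/-- Infinitely many crossings in the same direction contain a parallel bigon. If the tracks are
disjoint, each lies in a half-plane of the other, and the common region shows that both are left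
halves or both are right halves. A path witnessing parallelism would join opposite sides without
crossing either track. -/
theorem IsMinimal.not_parallel (hG : G.IsMinimal) {a b : Strand E} (h : SameSide a b G)
    (hne : G.track a ≠ G.track b) : ¬ G.Parallel (G.track a) (G.track b) := by
  rintro (⟨-, X, hX, h1, h2⟩ | ⟨⟨-, hd⟩, s, t, hs, ht, hj⟩)
  · obtain ⟨e, he, e', he', hee⟩ := hX.nontrivial
    refine hG.leads_total hne hee (h1 e he).1 (h1 e' he').1 fun x hx y hy => h2 x ?_ y ?_
    · rcases hx with rfl | rfl <;> assumption
    · rcases hy with rfl | rfl <;> assumption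
  have hcross : ∀ {a b : Strand E}, (∀ e, ¬ (G.Crosses (G.track a) e ∧ G.Crosses (G.track b) e)) →
      ∀ k l, G.curves.go a k ≠ G.curves.opp (G.curves.go b l) := fun {a b} hd k l e =>
    hd (G.curves.go b l).source ⟨⟨G.curves.go a k, by
      rw [e]; exact source_opp _, track_go _ _⟩, ⟨_, rfl, track_go _ _⟩⟩
  have hd' : ∀ e, ¬ (G.Crosses (G.track b) e ∧ G.Crosses (G.track a) e) :=
    fun e h => hd e h.symm
  obtain ⟨σ, p1, p2, p3⟩ := hG.curves.exists_half a
  obtain ⟨τ, q1, q2, q3⟩ := hG.curves.exists_half b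
  replace p3 := p3 b (track_ne hne) (hcross hd)
  replace q3 := q3 a (track_ne hne.symm) (hcross hd')
  simp only [curves_left, curves_right] at p1 p2 p3 q1 q2 q3
  replace p1 : ∀ s, G.track s ≠ G.track a → σ (G.left s) = σ (G.right s) :=
    fun s hs => p1 s (track_ne hs.symm)
  replace q1 : ∀ s, G.track s ≠ G.track b → τ (G.left s) = τ (G.right s) :=
    fun s hs => q1 s (track_ne hs.symm)
  obtain ⟨k, rfl⟩ := track_eq_iff.1 hs.symm
  obtain ⟨l, rfl⟩ := track_eq_iff.1 ht.symm
  have a0 := p2 0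
  have b0 := q2 0
  have ab := p3 0
  have ba := q3 0
  have ak := p2 k
  have bl := q2 l
  have pl := p3 l
  have qk := q3 k
  simp only [go_zero] at a0 b0 ab ba
  rcases hj with hj | hj
  all_goals
    have e1 := hj.eq_of_forall p1
    have e2 := hj.symm.eq_of_forall q1
    rcases h with h | h
    all_goals
      have e3 := congrArg σ h
      have e4 := congrArg τ h
      omega

variable {α : G.TrainTrack → Real.Angle} {p : Equiv.Perm E} {st : E → Strand E} {x : E}

theorem IsMinimal.cyclicMonotone_of_mem_X (hG : G.IsMinimal) (hα : α ∈ G.X)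
    (F : G.curves.FanOrder p st) (hs : ∀ a b, p.SameCycle a b → SameSide (st a) (st b) G)
    (hx : x ∈ Function.periodicPts p) : CyclicMonotone p (fun e => α (G.track (st e))) x := by
  have hs' : ∀ i j : ℕ, SameSide (st ((p ^ i) x)) (st ((p ^ j) x)) G :=
    fun i j => hs _ _ (sameCycle_pow _ _)
  refine cyclicMonotone_of_btw hx (fun i j k hij hjk hk => ?_)
    (fun i j k l hij hjk hkl hl e1 e2 => ?_)
  · by_cases c1 : G.track (st ((p ^ i) x)) = G.track (st ((p ^ j) x))
    · rw [c1]; exact btw_refl_left _ _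
    by_cases c2 : G.track (st ((p ^ j) x)) = G.track (st ((p ^ k) x))
    · rw [c2]; exact btw_refl_right _ _
    by_cases c3 : G.track (st ((p ^ i) x)) = G.track (st ((p ^ k) x))
    · rw [c3]; exact btw_refl_left_right _ _
    exact hα.1 _ _ _ ⟨hG.not_parallel (hs' _ _) c1, hG.not_parallel (hs' _ _) c2,
      hG.not_parallel (hs' _ _) c3, outgoingOrder_of_order
        (F.order x i j k hij hjk hk (track_ne c1) (track_ne c3) (track_ne c2))⟩
  -- Equal angles at one region come only from equal tracks, so interlaced equal angles would be
  -- interlaced visits of two tracks.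
  · have key : ∀ i j, α (G.track (st ((p ^ i) x))) = α (G.track (st ((p ^ j) x))) →
        ∃ m, G.curves.go (st ((p ^ i) x)) m = st ((p ^ j) x) := fun i j e => by
      by_contra hc
      exact ne_of_mem_X hα (hs' i j) (fun h => hc (track_eq_iff.1 h)) e
    obtain ⟨m, hm⟩ := key _ _ e1
    obtain ⟨n, hn⟩ := key _ _ e2
    exact congrArg α (track_eq_iff.2 (F.not_abab x i j k l hij hjk hkl hl m n hm hn))

theorem nonconstant_of_forall_track (hα : α ∈ G.X)
    (hs : ∀ a b, p.SameCycle a b → SameSide (st a) (st b) G)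
    (h : ¬ ∀ y, p.SameCycle x y → G.track (st x) = G.track (st y)) :
    CyclicNonconstant p (fun e => α (G.track (st e))) x := by
  push Not at h
  obtain ⟨y, hy, hne⟩ := h
  exact ⟨x, y, Equiv.Perm.SameCycle.refl _ _, hy, ne_of_mem_X hα (hs _ _ hy) hne⟩

theorem left_white_eq {a b : E} (h : G.rotW.SameCycle a b) :
    G.left (.white a) = G.left (.white b) :=
  congrArg (fun v => (Sum.inl (Sum.inl v) : G.Region)) (white_eq_iff.2 h)

theorem right_black_eq {a b : E} (h : G.rotB.SameCycle a b) :
    G.right (.black a) = G.right (.black b) :=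
  congrArg (fun v => (Sum.inl (Sum.inr v) : G.Region)) (black_eq_iff.2 h)

theorem left_black_eq {a b : E} (h : G.rotF.SameCycle a b) :
    G.left (.black a) = G.left (.black b) :=
  congrArg (fun v => (Sum.inr v : G.Region)) (face_eq_iff.2 h)

theorem right_white_eq {a b : E} (h : G.rotF.SameCycle a b) :
    G.right (.white a) = G.right (.white b) :=
  congrArg (fun v => (Sum.inr v : G.Region)) (face_eq_iff.2 h)

/-- The white strands around a vertex belong to different train-tracks. -/
theorem IsMinimal.white_track_ne (hG : G.IsMinimal) {a b : E} (h : G.rotW.SameCycle a b)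
    (hne : a ≠ b) : G.track (.white a) ≠ G.track (.white b) := fun e => by
  obtain ⟨k, hk⟩ := track_eq_iff.1 e
  exact G.fan_white.go_ne hG.curves (pair_of_sameCycle (G.finite_white a) h hne)
    (fun _ => trivial) k hk

/-- The black strands around a vertex belong to different train-tracks. -/
theorem IsMinimal.black_track_ne (hG : G.IsMinimal) {a b : E} (h : G.rotB.SameCycle a b)
    (hne : a ≠ b) : G.track (.black a) ≠ G.track (.black b) := fun e => by
  obtain ⟨k, hk⟩ := track_eq_iff.1 e
  exact G.fan_black.go_ne hG.curves.mirror (pair_of_sameCycle (G.finite_black a) h hne).inv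
    (fun _ h => h) k hk

theorem IsMinimal.rotW_ne (hG : G.IsMinimal) (e : E) : G.rotW e ≠ e := fun h => hG.1 ⟨e,
  track_eq_iff.2 ⟨1, by change G.next _ = _; rw [next_white, h]⟩⟩

theorem IsMinimal.rotB_ne (hG : G.IsMinimal) (e : E) : G.rotB e ≠ e := fun h => hG.1 ⟨e,
  (track_eq_iff.2 ⟨1, by
    change G.next _ = _; rw [next_black, Equiv.Perm.inv_eq_iff_eq.2 h.symm]⟩).symm⟩

/-- If all these strands belonged to one track, its visit to `rotF y` would come strictly after its
visit to `y`: otherwise it would lead from the edge `rotF y` to `rotB⁻¹ y`, as the other track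
through `rotF y` does in one step. Strictly increasing times cannot return to the start after a full
turn. -/
theorem IsMinimal.not_face_black (hG : G.IsMinimal) (e : E) :
    ¬ ∀ y, G.rotF.SameCycle e y → G.track (.black e) = G.track (.black y) := fun h => by
  have h' : ∀ i : ℕ, ∃ k, G.curves.go (.black e) k = .black ((G.rotF ^ i) e) :=
    fun i => track_eq_iff.1 (h _ (by simpa using sameCycle_pow (p := G.rotF) (x := e) 0 i))
  choose k hk using h'
  have hstep : ∀ i, k i < k (i + 1) := fun i => by
    by_contra hc
    push Not at hc
    have h1 := hk (i + 1)
    rw [pow_succ', Equiv.Perm.mul_apply] at h1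
    have := hG.curves.no_bigon (s := .black (G.rotF ((G.rotF ^ i) e))) (n := k i + 1 - k (i + 1))
      (m := 1) (by omega) zero_le_one ?_
    · omega
    · rw [← h1, go_go, show k (i + 1) + (k i + 1 - k (i + 1)) = k i + 1 by ring, ← next_go, hk i, h1]
      change G.next (.white _) = oppStrand (G.next (.black _))
      rw [next_black, next_white, rotW_rotF]
      rfl
  have hmono : StrictMono k := strictMono_nat_of_lt_succ hstep
  have hn : 0 < Function.minimalPeriod G.rotF e :=
    Function.minimalPeriod_pos_of_mem_periodicPts (G.finite_face e)
  have e1 := hk (Function.minimalPeriod G.rotF e)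
  rw [Equiv.Perm.pow_minimalPeriod_apply] at e1
  have e0 := hk 0
  rw [pow_zero, Equiv.Perm.one_apply] at e0
  have := hG.curves.injective_go _ (e0.trans e1.symm)
  have := hmono hn
  omega

theorem IsMinimal.not_face_white (hG : G.IsMinimal) (e : E) :
    ¬ ∀ y, G.rotF.SameCycle e y → G.track (.white e) = G.track (.white y) := fun h => by
  have h' : ∀ i : ℕ, ∃ k, G.curves.go (.white e) k = .white ((G.rotF ^ i) e) :=
    fun i => track_eq_iff.1 (h _ (by simpa using sameCycle_pow (p := G.rotF) (x := e) 0 i))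
  choose k hk using h'
  -- White strands have the face on their right, so the times decrease; the forbidden bigon leads
  -- from `y` to `rotB⁻¹ y`.
  have hstep : ∀ i, k (i + 1) < k i := fun i => by
    by_contra hc
    push Not at hc
    have h1 := hk (i + 1)
    rw [pow_succ', Equiv.Perm.mul_apply] at h1
    have := hG.curves.no_bigon (s := .white ((G.rotF ^ i) e)) (n := k (i + 1) + 1 - k i)
      (m := 1) (by omega) zero_le_one ?_
    · omega
    · rw [← hk, go_go, show k i + (k (i + 1) + 1 - k i) = k (i + 1) + 1 by ring, ← next_go, h1, hk]
      change G.next (.black _) = oppStrand (G.next (.white _))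
      rw [next_black, next_white, rotW_rotF]
      rfl
  have hmono : StrictAnti k := strictAnti_nat_of_succ_lt hstep
  have hn : 0 < Function.minimalPeriod G.rotF e :=
    Function.minimalPeriod_pos_of_mem_periodicPts (G.finite_face e)
  have e1 := hk (Function.minimalPeriod G.rotF e)
  rw [Equiv.Perm.pow_minimalPeriod_apply] at e1
  have e0 := hk 0
  rw [pow_zero, Equiv.Perm.one_apply] at e0
  have := hG.curves.injective_go _ (e0.trans e1.symm)
  have := hmono hn
  omega

theorem IsMinimal.X_subset_Y (hG : G.IsMinimal) : G.X ⊆ G.Y := fun α hα e => by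
  have hw : ∀ a b, G.rotW.SameCycle a b → SameSide (.white a) (.white b) G :=
    fun a b h => Or.inl (left_white_eq h)
  have hb : ∀ a b, G.rotB.SameCycle a b → SameSide (.black a) (.black b) G :=
    fun a b h => Or.inr (right_black_eq h)
  have hfb : ∀ a b, G.rotF.SameCycle a b → SameSide (.black a) (.black b) G :=
    fun a b h => Or.inl (left_black_eq h)
  have hfw : ∀ a b, G.rotF.SameCycle a b → SameSide (.white a) (.white b) G :=
    fun a b h => Or.inr (right_white_eq h)
  have m := hG.curves
  refine ⟨⟨hG.cyclicMonotone_of_mem_X hα (G.fan_white.fanOrder m) hw (G.finite_white e),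
      fun a ha b hb' h => ?_, nonconstant_of_forall_track hα hw fun h => ?_⟩,
    ⟨hG.cyclicMonotone_of_mem_X hα (G.fan_black.fanOrder_of_mirror m) hb (G.finite_black e),
      fun a ha b hb' h => ?_, nonconstant_of_forall_track hα hb fun h => ?_⟩,
    ⟨hG.cyclicMonotone_of_mem_X hα (G.fan_face_black.fanOrder m) hfb (G.finite_face e),
      nonconstant_of_forall_track hα hfb (hG.not_face_black e)⟩,
    ⟨hG.cyclicMonotone_of_mem_X hα (G.fan_face_white.fanOrder_of_mirror m) hfw (G.finite_face e),
      nonconstant_of_forall_track hα hfw (hG.not_face_white e)⟩⟩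
  · by_contra hne
    have hc := Equiv.Perm.SameCycle.trans (Equiv.Perm.SameCycle.symm ha) hb'
    exact ne_of_mem_X hα (hw _ _ hc) (hG.white_track_ne hc hne) h
  · have hc : G.rotW.SameCycle e (G.rotW e) := ⟨1, by simp⟩
    exact hG.white_track_ne hc (hG.rotW_ne e).symm (h _ hc)
  · by_contra hne
    have hc := Equiv.Perm.SameCycle.trans (Equiv.Perm.SameCycle.symm ha) hb'
    exact ne_of_mem_X hα (hb _ _ hc) (hG.black_track_ne hc hne) h
  · have hc : G.rotB.SameCycle e (G.rotB e) := ⟨1, by simp⟩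
    exact hG.black_track_ne hc (hG.rotB_ne e).symm (h _ hc)

end BipartitePlaneGraph

/-! ### Increments of cyclic sequences -/

open BipartitePlaneGraph

section Increments

variable {E : Type*} {p : Equiv.Perm E} {f : E → Real.Angle} {x : E}

/-- The increase in `[0, 2π)` of a function along one step of a permutation. -/
noncomputable def increment (p : Equiv.Perm E) (f : E → Real.Angle) (y : E) : ℝ :=
  angleLift (f (p y) - f y)

theorem increment_nonneg (y : E) : 0 ≤ increment p f y := angleLift_nonneg _

theorem coe_increment (y : E) : (increment p f y : Real.Angle) = f (p y) - f y := coe_angleLift _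

/-- The steps of a monotone lift add up to `2π` and coincide with the increments unless one of them
is the whole of `2π`. In that case the lift is constant before and after this step, and all values
agree. -/
theorem sum_increment (h1 : CyclicMonotone p f x) (h2 : CyclicNonconstant p f x)
    (hx : x ∈ Function.periodicPts p) : orbitSum p (increment p f) x = 2 * π := by
  obtain ⟨l, hl, hl', hn⟩ := h1
  have hn0 := hn 0
  rw [zero_add] at hn0
  have hlast : ∑ k ∈ Finset.range (Function.minimalPeriod p x), (l ((k + 1 : ℕ) : ℤ) - l (k : ℤ)) =
      2 * π := by
    rw [Finset.sum_range_sub (fun k : ℕ => l (k : ℤ)), hn0]; simp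
  rw [orbitSum, ← hlast]
  refine Finset.sum_congr rfl fun k hk => ?_
  have hk := Finset.mem_range.1 hk
  have hstep : (increment p f ((p ^ k) x)) =
      angleLift ((l ((k + 1 : ℕ) : ℤ) - l (k : ℤ) : ℝ) : Real.Angle) := by
    rw [increment, Real.Angle.coe_sub, hl', hl', zpow_natCast, zpow_natCast, pow_succ',
      Equiv.Perm.mul_apply]
  rw [hstep]
  have h0 : l (k : ℤ) ≤ l ((k + 1 : ℕ) : ℤ) := hl (by omega)
  refine angleLift_coe (by linarith) ?_
  by_contra hc
  push Not at hc
  have hc1 : ∀ j < Function.minimalPeriod p x, f ((p ^ j) x) = f x := fun j hj => by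
    have e1 : l 0 ≤ l (j : ℤ) := hl (by omega)
    have e2 : l ((k + 1 : ℕ) : ℤ) ≤ l (Function.minimalPeriod p x) := hl (by omega)
    have e3 : l 0 ≤ l (k : ℤ) := hl (by omega)
    have e4 : l (j : ℤ) ≤ l (Function.minimalPeriod p x) := hl (by omega)
    have f0 := hl' 0
    rw [zpow_zero, Equiv.Perm.one_apply] at f0
    rw [← f0, ← zpow_natCast, ← hl' j]
    rcases le_or_gt j k with h | h
    · have e5 : l (j : ℤ) ≤ l (k : ℤ) := hl (by omega)
      rw [show l (j : ℤ) = l 0 by linarith]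
    · have e5 : l ((k + 1 : ℕ) : ℤ) ≤ l (j : ℤ) := hl (by omega)
      rw [show l (j : ℤ) = l 0 + 2 * π by linarith, Real.Angle.coe_add, Real.Angle.coe_two_pi,
        add_zero]
  obtain ⟨y, z, hy, hz, hne⟩ := h2
  obtain ⟨i, hi, rfl⟩ := exists_pow_of_sameCycle hx hy
  obtain ⟨j, hj, rfl⟩ := exists_pow_of_sameCycle hx hz
  exact hne ((hc1 i hi).trans (hc1 j hj).symm)

theorem coe_sum_increment (k : ℕ) :
    ((∑ i ∈ Finset.range k, increment p f ((p ^ i) x) : ℝ) : Real.Angle) = f ((p ^ k) x) - f x := by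
  induction k with
  | zero => simp
  | succ k ih =>
    rw [Finset.sum_range_succ, Real.Angle.coe_add, ih, coe_increment, pow_succ',
      Equiv.Perm.mul_apply]
    abel

/-- The partial sums of the increments are a monotone lift, and a constant sequence would have
increments summing to zero. -/
theorem cyclicMonotone_of_sum (hx : x ∈ Function.periodicPts p)
    (h : orbitSum p (increment p f) x = 2 * π) :
    CyclicMonotone p f x ∧ CyclicNonconstant p f x := by
  constructor
  · refine cyclicMonotone_of_nat hx
      (fun k => (f x).toReal + ∑ i ∈ Finset.range k, increment p f ((p ^ i) x))
      (fun k _ => ?_) (fun k _ => ?_) ?_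
    · rw [Finset.sum_range_succ]
      have := increment_nonneg (p := p) (f := f) ((p ^ k) x)
      linarith
    · rw [Real.Angle.coe_add, Real.Angle.coe_toReal, coe_sum_increment]; abel
    · rw [← h, Finset.sum_range_zero, add_zero]
      refine add_le_add le_rfl (Finset.sum_le_sum_of_subset_of_nonneg
        (Finset.range_mono (by omega)) fun _ _ _ => increment_nonneg _)
  · by_contra hc
    have : orbitSum p (increment p f) x = 0 := by
      refine Finset.sum_eq_zero fun i _ => ?_
      rw [increment, angleLift_eq_zero, sub_eq_zero]
      by_contra hne
      refine hc ⟨_, _, ⟨(i + 1 : ℕ), rfl⟩, ⟨i, rfl⟩, ?_⟩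
      rw [zpow_natCast, zpow_natCast, pow_succ', Equiv.Perm.mul_apply]
      exact hne
    have := Real.pi_pos
    linarith

/-- Partial sums over less than a full turn are strictly increasing within `[0, 2π)`, so they are
distinct as angles. -/
theorem cyclicInjective_of_pos (hx : x ∈ Function.periodicPts p)
    (h : orbitSum p (increment p f) x = 2 * π) (hpos : ∀ y, 0 < increment p f y) :
    CyclicInjective p f x := by
  have key : ∀ i j, i < j → j < Function.minimalPeriod p x →
      f ((p ^ i) x) ≠ f ((p ^ j) x) := fun i j hij hj e => by
    have e1 := coe_sum_increment (p := p) (f := f) (x := x) i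
    have e2 := coe_sum_increment (p := p) (f := f) (x := x) j
    rw [e, ← e2] at e1
    have hmono : StrictMono fun k => ∑ i ∈ Finset.range k, increment p f ((p ^ i) x) :=
      strictMono_nat_of_lt_succ fun k => by
        rw [Finset.sum_range_succ]; linarith [hpos ((p ^ k) x)]
    have m1 := hmono hij
    have m2 := hmono hj
    have m3 := hmono.monotone (Nat.zero_le i)
    simp only [Finset.sum_range_zero] at m1 m2 m3
    rw [orbitSum] at h
    rw [h] at m2
    have a1 := congrArg angleLift e1
    rw [angleLift_coe (by linarith) (by linarith), angleLift_coe (by linarith) (by linarith)] at a1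
    linarith
  intro y hy z hz e
  obtain ⟨i, hi, rfl⟩ := exists_pow_of_sameCycle hx hy
  obtain ⟨j, hj, rfl⟩ := exists_pow_of_sameCycle hx hz
  rcases lt_trichotomy i j with h | h | h
  · exact absurd e (key i j h hj)
  · rw [h]
  · exact absurd e.symm (key j i h hi)

theorem increment_pos_of_injective (h1 : CyclicInjective p f x) (h2 : CyclicNonconstant p f x) :
    0 < increment p f x := by
  refine (increment_nonneg x).lt_of_ne fun h => ?_
  rw [eq_comm, increment, angleLift_eq_zero, sub_eq_zero] at h
  have hx : p.SameCycle x x := Equiv.Perm.SameCycle.refl _ _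
  have e := h1 (show p.SameCycle x (p x) from ⟨1, by simp⟩) hx h
  obtain ⟨y, z, ⟨i, rfl⟩, ⟨j, rfl⟩, hne⟩ := h2
  rw [Equiv.Perm.zpow_apply_eq_self_of_apply_eq_self e,
    Equiv.Perm.zpow_apply_eq_self_of_apply_eq_self e] at hne
  exact hne rfl

theorem add_le_orbitSum {h : E → ℝ} (hx : x ∈ Function.periodicPts p) (h0 : ∀ y, 0 ≤ h y)
    (hne : p x ≠ x) : h x + h (p x) ≤ orbitSum p h x := by
  have hn := Function.minimalPeriod_pos_of_mem_periodicPts hx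
  have hn1 : Function.minimalPeriod p x ≠ 1 := fun e =>
    hne (Function.minimalPeriod_eq_one_iff_isFixedPt.1 e)
  have : ∑ i ∈ Finset.range 2, h ((p ^ i) x) ≤ orbitSum p h x :=
    Finset.sum_le_sum_of_subset_of_nonneg (Finset.range_mono (by omega)) fun _ _ _ => h0 _
  simpa [Finset.sum_range_succ] using this

theorem orbitSum_of_fixed {h : E → ℝ} (hx : p x = x) : orbitSum p h x = h x := by
  rw [orbitSum, Function.minimalPeriod_eq_one_iff_isFixedPt.2 hx]; simp

end Increments

/-! ### Minimal immersions and `Y` -/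

namespace BipartitePlaneGraph

variable {E : Type*} {G : BipartitePlaneGraph E} {α : G.TrainTrack → Real.Angle}

theorem track_next (s : Strand E) : G.track (G.next s) = G.track s :=
  track_go s 1

theorem track_black_rotW (e : E) : G.track (.black (G.rotW e)) = G.track (.white e) :=
  track_next (.white e)

theorem track_white_inv (e : E) : G.track (.white (G.rotB⁻¹ e)) = G.track (.black e) :=
  track_next (.black e)

theorem rhombusAngle_rotW (e : E) : G.rhombusAngle α (G.rotW e) =
    increment G.rotW (fun y => α (G.track (.white y))) e := by
  rw [rhombusAngle, track_black_rotW]; rfl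

theorem rhombusAngle_eq (e : E) : G.rhombusAngle α e =
    increment G.rotB (fun y => α (G.track (.black y))) e := by
  rw [rhombusAngle, increment, ← track_white_inv (G := G) (G.rotB e), Equiv.Perm.inv_app]

theorem orbitSum_rotW (e : E) : orbitSum G.rotW (G.rhombusAngle α) e =
    orbitSum G.rotW (increment G.rotW fun y => α (G.track (.white y))) e := by
  rw [← orbitSum_apply]; simp only [rhombusAngle_rotW]

theorem orbitSum_rotB (e : E) : orbitSum G.rotB (G.rhombusAngle α) e =
    orbitSum G.rotB (increment G.rotB fun y => α (G.track (.black y))) e := by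
  rw [funext rhombusAngle_eq]

section Local


/-- A single angle is less than `2π`, so the vertex has degree at least two and consecutive angles
are different terms of a positive sum equal to `2π`. This bound keeps the sums of two dual angles
non-negative. -/
theorem add_rotW_le (h0 : ∀ e, 0 < G.rhombusAngle α e) (hW : ∀ e, orbitSum G.rotW (G.rhombusAngle α) e = 2 * π) (e : E) :
    G.rhombusAngle α e + G.rhombusAngle α (G.rotW e) ≤ 2 * π := by
  by_cases h : G.rotW e = e
  · have := hW e
    rw [orbitSum_of_fixed h] at this
    exact absurd this (angleLift_lt _).ne
  · rw [← hW e]; exact add_le_orbitSum (G.finite_white e) (fun y => (h0 y).le) h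

theorem add_rotB_le (h0 : ∀ e, 0 < G.rhombusAngle α e) (hB : ∀ e, orbitSum G.rotB (G.rhombusAngle α) e = 2 * π) (e : E) :
    G.rhombusAngle α e + G.rhombusAngle α (G.rotB e) ≤ 2 * π := by
  by_cases h : G.rotB e = e
  · have := hB e
    rw [orbitSum_of_fixed h] at this
    exact absurd this (angleLift_lt _).ne
  · rw [← hB e]; exact add_le_orbitSum (G.finite_black e) (fun y => (h0 y).le) h

/-- Modulo `2π` both sides agree, since consecutive strands of a train-track have the same angle.
Positivity and the bound at the black vertex place the right side in `[0, 2π)`, where the lift is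
unique. -/
theorem increment_face_white (h0 : ∀ e, 0 < G.rhombusAngle α e) (hB : ∀ e, orbitSum G.rotB (G.rhombusAngle α) e = 2 * π) (e : E) :
    increment G.rotF (fun y => α (G.track (.white y))) e =
      (π - G.rhombusAngle α e) + (π - G.rhombusAngle α (G.rotB⁻¹ e)) := by
  have h1 := add_rotB_le h0 hB (G.rotB⁻¹ e)
  rw [Equiv.Perm.app_inv] at h1
  have h2 := h0 e
  have h3 := h0 (G.rotB⁻¹ e)
  rw [← angleLift_coe (r := (π - G.rhombusAngle α e) + (π - G.rhombusAngle α (G.rotB⁻¹ e)))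
    (by linarith) (by linarith), increment]
  congr 1
  rw [show (π - G.rhombusAngle α e) + (π - G.rhombusAngle α (G.rotB⁻¹ e)) =
    2 * π - (G.rhombusAngle α e + G.rhombusAngle α (G.rotB⁻¹ e)) by ring, Real.Angle.coe_sub,
    Real.Angle.coe_two_pi, Real.Angle.coe_add, rhombusAngle, rhombusAngle, coe_angleLift,
    coe_angleLift, track_white_inv, ← rotW_rotF, track_black_rotW]
  abel

theorem increment_face_black (h0 : ∀ e, 0 < G.rhombusAngle α e) (hW : ∀ e, orbitSum G.rotW (G.rhombusAngle α) e = 2 * π) (e : E) :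
    increment G.rotF (fun y => α (G.track (.black y))) e =
      (π - G.rhombusAngle α (G.rotF e)) + (π - G.rhombusAngle α (G.rotB⁻¹ e)) := by
  have h1 := add_rotW_le h0 hW (G.rotF e)
  rw [rotW_rotF] at h1
  have h2 := h0 (G.rotF e)
  have h3 := h0 (G.rotB⁻¹ e)
  rw [← angleLift_coe (r := (π - G.rhombusAngle α (G.rotF e)) +
    (π - G.rhombusAngle α (G.rotB⁻¹ e))) (by linarith) (by linarith), increment]
  congr 1
  rw [show (π - G.rhombusAngle α (G.rotF e)) + (π - G.rhombusAngle α (G.rotB⁻¹ e)) =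
    2 * π - (G.rhombusAngle α (G.rotF e) + G.rhombusAngle α (G.rotB⁻¹ e)) by ring,
    Real.Angle.coe_sub, Real.Angle.coe_two_pi, Real.Angle.coe_add, rhombusAngle, rhombusAngle,
    coe_angleLift, coe_angleLift, track_white_inv, ← rotW_rotF, track_black_rotW]
  abel

end Local

/-- At vertices the rhombus angles are increments, up to a shift of the orbit. At a face, the
increments along white and along black strands differ only by shifting one of the two dual angles
around the face, so the single cone condition governs both. -/
theorem mem_Y_iff : α ∈ G.Y ↔ (∀ e, orbitSum G.rotW (G.rhombusAngle α) e = 2 * π) ∧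
    (∀ e, orbitSum G.rotB (G.rhombusAngle α) e = 2 * π) ∧
    (∀ e, orbitSum G.rotF
      (fun y => (π - G.rhombusAngle α y) + (π - G.rhombusAngle α (G.rotB⁻¹ y))) e = 2 * π) ∧
    ∀ e, 0 < G.rhombusAngle α e := by
  constructor
  · intro h
    have h0 : ∀ e, 0 < G.rhombusAngle α e := fun e => by
      rw [rhombusAngle_eq]; exact increment_pos_of_injective (h e).2.1.2.1 (h e).2.1.2.2
    have hW : ∀ e, orbitSum G.rotW (G.rhombusAngle α) e = 2 * π := fun e => by
      rw [orbitSum_rotW]; exact sum_increment (h e).1.1 (h e).1.2.2 (G.finite_white e)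
    have hB : ∀ e, orbitSum G.rotB (G.rhombusAngle α) e = 2 * π := fun e => by
      rw [orbitSum_rotB]; exact sum_increment (h e).2.1.1 (h e).2.1.2.2 (G.finite_black e)
    refine ⟨hW, hB, fun e => ?_, h0⟩
    rw [← funext (increment_face_white h0 hB)]
    exact sum_increment (h e).2.2.2.1 (h e).2.2.2.2 (G.finite_face e)
  · rintro ⟨hW, hB, hF, h0⟩ e
    have hW' := hW e
    have hB' := hB e
    rw [orbitSum_rotW] at hW'
    rw [orbitSum_rotB] at hB'
    have w := cyclicMonotone_of_sum (G.finite_white e) hW'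
    have b := cyclicMonotone_of_sum (G.finite_black e) hB'
    refine ⟨⟨w.1, cyclicInjective_of_pos (G.finite_white e) hW' fun y => ?_, w.2⟩,
      ⟨b.1, cyclicInjective_of_pos (G.finite_black e) hB' fun y => ?_, b.2⟩,
      cyclicMonotone_of_sum (G.finite_face e) ?_, cyclicMonotone_of_sum (G.finite_face e) ?_⟩
    · rw [← rhombusAngle_rotW]; exact h0 _
    · rw [← rhombusAngle_eq]; exact h0 _
    · rw [funext (increment_face_black h0 hW), ← hF e]
      simp only [orbitSum, Finset.sum_add_distrib]
      congr 1
      exact orbitSum_apply G.rotF (fun y => π - G.rhombusAngle α y) e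
    · rw [funext (increment_face_white h0 hB)]; exact hF e

theorem isMinimal_mk_iff : (IsoradialImmersion.mk α fun _ => 0 : G.IsoradialImmersion).IsMinimal ↔
    α ∈ G.Y := by
  have ha : (IsoradialImmersion.mk α fun _ => 0 : G.IsoradialImmersion).angle =
      G.rhombusAngle α := funext fun e => by simp [IsoradialImmersion.angle]
  rw [mem_Y_iff, IsoradialImmersion.IsMinimal, IsoradialImmersion.IsFlat, ha]
  constructor
  · rintro ⟨⟨h1, h2, h3⟩, -, h4⟩
    exact ⟨h1, h2, h3, fun e => (h4 e).1⟩
  · rintro ⟨h1, h2, h3, h4⟩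
    exact ⟨⟨h1, h2, h3⟩, fun _ => rfl, fun e => ⟨h4 e, angleLift_lt _⟩⟩

variable (G) in
theorem setOf_isMinimal_eq : {I : G.IsoradialImmersion | I.IsMinimal} =
    (fun α => IsoradialImmersion.mk α (fun _ => 0)) '' G.Y := by
  ext I
  constructor
  · intro h
    obtain ⟨α, k⟩ := I
    obtain rfl : k = fun _ => 0 := funext h.2.1
    exact ⟨α, isMinimal_mk_iff.1 h, rfl⟩
  · rintro ⟨α, hα, rfl⟩
    exact isMinimal_mk_iff.2 hα

end BipartitePlaneGraph

/-! ### Finite components and shortest bigons -/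

namespace CurveSystem

variable {S C R : Type*} {Γ : CurveSystem S C R}

section
open scoped Classical

variable (Γ) in
/-- Regions that cannot be distinguished by functions that change only across strands of `L`, i.e.
regions in the same component of the complement of `L`. -/
def SameSide (L : Set S) (r r' : R) : Prop :=
  ∀ A : Set R, (∀ s ∉ L, Γ.left s ∈ A ↔ Γ.right s ∈ A) → (r ∈ A ↔ r' ∈ A)

variable (Γ) in
/-- The union of the finite components of the complement of `L`. -/
def inner (L : Set S) : Set R := {r | {r' | Γ.SameSide L r r'}.Finite}

variable {L : Set S}

theorem SameSide.symm {r r' : R} (h : Γ.SameSide L r r') : Γ.SameSide L r' r :=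
  fun A hA => (h A hA).symm

theorem SameSide.trans {r r' r'' : R} (h : Γ.SameSide L r r') (h' : Γ.SameSide L r' r'') :
    Γ.SameSide L r r'' := fun A hA => (h A hA).trans (h' A hA)

theorem sameSide_left_right {s : S} (hs : s ∉ L) : Γ.SameSide L (Γ.left s) (Γ.right s) :=
  fun _ hA => hA s hs

theorem SameSide.class_eq {r r' : R} (h : Γ.SameSide L r r') :
    {x | Γ.SameSide L r x} = {x | Γ.SameSide L r' x} :=
  Set.ext fun _ => ⟨fun hx => h.symm.trans hx, fun hx => h.trans hx⟩

theorem SameSide.mem_inner {r r' : R} (h : Γ.SameSide L r r') :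
    r ∈ Γ.inner L ↔ r' ∈ Γ.inner L := by
  simp only [inner, Set.mem_ofPred_eq, h.class_eq]

theorem SameSide.apply_eq {r r' : R} (h : Γ.SameSide L r r') {σ : R → ℤ}
    (hσ : ∀ s ∉ L, σ (Γ.left s) = σ (Γ.right s)) : σ r = σ r' :=
  ((h {x | σ x = σ r} fun s hs => by simp only [Set.mem_ofPred_eq, hσ s hs]).1 rfl).symm

/-- The indicator function of a component. -/
noncomputable def classInd (Γ : CurveSystem S C R) (L : Set S) (r r' : R) : ℤ :=
  if Γ.SameSide L r r' then 1 else 0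

theorem classInd_eq (r : R) {s : S} (hs : s ∉ L) :
    classInd Γ L r (Γ.left s) = classInd Γ L r (Γ.right s) := by
  simp only [classInd]; congr 1
  exact propext ⟨fun h => h.trans (sameSide_left_right hs),
    fun h => h.trans (sameSide_left_right hs).symm⟩

/-- A component that does not touch `L` is the whole infinite set of regions. So every finite
component is adjacent to a strand of `L`, and there are finitely many of them. -/
theorem finite_inner [Infinite R] (hL : L.Finite) : (Γ.inner L).Finite := by
  have : Γ.inner L ⊆ ⋃ s ∈ L, ({x | x ∈ Γ.inner L ∧ Γ.SameSide L (Γ.left s) x} ∪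
      {x | x ∈ Γ.inner L ∧ Γ.SameSide L (Γ.right s) x}) := by
    intro r hr
    by_cases hc : ∀ s, classInd Γ L r (Γ.left s) = classInd Γ L r (Γ.right s)
    · have h1 := Γ.const _ hc r
      refine absurd (hr.subset fun x _ => ?_) (Set.infinite_univ (α := R))
      have h2 := h1 x
      simp only [classInd] at h2
      rw [if_pos (show Γ.SameSide L r r from fun _ _ => Iff.rfl)] at h2
      by_contra hx
      exact absurd (h2.trans (if_neg hx)) one_ne_zero
    · push Not at hc
      obtain ⟨s, hs⟩ := hc
      have hsL : s ∈ L := by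
        by_contra h; exact hs (classInd_eq r h)
      refine Set.mem_biUnion hsL ?_
      by_cases c : Γ.SameSide L r (Γ.left s)
      · exact Or.inl ⟨hr, c.symm⟩
      · refine Or.inr ⟨hr, ?_⟩
        by_contra c'
        apply hs
        rw [classInd, classInd, if_neg c, if_neg fun h => c' h.symm]
  refine (hL.biUnion fun s _ => Set.Finite.union ?_ ?_).subset this
  · by_cases c : Γ.left s ∈ Γ.inner L
    · exact Set.Finite.subset c fun x hx => hx.2
    · convert Set.finite_empty
      exact Set.eq_empty_of_forall_notMem fun x hx => c (hx.2.mem_inner.2 hx.1)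
  · by_cases c : Γ.right s ∈ Γ.inner L
    · exact Set.Finite.subset c fun x hx => hx.2
    · convert Set.finite_empty
      exact Set.eq_empty_of_forall_notMem fun x hx => c (hx.2.mem_inner.2 hx.1)

/-- The indicator of a component has finitely many jumps. As the surface has one end, an infinite
component is cofinite, and two cofinite components meet. -/
theorem sameSide_of_not_mem_inner [Infinite R] (hL : L.Finite) {r r' : R} (hr : r ∉ Γ.inner L)
    (hr' : r' ∉ Γ.inner L) : Γ.SameSide L r r' := by
  have key : ∀ r, r ∉ Γ.inner L → {x | Γ.SameSide L r x}ᶜ.Finite := fun r hr => by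
    obtain ⟨c, hc⟩ := const_off_finite (Γ := Γ) (h := classInd Γ L r) (hL.subset fun s hs => by
      by_contra h
      exact hs (by rw [jump, classInd_eq r h, sub_self]))
    by_cases h1 : c = 1
    · refine hc.subset fun x hx => ?_
      simp only [Set.mem_compl_iff, Set.mem_ofPred_eq] at hx ⊢
      rw [h1, classInd, if_neg hx]; exact zero_ne_one
    · refine absurd (hc.subset fun x hx => ?_) hr
      simp only [Set.mem_ofPred_eq] at hx ⊢
      rw [classInd, if_pos hx]; exact Ne.symm h1
  obtain ⟨x, hx⟩ := ((key r hr).union (key r' hr')).infinite_compl.nonempty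
  simp only [Set.compl_union, compl_compl, Set.mem_inter_iff, Set.mem_ofPred_eq] at hx
  exact hx.1.trans hx.2.symm

theorem nonempty_inner {σ : R → ℤ} (hfin : (Function.support σ).Finite)
    (hσ : ∀ s ∉ L, σ (Γ.left s) = σ (Γ.right s)) {s : S} (hs : σ (Γ.left s) ≠ σ (Γ.right s)) :
    (Γ.inner L).Nonempty := by
  obtain ⟨r, hr⟩ : ∃ r, σ r ≠ 0 := by
    by_contra hc
    push Not at hc
    exact hs (by rw [hc, hc])
  refine ⟨r, hfin.subset fun x hx => ?_⟩
  rw [Function.mem_support, ← SameSide.apply_eq hx hσ]; exact hr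

variable (Γ) in
/-- A parallel bigon from the crossing at `s` to another one. -/
structure Bigon (s : S) (n m : ℕ) : Prop where
  ne : Γ.go s n ≠ s
  opp_go : Γ.go (Γ.opp s) m = Γ.opp (Γ.go s n)

theorem Bigon.symm {s : S} {n m : ℕ} (h : Γ.Bigon s n m) : Γ.Bigon (Γ.opp s) m n where
  ne e := h.ne (opp_inj.1 (e.symm.trans h.opp_go)).symm
  opp_go := by rw [h.opp_go, Γ.opp_opp, Γ.opp_opp]

variable (Γ) in
/-- The first strands of a curve. -/
def segment (s : S) (n : ℕ) : Set S := {v | ∃ k : ℕ, k < n ∧ Γ.go s k = v}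

theorem finite_segment (s : S) (n : ℕ) : (Γ.segment s n).Finite :=
  ((Set.finite_lt_nat n).image fun k : ℕ => Γ.go s k).subset fun _ ⟨k, hk, h⟩ => ⟨k, hk, h⟩

variable (Γ) in
/-- A shortest bigon. -/
structure MinBigon (s : S) (n m : ℕ) : Prop extends Γ.Bigon s n m where
  le : ∀ {s' n' m'}, Γ.Bigon s' n' m' → n + m ≤ n' + m'
  self : ∀ s k, Γ.go s k ≠ Γ.opp s

theorem exists_minBigon (hs : ∀ s k, Γ.go s k ≠ Γ.opp s) {s : S} {n m : ℕ} (h : Γ.Bigon s n m) :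
    ∃ s n m, Γ.MinBigon s n m := by
  have : ∃ N, ∃ s n m, Γ.Bigon s n m ∧ n + m = N := ⟨_, s, n, m, h, rfl⟩
  obtain ⟨s, n, m, h', hN⟩ := Nat.find_spec this
  refine ⟨s, n, m, h', fun {s' n' m'} h => ?_, hs⟩
  rw [hN]; exact Nat.find_min' this ⟨_, _, _, h, rfl⟩

namespace MinBigon

variable {s : S} {n m : ℕ}

theorem symm (h : Γ.MinBigon s n m) : Γ.MinBigon (Γ.opp s) m n :=
  ⟨h.toBigon.symm, fun h' => by have := h.le h'; omega, h.self⟩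

theorem self' (h : Γ.MinBigon s n m) (t : S) (k l : ℤ) : Γ.go t k ≠ Γ.opp (Γ.go t l) := fun e =>
  h.self (Γ.go t l) (k - l) (by rw [go_go, ← e]; congr 1; ring)

theorem pos (h : Γ.MinBigon s n m) : 0 < n := Nat.pos_of_ne_zero fun h0 => h.ne (by rw [h0]; rfl)

/-- A strand repeated on a side of the bigon would allow a piece to be cut out, leaving a shorter
bigon. The same reason excludes the strand just before the start. -/
theorem end_not_mem (h : Γ.MinBigon s n m) : Γ.go s n ∉ Γ.segment s n := fun ⟨k, hk, e⟩ => by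
  have := h.le (s' := s) (n' := k) (m' := m) ⟨by rw [e]; exact h.ne, by rw [e, h.opp_go]⟩
  omega

theorem start_not_mem (h : Γ.MinBigon s n m) : Γ.next⁻¹ s ∉ Γ.segment s n := fun ⟨k, hk, e⟩ => by
  have e1 : Γ.go s (k + 1 : ℕ) = s := by
    push_cast; rw [← next_go, e, Equiv.Perm.app_inv]
  have e2 : Γ.go s (n - (k + 1) : ℕ) = Γ.go s n := by
    conv_lhs => rw [← e1]
    rw [go_go]; congr 1; omega
  have := h.le (s' := s) (n' := n - (k + 1)) (m' := m)
    ⟨by rw [e2]; exact h.ne, by rw [e2, h.opp_go]⟩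
  omega

theorem not_mem_opp (h : Γ.MinBigon s n m) {v : S} (hv : v ∈ Γ.segment s n) : v ∉ Γ.segment (Γ.opp s) m := by
  rintro ⟨l, hl, e⟩
  obtain ⟨k, hk, rfl⟩ := hv
  refine h.self s (k - l) ?_
  rw [← go_inj (Γ := Γ) (k := l), e, go_go]; congr 1; ring

theorem opp_not_mem (h : Γ.MinBigon s n m) {v : S} (hv : v ∈ Γ.segment s n) : Γ.opp v ∉ Γ.segment s n := by
  rintro ⟨l, hl, e⟩
  obtain ⟨k, hk, rfl⟩ := hv
  exact h.self' s l k e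

/-- A crossing of the two sides strictly before the end would be the end of a shorter bigon. -/
theorem eq_of_opp_mem (h : Γ.MinBigon s n m) {v : S} (hv : v ∈ Γ.segment s n) (hv' : Γ.opp v ∈ Γ.segment (Γ.opp s) m) :
    v = s := by
  obtain ⟨k, hk, rfl⟩ := hv
  obtain ⟨l, hl, e⟩ := hv'
  by_contra hne
  have := h.le (s' := s) (n' := k) (m' := l) ⟨hne, e⟩
  omega

theorem start_mem (h : Γ.MinBigon s n m) : s ∈ Γ.segment s n := ⟨0, h.pos, rfl⟩

theorem pred_end_mem (h : Γ.MinBigon s n m) : Γ.next⁻¹ (Γ.go s n) ∈ Γ.segment s n :=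
  ⟨n - 1, by have := h.pos; omega, by
    rw [inv_go]; congr 1; have := h.pos; omega⟩

theorem mem_of_pred_mem {v : S} (hv : Γ.next⁻¹ v ∈ Γ.segment s n) (hne : v ≠ Γ.go s n) :
    v ∈ Γ.segment s n := by
  obtain ⟨k, hk, e⟩ := hv
  have e1 : Γ.go s (k + 1 : ℕ) = v := by
    push_cast; rw [← next_go, e, Equiv.Perm.app_inv]
  refine ⟨k + 1, lt_of_le_of_ne hk fun hn => hne ?_, e1⟩
  rw [← e1, hn]

theorem pred_mem {v : S} (hv : v ∈ Γ.segment s n) (hne : v ≠ s) :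
    Γ.next⁻¹ v ∈ Γ.segment s n := by
  obtain ⟨k, hk, rfl⟩ := hv
  have : k ≠ 0 := fun h0 => hne (by rw [h0]; rfl)
  exact ⟨k - 1, by omega, by rw [inv_go]; congr 1; omega⟩

/-- A side of the bigon has a source at its start and a sink at its end. The two sides have the same
source and sink crossings, so their difference is a cocycle. -/
theorem indicator_sub (h : Γ.MinBigon s n m) (v : S) : (if v ∈ Γ.segment s n then 1 else 0 : ℤ) -
    (if Γ.next⁻¹ v ∈ Γ.segment s n then 1 else 0) = kron v s - kron v (Γ.go s n) := by
  by_cases c1 : v = s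
  · rw [c1, if_pos h.start_mem, if_neg h.start_not_mem, kron_self, kron_ne h.ne.symm]
  by_cases c2 : v = Γ.go s n
  · rw [c2, if_neg h.end_not_mem, if_pos h.pred_end_mem, kron_self, kron_ne h.ne]
  rw [kron_ne c1, kron_ne c2]
  by_cases c3 : v ∈ Γ.segment s n
  · rw [if_pos c3, if_pos (pred_mem c3 c1)]; rfl
  · rw [if_neg c3, if_neg fun h => c3 (mem_of_pred_mem h c2)]

/-- The boundary of a shortest bigon encloses some region. -/
theorem nonempty_inner (h : Γ.MinBigon s n m) : (Γ.inner (Γ.segment s n ∪ Γ.segment (Γ.opp s) m)).Nonempty := by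
  set f : S → ℤ := fun v => (if v ∈ Γ.segment s n then 1 else 0) -
    (if v ∈ Γ.segment (Γ.opp s) m then 1 else 0) with hf
  have f0 : ∀ v ∉ Γ.segment s n ∪ Γ.segment (Γ.opp s) m, f v = 0 := fun v hv => by
    simp only [Set.mem_union, not_or] at hv
    simp only [hf]; rw [if_neg hv.1, if_neg hv.2]; rfl
  obtain ⟨σ, h1, h2⟩ := Γ.finite_potential f
    (((finite_segment s n).union (finite_segment (Γ.opp s) m)).subset fun v hv => by
      by_contra hc; exact hv (f0 v hc))
    (fun v => by
      have e1 := h.indicator_sub v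
      have e2 := h.symm.indicator_sub v
      have e3 := h.indicator_sub (Γ.opp v)
      have e4 := h.symm.indicator_sub (Γ.opp v)
      rw [kron_opp, kron_opp] at e3 e4
      rw [h.opp_go] at e2 e4
      rw [Γ.opp_opp, Γ.opp_opp] at e4
      simp only [hf]
      linarith)
  refine CurveSystem.nonempty_inner h1 (fun v hv => ?_) (s := s) ?_
  · have := h2 v
    rw [f0 v hv] at this
    exact sub_eq_zero.1 this
  · have := h2 s
    simp only [hf] at this
    rw [if_pos h.start_mem, if_neg (h.not_mem_opp h.start_mem)] at this
    intro e
    rw [left, right] at e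
    omega

/-- At crossings other than its vertices, the boundary of a shortest bigon goes straight. -/
theorem not_mem_of_mem (h : Γ.MinBigon s n m) {v : S} (hv : v ∈ Γ.segment s n ∪ Γ.segment (Γ.opp s) m) (h1 : v ≠ s)
    (h2 : v ≠ Γ.opp s) : Γ.opp v ∉ Γ.segment s n ∪ Γ.segment (Γ.opp s) m := by
  rintro (h' | h') <;> rcases hv with hv | hv
  · exact h.opp_not_mem hv h'
  · exact h2 (h.symm.eq_of_opp_mem hv (by rwa [Γ.opp_opp]))
  · exact h1 (h.eq_of_opp_mem hv h')
  · exact h.symm.opp_not_mem hv h'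

theorem union_of_pred (h : Γ.MinBigon s n m) {v : S} (hv : Γ.next⁻¹ v ∈ Γ.segment s n ∪ Γ.segment (Γ.opp s) m)
    (h1 : v ≠ Γ.go s n) (h2 : v ≠ Γ.opp (Γ.go s n)) :
    v ∈ Γ.segment s n ∪ Γ.segment (Γ.opp s) m := by
  rcases hv with hv | hv
  · exact Or.inl (mem_of_pred_mem hv h1)
  · exact Or.inr (mem_of_pred_mem hv (by rwa [h.opp_go]))

theorem pred_start_not_mem (h : Γ.MinBigon s n m) : Γ.next⁻¹ s ∉ Γ.segment s n ∪ Γ.segment (Γ.opp s) m := by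
  rintro (h' | ⟨k, hk, e⟩)
  · exact h.start_not_mem h'
  · refine h.self s (-(k : ℤ) - 1) ?_
    rw [← go_inj (Γ := Γ) (k := k), e, go_go,
      show -(k : ℤ) - 1 + k = 0 - 1 by ring, ← inv_go, go_zero]

theorem end_not_mem' (h : Γ.MinBigon s n m) : Γ.go s n ∉ Γ.segment s n ∪ Γ.segment (Γ.opp s) m := by
  rintro (h' | ⟨k, hk, e⟩)
  · exact h.end_not_mem h'
  · refine h.self s (n - k) ?_
    rw [← go_inj (Γ := Γ) (k := k), e, go_go]; congr 1; ring

end MinBigon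
end
end CurveSystem

/-! ### Euler's inequality -/

namespace BipartitePlaneGraph

open CurveSystem

variable {E : Type*} {G : BipartitePlaneGraph E}

variable (G) in
/-- The strands on the boundary of regions in `D`. -/
def strandsOf (D : Set G.Region) : Set (Strand E) := {s | G.left s ∈ D ∨ G.right s ∈ D}

variable (G) in
/-- The crossings on the boundary of regions in `D`. -/
def crossingsOf (D : Set G.Region) : Set E := {e | G.left (.white e) ∈ D ∨ G.left (.black e) ∈ D ∨
  G.right (.black e) ∈ D ∨ G.left (.black (G.rotB e)) ∈ D}

theorem finite_strandsOf {D : Set G.Region} (hD : D.Finite) : (G.strandsOf D).Finite := by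
  have h1 := finite_left_set (Γ := G.curves) hD
  have h2 := finite_right_set (Γ := G.curves) hD
  simp only [curves_left, curves_right] at h1 h2
  exact h1.union h2

theorem right_black_rotB (e : E) : G.right (.black (G.rotB e)) = G.right (.black e) :=
  right_black_eq (show G.rotB.SameCycle (G.rotB e) e from ⟨-1, by simp⟩)

theorem left_white_inv (e : E) : G.left (.white (G.rotW⁻¹ e)) = G.left (.white e) :=
  left_white_eq (show G.rotW.SameCycle (G.rotW⁻¹ e) e from ⟨1, by simp⟩)

theorem right_white (e : E) : G.right (.white e) = G.left (.black e) := rfl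

theorem right_white_inv (e : E) : G.right (.white (G.rotW⁻¹ e)) = G.left (.black (G.rotB e)) := by
  rw [right_white]
  exact (left_black_eq (show G.rotF.SameCycle (G.rotB e) (G.rotW⁻¹ e) from
    ⟨1, by rw [zpow_one, rotF_rotB]⟩)).symm

theorem white_mem {D : Set G.Region} {e : E} : .white e ∈ G.strandsOf D ↔
    G.left (.white e) ∈ D ∨ G.left (.black e) ∈ D := Iff.rfl

theorem black_mem {D : Set G.Region} {e : E} : .black e ∈ G.strandsOf D ↔
    G.left (.black e) ∈ D ∨ G.right (.black e) ∈ D := Iff.rfl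

theorem black_rotB_mem {D : Set G.Region} {e : E} : .black (G.rotB e) ∈ G.strandsOf D ↔
    G.left (.black (G.rotB e)) ∈ D ∨ G.right (.black e) ∈ D := by
  rw [black_mem, right_black_rotB]

theorem white_inv_mem {D : Set G.Region} {e : E} : .white (G.rotW⁻¹ e) ∈ G.strandsOf D ↔
    G.left (.white e) ∈ D ∨ G.left (.black (G.rotB e)) ∈ D := by
  rw [white_mem, left_white_inv, ← right_white (G.rotW⁻¹ e), right_white_inv]

theorem finite_crossingsOf {D : Set G.Region} (hD : D.Finite) : (G.crossingsOf D).Finite := by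
  have h := finite_strandsOf hD
  refine ((h.preimage (f := Strand.white) fun _ _ _ _ h => by cases h; rfl).union
    (h.preimage (f := fun e => Strand.black (G.rotB e))
      fun _ _ _ _ h => by simpa using h)).subset fun e he => ?_
  simp only [Set.mem_union, Set.mem_preimage, white_mem, black_rotB_mem]
  simp only [crossingsOf, Set.mem_ofPred_eq] at he
  tauto

open scoped Classical in
/-- The Euler inequality for a finite set of regions with connected complement. -/
theorem ncard_strandsOf_lt {D : Set G.Region} (hD : D.Finite) (hne : D.Nonempty)
    (hout : ∀ σ : G.Region → ℤ, (∀ s ∉ G.strandsOf D, σ (G.left s) = σ (G.right s)) →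
      ∀ r ∉ D, ∀ r' ∉ D, σ r = σ r') (hinf : ∀ σ : G.Region → ℤ, (Function.support σ).Finite →
        ∃ r ∉ D, σ r = 0) :
    (G.strandsOf D).ncard + 1 ≤ D.ncard + (G.crossingsOf D).ncard := by
  have hS := finite_strandsOf hD
  have hV := finite_crossingsOf hD
  have : Fintype D := hD.fintype
  have : Fintype (G.strandsOf D) := hS.fintype
  obtain ⟨e₀, he₀⟩ : (G.crossingsOf D).Nonempty := by
    obtain ⟨r, hr⟩ := hne
    obtain ⟨e, rfl⟩ | ⟨e, rfl⟩ | ⟨e, rfl⟩ := G.exists_region r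
    · exact ⟨e, Or.inl hr⟩
    · exact ⟨e, Or.inr (Or.inr (Or.inl hr))⟩
    · exact ⟨e, Or.inr (Or.inl hr)⟩
  have : Fintype ↥(G.crossingsOf D \ {e₀}) := (hV.subset Set.sdiff_subset).fintype
  let ext : (G.strandsOf D → ℤ) →ₗ[ℤ] (Strand E → ℤ) :=
    { toFun := fun f s => if h : s ∈ G.strandsOf D then f ⟨s, h⟩ else 0
      map_add' := fun f g => funext fun s => by
        simp only [Pi.add_apply]; split_ifs <;> simp
      map_smul' := fun c f => funext fun s => by
        simp only [Pi.smul_apply]; split_ifs <;> simp }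
  let extR : (D → ℤ) →ₗ[ℤ] (G.Region → ℤ) :=
    { toFun := fun f s => if h : s ∈ D then f ⟨s, h⟩ else 0
      map_add' := fun f g => funext fun s => by
        simp only [Pi.add_apply]; split_ifs <;> simp
      map_smul' := fun c f => funext fun s => by
        simp only [Pi.smul_apply]; split_ifs <;> simp }
  let dv : (Strand E → ℤ) →ₗ[ℤ] (E → ℤ) :=
    { toFun := fun f e => f (.white e) + f (.black e) - f (.black (G.rotB e)) -
        f (.white (G.rotW⁻¹ e))
      map_add' := fun f g => funext fun e => by simp only [Pi.add_apply]; ring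
      map_smul' := fun c f => funext fun e => by
        simp only [Pi.smul_apply, smul_eq_mul, RingHom.id_apply]; ring }
  let dd : (G.Region → ℤ) →ₗ[ℤ] (Strand E → ℤ) :=
    { toFun := fun f s => f (G.left s) - f (G.right s)
      map_add' := fun f g => funext fun e => by simp only [Pi.add_apply]; ring
      map_smul' := fun c f => funext fun e => by
        simp only [Pi.smul_apply, smul_eq_mul, RingHom.id_apply]; ring }
  let div : (G.strandsOf D → ℤ) →ₗ[ℤ] (↥(G.crossingsOf D \ {e₀}) → ℤ) :=
    (LinearMap.funLeft ℤ ℤ (Subtype.val)).comp (dv.comp ext)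
  let d : (D → ℤ) →ₗ[ℤ] (G.strandsOf D → ℤ) :=
    (LinearMap.funLeft ℤ ℤ (Subtype.val)).comp (dd.comp extR)
  -- A divergence-free function on the strands of `D` is the boundary of a function on `D`;
  -- rank-nullity then gives the inequality. The crossing `e₀` can be left out because the total
  -- divergence of a finitely supported function is zero.
  have hker : LinearMap.ker div ≤ LinearMap.range d := by
    intro f hf
    have hf1 : ∀ e ∈ G.crossingsOf D, e ≠ e₀ → dv (ext f) e = 0 := fun e he hne =>
      congrFun (LinearMap.mem_ker.1 hf) ⟨e, he, hne⟩
    have ext0 : ∀ s ∉ G.strandsOf D, ext f s = 0 := fun s hs => dif_neg hs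
    have hf2 : ∀ e, e ≠ e₀ → dv (ext f) e = 0 := fun e hne => by
      by_cases he : e ∈ G.crossingsOf D
      · exact hf1 e he hne
      · simp only [crossingsOf, Set.mem_ofPred_eq, not_or] at he
        change ext f (.white e) + ext f (.black e) - ext f (.black (G.rotB e)) -
          ext f (.white (G.rotW⁻¹ e)) = 0
        rw [ext0 _ (by rw [white_mem]; tauto), ext0 _ (by rw [black_mem]; tauto),
          ext0 _ (by rw [black_rotB_mem]; tauto), ext0 _ (by rw [white_inv_mem]; tauto)]; rfl
    have hfin : (Function.support (ext f)).Finite := hS.subset fun s hs => by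
      by_contra h; exact hs (ext0 s h)
    have fw : (Function.support fun e => ext f (.white e)).Finite :=
      hfin.preimage (f := Strand.white) (fun _ _ _ _ h => by cases h; rfl)
    have fb : (Function.support fun e => ext f (.black e)).Finite :=
      hfin.preimage (f := Strand.black) (fun _ _ _ _ h => by cases h; rfl)
    have hf3 : dv (ext f) e₀ = 0 := by
      rw [← finsum_eq_single _ e₀ hf2]
      have e1 : ∀ e, dv (ext f) e = (ext f (.white e) - ext f (.white (G.rotW⁻¹ e))) +
          (ext f (.black e) - ext f (.black (G.rotB e))) := fun e => by
        change ext f (.white e) + ext f (.black e) - ext f (.black (G.rotB e)) -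
          ext f (.white (G.rotW⁻¹ e)) = _
        ring
      have fw' : (Function.support fun e => ext f (.white (G.rotW⁻¹ e))).Finite :=
        fw.preimage (f := (G.rotW⁻¹ : Equiv.Perm E)) (Equiv.injective _).injOn
      have fb' : (Function.support fun e => ext f (.black (G.rotB e))).Finite :=
        fb.preimage (f := G.rotB) G.rotB.injective.injOn
      rw [finsum_congr e1, finsum_add_distrib, finsum_sub_distrib fw fw',
        finsum_sub_distrib fb fb', finsum_comp_equiv (G.rotW⁻¹) (f := fun e => ext f (.white e)),
        finsum_comp_equiv G.rotB (f := fun e => ext f (.black e))]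
      · ring
      · exact (fw.union fw').subset (Function.support_sub _ _)
      · exact (fb.union fb').subset (Function.support_sub _ _)
    have hf4 : ∀ e, dv (ext f) e = 0 := fun e => by
      by_cases h : e = e₀
      · rw [h, hf3]
      · exact hf2 e h
    obtain ⟨σ, h1, h2⟩ := G.exists_finite_potential hfin (by
      rintro (e | e)
      · have := hf4 e
        change ext f (.white e) + ext f (.black e) - ext f (.black (G.rotB e)) -
          ext f (.white (G.rotW⁻¹ e)) = 0 at this
        change _ = ext f (.black (G.rotB e)) + ext f (.white (G.rotW⁻¹ e))
        change ext f (.white e) + ext f (.black e) = _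
        linarith
      · have := hf4 e
        change ext f (.white e) + ext f (.black e) - ext f (.black (G.rotB e)) -
          ext f (.white (G.rotW⁻¹ e)) = 0 at this
        change ext f (.black e) + ext f (.white e) =
          ext f (.white (G.rotW⁻¹ e)) + ext f (.black (G.rotB e))
        linarith)
    have h3 := hout σ fun s hs => by
      have := h2 s; rw [ext0 s hs] at this; exact sub_eq_zero.1 this
    obtain ⟨r₀, hr₀, h0⟩ := hinf σ h1
    -- The potential is constant outside `D` by `hout` and vanishes somewhere there by `hinf`.
    have h4 : ∀ r ∉ D, σ r = 0 := fun r hr => (h3 r hr r₀ hr₀).trans h0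
    have h5 : extR (fun r => σ r) = σ := funext fun r => by
      change (if h : r ∈ D then σ r else 0) = σ r
      split_ifs with h
      · rfl
      · exact (h4 r h).symm
    refine ⟨fun r => σ r, funext fun s => ?_⟩
    change dd (extR fun r => σ r) s.1 = f s
    rw [h5]
    change σ (G.left s) - σ (G.right s) = f s
    rw [h2]
    exact dif_pos s.2
  have r1 := (LinearMap.ker div).finrank_quotient_add_finrank
  rw [div.quotKerEquivRange.finrank_eq] at r1
  have r2 : Module.finrank ℤ (LinearMap.ker div) ≤ Module.finrank ℤ (LinearMap.range d) :=
    Submodule.finrank_mono hker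
  have r3 := LinearMap.finrank_range_le d
  have r4 := Submodule.finrank_le (LinearMap.range div)
  rw [Module.finrank_fintype_fun_eq_card] at r1 r3 r4
  rw [← Set.ncard_sdiff_singleton_add_one he₀ hV]
  rw [← Nat.card_eq_fintype_card, Nat.card_coe_set_eq] at r1 r3 r4
  omega

end BipartitePlaneGraph

/-! ### The Gauss-Bonnet count -/

section
open scoped Classical

theorem finsum_classes {E : Type*} {p : Equiv.Perm E} (hp : ∀ e, e ∈ Function.periodicPts p)
    {g : E → ℝ} {c : ℝ} (hg : ∀ e, orbitSum p g e = c)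
    {D : Set (Quotient (Equiv.Perm.SameCycle.setoid p))} (hD : D.Finite) :
    ∑ᶠ e, (if Quotient.mk _ e ∈ D then g e else 0) = c * D.ncard := by
  have hfib : ∀ x, {e | (Quotient.mk _ e : Quotient (Equiv.Perm.SameCycle.setoid p)) =
      Quotient.mk _ x} = {e | p.SameCycle x e} := fun x => Set.ext fun e =>
    (Quotient.eq (r := Equiv.Perm.SameCycle.setoid p)).trans Equiv.Perm.sameCycle_comm
  have hT : {e | (Quotient.mk _ e : Quotient (Equiv.Perm.SameCycle.setoid p)) ∈ D}.Finite := by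
    refine hD.preimage' fun v _ => ?_
    obtain ⟨x, rfl⟩ := Quotient.exists_rep v
    exact (finite_sameCycle (hp x)).subset (hfib x).subset
  rw [finsum_eq_sum_of_support_subset (s := hT.toFinset) _ fun e he => ?_]
  · rw [← Finset.sum_fiberwise_of_maps_to (t := hD.toFinset) (g := fun e =>
      (Quotient.mk _ e : Quotient (Equiv.Perm.SameCycle.setoid p))) (fun e he => by simpa using he)]
    rw [Finset.sum_congr rfl fun v hv => ?_, Finset.sum_const, nsmul_eq_mul, mul_comm,
      Set.ncard_eq_toFinset_card D hD]
    obtain ⟨x, rfl⟩ := Quotient.exists_rep v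
    have hx : Quotient.mk _ x ∈ D := by simpa using hv
    rw [← hg x, orbitSum, ← Finset.sum_image (s := Finset.range (Function.minimalPeriod p x))
      (g := fun i => (p ^ i) x) (f := g)]
    · have hset : {e ∈ hT.toFinset | (Quotient.mk _ e :
          Quotient (Equiv.Perm.SameCycle.setoid p)) = Quotient.mk _ x} =
          Finset.image (fun i => (p ^ i) x) (Finset.range (Function.minimalPeriod p x)) := by
        ext e
        simp only [Finset.mem_filter, Set.Finite.mem_toFinset, Set.mem_ofPred_eq, Finset.mem_image,
          Finset.mem_range]
        constructor
        · rintro ⟨-, h⟩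
          exact exists_pow_of_sameCycle (hp x) ((hfib x).subset h)
        · rintro ⟨i, -, rfl⟩
          have : (Quotient.mk _ ((p ^ i) x) : Quotient (Equiv.Perm.SameCycle.setoid p)) =
            Quotient.mk _ x := (hfib x).symm.subset ⟨i, rfl⟩
          exact ⟨by rw [this]; exact hx, this⟩
      rw [← hset]
      refine Finset.sum_congr rfl fun e he => ?_
      rw [if_pos]
      simpa using (Finset.mem_filter.1 he).1
    · intro i hi j hj h
      simp only [Equiv.Perm.coe_pow] at h
      exact (Function.iterate_injOn_Iio_minimalPeriod (f := p) (x := x))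
        (by simpa using hi) (by simpa using hj) h
  · simp only [Function.mem_support, ne_eq, ite_eq_right_iff, Classical.not_imp] at he
    simpa using he.1

theorem ncard_sum {A B : Type*} {D : Set (A ⊕ B)} (hD : D.Finite) :
    D.ncard = (Sum.inl ⁻¹' D).ncard + (Sum.inr ⁻¹' D).ncard := by
  rw [← Set.ncard_image_of_injective (Sum.inl ⁻¹' D) (Sum.inl_injective (β := B)),
    ← Set.ncard_image_of_injective (Sum.inr ⁻¹' D) (Sum.inr_injective (α := A)),
    ← Set.ncard_union_eq ?_ ((hD.preimage Sum.inl_injective.injOn).image _)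
      ((hD.preimage Sum.inr_injective.injOn).image _)]
  · congr 1
    ext (a | b) <;> simp
  · rw [Set.disjoint_left]
    rintro _ ⟨a, -, rfl⟩ ⟨b, -, h⟩
    cases h

/-- The truth value of a proposition. -/
noncomputable def truth (P : Prop) : ℝ := if P then 1 else 0

/-- The contribution of a crossing to `2π` times (the number of strands minus the number of
crossings minus the number of regions). -/
noncomputable def excess (w f b g : Prop) (θ : ℝ) : ℝ :=
  π * (truth (w ∨ f) + truth (f ∨ b) + truth (g ∨ b) + truth (w ∨ g)) -
    2 * π * truth (w ∨ f ∨ b ∨ g) -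
    ((if w then θ else 0) + (if b then θ else 0) + (if f then π - θ else 0) +
      (if g then π - θ else 0))

/-- The hypothesis says that membership does not change across one of the two curves at the
crossing. Regular boundary crossings, interior crossings and exterior crossings are all of this
kind. -/
theorem excess_eq_zero {w f b g : Prop} {θ : ℝ} (h : (f ↔ b) ∧ (w ↔ g) ∨ (w ↔ f) ∧ (g ↔ b)) :
    excess w f b g θ = 0 := by
  by_cases hw : w <;> by_cases hf : f <;> by_cases hb : b <;> by_cases hg : g <;>
    simp only [hw, hf, hb, hg, excess, truth] at h ⊢ <;> simp at h ⊢ <;> ring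

/-- At a vertex of a bigon three of the four regions agree and the fourth one, a face, may differ.
The value is then `θ - π` or `π - θ`, or `0` if all agree. -/
theorem neg_pi_lt_excess {w f b g : Prop} {θ : ℝ} (h0 : 0 < θ) (h1 : θ < 2 * π)
    (h : (g ↔ b) ∧ (w ↔ g) ∨ (w ↔ f) ∧ (f ↔ b)) : -π < excess w f b g θ := by
  by_cases hw : w <;> by_cases hf : f <;> by_cases hb : b <;> by_cases hg : g <;>
    simp only [hw, hf, hb, hg, excess, truth] at h ⊢ <;> simp at h ⊢ <;> linarith

end

namespace BipartitePlaneGraph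

open CurveSystem

variable {E : Type*} {G : BipartitePlaneGraph E}

section Counting
open scoped Classical

variable {D : Set G.Region}

theorem ncard_strandsOf (hD : D.Finite) : (G.strandsOf D).ncard =
    {e | .white e ∈ G.strandsOf D}.ncard + {e | .black e ∈ G.strandsOf D}.ncard := by
  have hw : Function.Injective (Strand.white : E → Strand E) := fun _ _ h => by cases h; rfl
  have hb : Function.Injective (Strand.black : E → Strand E) := fun _ _ h => by cases h; rfl
  have hS1 : {e | .white e ∈ G.strandsOf D}.Finite := (finite_strandsOf hD).preimage hw.injOn
  have hS2 : {e | .black e ∈ G.strandsOf D}.Finite := (finite_strandsOf hD).preimage hb.injOn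
  rw [← Set.ncard_image_of_injective _ hw, ← Set.ncard_image_of_injective _ hb,
    ← Set.ncard_union_eq ?_ (Set.Finite.image _ hS1) (Set.Finite.image _ hS2)]
  · congr 1
    ext (e | e) <;> simp
  · rw [Set.disjoint_left]
    rintro _ ⟨a, -, rfl⟩ ⟨b, -, h⟩
    cases h

theorem ncard_preimage_perm (p : Equiv.Perm E) (A : Set E) : {e | p e ∈ A}.ncard = A.ncard :=
  Set.ncard_preimage_of_injective_subset_range p.injective (by simp)

/-- Every strand contributes `π` at each of its two ends. By flatness the angles at each vertex and
the dual angles at each face of `D` add up to `2π`, so the angle terms count the regions. -/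
theorem sum_excess (hD : D.Finite) {θ : E → ℝ} (hW : ∀ e, orbitSum G.rotW θ e = 2 * π)
    (hB : ∀ e, orbitSum G.rotB θ e = 2 * π)
    (hF : ∀ e, orbitSum G.rotF (fun y => (π - θ y) + (π - θ (G.rotB⁻¹ y))) e = 2 * π) :
    ∑ e ∈ (finite_crossingsOf hD).toFinset, excess (G.left (.white e) ∈ D) (G.left (.black e) ∈ D)
      (G.right (.black e) ∈ D) (G.left (.black (G.rotB e)) ∈ D) (θ e) =
    2 * π * ((G.strandsOf D).ncard - (G.crossingsOf D).ncard - D.ncard) := by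
  have hV : ∀ {e}, e ∈ (finite_crossingsOf hD).toFinset ↔ G.left (.white e) ∈ D ∨
    G.left (.black e) ∈ D ∨ G.right (.black e) ∈ D ∨ G.left (.black (G.rotB e)) ∈ D :=
    (finite_crossingsOf hD).mem_toFinset
  set T := (finite_crossingsOf hD).toFinset with hT
  have count : ∀ P : E → Prop, (∀ e, P e → e ∈ T) →
      ∑ e ∈ T, truth (P e) = {e | P e}.ncard := fun P hP => by
    simp only [truth]
    rw [Finset.sum_ite, Finset.sum_const_zero, add_zero, Finset.sum_const, nsmul_eq_mul, mul_one,
      ← Set.ncard_coe_finset]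
    congr 2
    ext e
    simp only [Finset.coe_filter, Set.mem_ofPred_eq]
    exact ⟨fun h => h.2, fun h => ⟨hP e h, h⟩⟩
  have c1 := count (fun e => G.left (.white e) ∈ D ∨ G.left (.black e) ∈ D)
    (fun e he => hV.2 (by tauto))
  have c2 := count (fun e => G.left (.black e) ∈ D ∨ G.right (.black e) ∈ D)
    (fun e he => hV.2 (by tauto))
  have c3 := count (fun e => G.left (.black (G.rotB e)) ∈ D ∨ G.right (.black e) ∈ D)
    (fun e he => hV.2 (by tauto))
  have c4 := count (fun e => G.left (.white e) ∈ D ∨ G.left (.black (G.rotB e)) ∈ D)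
    (fun e he => hV.2 (by tauto))
  have c5 := count (fun e => G.left (.white e) ∈ D ∨
    G.left (.black e) ∈ D ∨ G.right (.black e) ∈ D ∨ G.left (.black (G.rotB e)) ∈ D)
    (fun e he => hV.2 he)
  -- The strands are counted here at their ends; translation by a rotation identifies this with the
  -- count at their starts.
  have k3 : {e | G.left (.black (G.rotB e)) ∈ D ∨ G.right (.black e) ∈ D}.ncard =
      {e | .black e ∈ G.strandsOf D}.ncard := by
    rw [← ncard_preimage_perm G.rotB {e | .black e ∈ G.strandsOf D}]
    congr 1
    ext e
    exact (black_rotB_mem (G := G)).symm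
  have k4 : {e | G.left (.white e) ∈ D ∨ G.left (.black (G.rotB e)) ∈ D}.ncard =
      {e | .white e ∈ G.strandsOf D}.ncard := by
    rw [← ncard_preimage_perm G.rotW⁻¹ {e | .white e ∈ G.strandsOf D}]
    congr 1
    ext e
    exact (white_inv_mem (G := G)).symm
  have kS := ncard_strandsOf hD
  have toT : ∀ (P : E → Prop) (h : E → ℝ), (∀ e, P e → e ∈ T) →
      ∑ᶠ e, (if P e then h e else 0) = ∑ e ∈ T, (if P e then h e else 0) := fun P h hP =>
    finsum_eq_sum_of_support_subset _ fun e he => by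
      simp only [Function.mem_support, ne_eq, ite_eq_right_iff, Classical.not_imp] at he
      exact hP e he.1
  have hD1 : (Sum.inl ⁻¹' D).Finite := hD.preimage Sum.inl_injective.injOn
  set DW : Set G.WhiteVertex := {v | (.inl (.inl v) : G.Region) ∈ D}
  set DB : Set G.BlackVertex := {v | (.inl (.inr v) : G.Region) ∈ D}
  set DF : Set G.Face := {v | (.inr v : G.Region) ∈ D}
  have kD : D.ncard = DW.ncard + DB.ncard + DF.ncard :=
    (ncard_sum hD).trans (congrArg (· + DF.ncard) (ncard_sum hD1))
  have hDW : DW.Finite := hD.preimage (f := fun v : G.WhiteVertex => (.inl (.inl v) : G.Region))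
    fun _ _ _ _ h => Sum.inl_injective (Sum.inl_injective h)
  have hDB : DB.Finite := hD.preimage (f := fun v : G.BlackVertex => (.inl (.inr v) : G.Region))
    fun _ _ _ _ h => Sum.inr_injective (Sum.inl_injective h)
  have hDF : DF.Finite := hD.preimage (f := fun v : G.Face => (.inr v : G.Region))
    fun _ _ _ _ h => Sum.inr_injective h
  have d1 : _ = 2 * π * (DW.ncard : ℝ) := finsum_classes G.finite_white hW hDW
  have d2 : _ = 2 * π * (DB.ncard : ℝ) := finsum_classes G.finite_black hB hDB
  have d3 : _ = 2 * π * (DF.ncard : ℝ) := finsum_classes (p := G.rotF) G.finite_face hF hDF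
  change ∑ᶠ e, (if G.left (.white e) ∈ D then θ e else 0) = _ at d1
  change ∑ᶠ e, (if G.right (.black e) ∈ D then θ e else 0) = _ at d2
  change ∑ᶠ e, (if G.left (.black e) ∈ D then (π - θ e) + (π - θ (G.rotB⁻¹ e)) else 0) = _ at d3
  have fin : ∀ h : E → ℝ, (Function.support fun e =>
      if G.left (.black e) ∈ D then h e else 0).Finite := fun h =>
    T.finite_toSet.subset fun e he => by
      simp only [Function.mem_support, ne_eq, ite_eq_right_iff, Classical.not_imp] at he
      exact hV.2 (by tauto)
  have d3' : ∑ᶠ e, (if G.left (.black e) ∈ D then (π - θ e) + (π - θ (G.rotB⁻¹ e)) else 0) =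
      ∑ᶠ e, (if G.left (.black e) ∈ D then π - θ e else 0) +
      ∑ᶠ e, (if G.left (.black (G.rotB e)) ∈ D then π - θ e else 0) := by
    rw [← finsum_comp_equiv (G.rotB⁻¹)
      (f := fun e => if G.left (.black (G.rotB e)) ∈ D then π - θ e else 0)]
    simp only [Equiv.Perm.app_inv]
    rw [← finsum_add_distrib (fin _) (fin _)]
    refine finsum_congr fun e => ?_
    split_ifs <;> simp
  rw [d3', toT _ _ (fun e he => hV.2 (by tauto)), toT _ _ (fun e he => hV.2 (by tauto))] at d3
  rw [toT _ _ (fun e he => hV.2 (by tauto))] at d1 d2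
  simp only [excess, Finset.sum_sub_distrib, Finset.sum_add_distrib, ← Finset.mul_sum]
  rw [c1, c2, c3, c4, c5, k3, k4, kS, kD]
  have e5 : {e | G.left (.white e) ∈ D ∨ G.left (.black e) ∈ D ∨ G.right (.black e) ∈ D ∨
    G.left (.black (G.rotB e)) ∈ D} = G.crossingsOf D := rfl
  have e1 : {e | G.left (.white e) ∈ D ∨ G.left (.black e) ∈ D} =
    {e | .white e ∈ G.strandsOf D} := rfl
  have e2 : {e | G.left (.black e) ∈ D ∨ G.right (.black e) ∈ D} =
    {e | .black e ∈ G.strandsOf D} := rfl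
  rw [e5, e1, e2]
  push_cast
  linarith

end Counting
end BipartitePlaneGraph

/-! ### Excluding bigons -/

namespace BipartitePlaneGraph

open CurveSystem

variable {E : Type*} {G : BipartitePlaneGraph E} {α : G.TrainTrack → Real.Angle}

theorem infinite_region (G : BipartitePlaneGraph E) : Infinite G.Region := by
  have := G.infinite
  by_contra hc
  rw [not_infinite_iff_finite] at hc
  have h := finite_left_set (Γ := G.curves) (Set.finite_univ (α := G.Region))
  have : Infinite (Strand E) :=
    Infinite.of_injective Strand.white fun _ _ h => by cases h; rfl
  exact Set.infinite_univ (h.subset fun s _ => Set.mem_univ _)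

theorem ncard_inner_lt {L : Set (Strand E)} (hL : L.Finite) (hne : (G.curves.inner L).Nonempty) :
    (G.strandsOf (G.curves.inner L)).ncard + 1 ≤
      (G.curves.inner L).ncard + (G.crossingsOf (G.curves.inner L)).ncard := by
  classical
  have := G.infinite_region
  have hfin : (G.curves.inner L).Finite := finite_inner hL
  refine ncard_strandsOf_lt hfin hne (fun σ hσ r hr r' hr' => ?_) fun σ hσ => ?_
  -- Resetting `σ` to zero on the inner regions leaves jumps only across strands of `L`, so it is
  -- constant on the outer component.
  · have h := (sameSide_of_not_mem_inner hL hr hr').apply_eq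
      (σ := fun r => if r ∈ G.curves.inner L then 0 else σ r) fun s hs => by
        have hm := (sameSide_left_right (Γ := G.curves) hs).mem_inner
        simp only [curves_left, curves_right] at hm ⊢
        by_cases c : G.left s ∈ G.curves.inner L
        · rw [if_pos c, if_pos (hm.1 c)]
        · rw [if_neg c, if_neg fun h => c (hm.2 h)]
          exact hσ s (by rintro (h | h); exacts [c h, c (hm.2 h)])
    simpa only [if_neg hr, if_neg hr'] using h
  · obtain ⟨r, hr⟩ := (hfin.union hσ).infinite_compl.nonempty
    simp only [Set.compl_union, Set.mem_inter_iff, Set.mem_compl_iff, Function.mem_support,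
      not_not] at hr
    exact ⟨r, hr⟩

/-- The boundary of the enclosed set `D` passes straight through every crossing except the two
vertices of the bigon. The total excess is therefore more than `-2π`, against Euler's inequality. -/
theorem not_minBigon_of_mem_Y (hα : α ∈ G.Y) {s : Strand E} {n m : ℕ}
    (h : G.curves.MinBigon s n m) : False := by
  classical
  obtain ⟨hW, hB, hF, h0⟩ := mem_Y_iff.1 hα
  set L := G.curves.segment s n ∪ G.curves.segment (G.curves.opp s) m with hLdef
  have hL : L.Finite := (finite_segment s n).union (finite_segment _ m)
  have := G.infinite_region
  set D := G.curves.inner L with hDdef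
  have hD : D.Finite := finite_inner hL
  have hlt := ncard_inner_lt hL h.nonempty_inner
  have hsum := sum_excess hD hW hB hF
  have mem_iff : ∀ v ∉ L, (G.left v ∈ D ↔ G.right v ∈ D) := fun v hv => by
    have := (sameSide_left_right (Γ := G.curves) hv).mem_inner
    rwa [curves_left, curves_right] at this
  have r1 : ∀ {e}, .white e ∉ L → (G.left (.white e) ∈ D ↔ G.left (.black e) ∈ D) :=
    fun he => mem_iff _ he
  have r2 : ∀ {e}, .black e ∉ L → (G.left (.black e) ∈ D ↔ G.right (.black e) ∈ D) :=
    fun he => mem_iff _ he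
  have r3 : ∀ {e}, G.next⁻¹ (.white e) ∉ L →
      (G.left (.black (G.rotB e)) ∈ D ↔ G.right (.black e) ∈ D) := fun he => by
    have := mem_iff _ he
    rwa [inv_white, right_black_rotB] at this
  have r4 : ∀ {e}, G.next⁻¹ (.black e) ∉ L →
      (G.left (.white e) ∈ D ↔ G.left (.black (G.rotB e)) ∈ D) := fun he => by
    have := mem_iff _ he
    rwa [inv_black, left_white_inv, right_white_inv] at this
  have hsymm : G.curves.segment (G.curves.opp s) m ∪
      G.curves.segment (G.curves.opp (G.curves.opp s)) n = L := by
    rw [G.curves.opp_opp, Set.union_comm]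
  have hend := h.symm.end_not_mem'
  have hstart := h.symm.pred_start_not_mem
  rw [hsymm, h.opp_go] at hend
  rw [hsymm] at hstart
  set Φ : E → ℝ := fun e => excess (G.left (.white e) ∈ D) (G.left (.black e) ∈ D)
    (G.right (.black e) ∈ D) (G.left (.black (G.rotB e)) ∈ D) (G.rhombusAngle α e) with hΦ
  set z := G.curves.go s n with hz
  have hxy : s.source ≠ z.source := fun e => by
    rcases eq_or_eq_opp e with e | e
    · exact h.ne e.symm
    · exact h.self s n (by rw [← hz]; exact opp_eq_iff.1 e.symm)
  have pure : ∀ v : Strand E, v ∉ L → G.curves.opp v ∉ L →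
      (G.left (.white v.source) ∈ D ↔ G.left (.black v.source) ∈ D) ∧
      (G.left (.black v.source) ∈ D ↔ G.right (.black v.source) ∈ D) := by
    rintro (e | e) h1 h2
    · exact ⟨r1 h1, r2 h2⟩
    · exact ⟨r1 h2, r2 h1⟩
  have pure' : ∀ v : Strand E, G.next⁻¹ v ∉ L → G.next⁻¹ (G.curves.opp v) ∉ L →
      (G.left (.black (G.rotB v.source)) ∈ D ↔ G.right (.black v.source) ∈ D) ∧
      (G.left (.white v.source) ∈ D ↔ G.left (.black (G.rotB v.source)) ∈ D) := by
    rintro (e | e) h1 h2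
    · exact ⟨r3 h1, r4 h2⟩
    · exact ⟨r3 h2, r4 h1⟩
  -- At the initial vertex neither incoming strand belongs to the bigon, at the final vertex neither
  -- outgoing one does; this makes the relevant three regions agree.
  have bx : -π < Φ s.source := neg_pi_lt_excess (h0 _) (angleLift_lt _)
    (Or.inl (pure' s h.pred_start_not_mem hstart))
  have bz : -π < Φ z.source := neg_pi_lt_excess (h0 _) (angleLift_lt _)
    (Or.inr (pure z h.end_not_mem' hend))
  -- Elsewhere at most one of the two curves carries the boundary, and if its outgoing strand is not
  -- on the boundary, neither is the incoming one.
  have b0 : ∀ e, e ≠ s.source → e ≠ z.source → Φ e = 0 := fun e hx hy => by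
    have ns : ∀ v : Strand E, v.source = e → v ≠ s ∧ v ≠ G.curves.opp s ∧ v ≠ z ∧
        v ≠ G.curves.opp z := fun v hv =>
      ⟨fun h => hx (by rw [← hv, h]), fun h => hx (by rw [← hv, h]; exact source_opp s),
        fun h => hy (by rw [← hv, h]), fun h => hy (by rw [← hv, h]; exact source_opp z)⟩
    obtain ⟨w1, w2, w3, w4⟩ := ns (.white e) rfl
    obtain ⟨b1, b2, b3, b4⟩ := ns (.black e) rfl
    have pw : .white e ∉ L → G.next⁻¹ (.white e) ∉ L := fun hn hp => hn (h.union_of_pred hp w3 w4)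
    have pb : .black e ∉ L → G.next⁻¹ (.black e) ∉ L := fun hn hp => hn (h.union_of_pred hp b3 b4)
    refine excess_eq_zero ?_
    by_cases c : .white e ∈ L
    · have : .black e ∉ L := h.not_mem_of_mem c w1 w2
      exact Or.inl ⟨r2 this, r4 (pb this)⟩
    · exact Or.inr ⟨r1 c, r3 (pw c)⟩
  have hT : ∀ e ∉ (finite_crossingsOf hD).toFinset, Φ e = 0 := fun e he => by
    rw [Set.Finite.mem_toFinset] at he
    simp only [crossingsOf, Set.mem_ofPred_eq, not_or] at he
    exact excess_eq_zero (Or.inl ⟨iff_of_false he.2.1 he.2.2.1, iff_of_false he.1 he.2.2.2⟩)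
  have e1 : ∑ e ∈ (finite_crossingsOf hD).toFinset, Φ e = ∑ e ∈ ({s.source, z.source} : Finset E), Φ e := by
    rw [Finset.sum_subset Finset.subset_union_left (s₂ := _ ∪ {s.source, z.source})
      fun e _ he => hT e he]
    refine (Finset.sum_subset Finset.subset_union_right fun e _ he => ?_).symm
    simp only [Finset.mem_insert, Finset.mem_singleton, not_or] at he
    exact b0 e he.1 he.2
  rw [Finset.sum_pair hxy] at e1
  rw [e1] at hsum
  have hlt' : ((G.strandsOf D).ncard : ℝ) + 1 ≤ D.ncard + (G.crossingsOf D).ncard := by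
    exact_mod_cast hlt
  have hpi := Real.pi_pos
  have := mul_le_mul_of_nonneg_left
    (show ((G.strandsOf D).ncard - (G.crossingsOf D).ncard - D.ncard : ℝ) ≤ -1 by linarith)
    (show (0 : ℝ) ≤ 2 * π by linarith)
  linarith

/-- Graphs that admit a minimal immersion are minimal. -/
theorem isMinimal_of_mem_Y (hα : α ∈ G.Y) : G.IsMinimal := by
  have hself : ¬ G.HasSelfIntersection := fun ⟨e, he⟩ => by
    have := (mem_Y_iff.1 hα).2.2.2 e
    rw [rhombusAngle, he, sub_self, angleLift_eq_zero.2 rfl] at this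
    exact lt_irrefl _ this
  have hs : ∀ s k, G.curves.go s k ≠ G.curves.opp s := fun s k e =>
    hself (hasSelfIntersection_of_opp (track_eq_iff.2 ⟨k, e⟩))
  refine ⟨hself, ?_⟩
  rintro ⟨t₁, t₂, x, y, hne, hxy, ⟨s, rfl, rfl, n, rfl⟩, ⟨s', rfl, h', m, hm⟩⟩
  obtain rfl : s' = oppStrand s := by
    rcases eq_or_eq_opp h' with rfl | h
    · exact absurd rfl hne
    · exact h
  have hb : G.curves.Bigon s n m := by
    constructor
    · intro e
      apply hxy
      conv_lhs => rw [← e]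
      simp only [CurveSystem.go, zpow_natCast]; rfl
    · rcases eq_or_eq_opp hm with e | e
      · refine absurd ?_ hne
        have h1 := track_go (G := G) s n
        have h2 := track_go (G := G) (oppStrand s) m
        simp only [CurveSystem.go, zpow_natCast] at h1 h2
        rw [← h1, ← h2]
        exact congrArg G.track e.symm
      · simp only [CurveSystem.go, zpow_natCast]; exact e
  obtain ⟨s, n, m, h⟩ := exists_minBigon hs hb
  exact not_minBigon_of_mem_Y hα h

end BipartitePlaneGraph

theorem theorem3p3 {E : Type*} (G : BipartitePlaneGraph E) :
    ((∃ I : G.IsoradialImmersion, I.IsMinimal) ↔ G.IsMinimal) ∧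
    {I : G.IsoradialImmersion | I.IsMinimal} =
      (fun α => BipartitePlaneGraph.IsoradialImmersion.mk α (fun _ => 0)) '' G.Y ∧
    (G.IsMinimal → G.X.Nonempty ∧ G.X ⊆ G.Y) := by
  refine ⟨⟨fun ⟨I, hI⟩ => ?_, fun h => ?_⟩, G.setOf_isMinimal_eq,
    fun h => ⟨h.nonempty_X, h.X_subset_Y⟩⟩
  · obtain ⟨α, hα, -⟩ := G.setOf_isMinimal_eq.subset hI
    exact BipartitePlaneGraph.isMinimal_of_mem_Y hα
  · obtain ⟨α, hα⟩ := h.nonempty_X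
    exact ⟨_, BipartitePlaneGraph.isMinimal_mk_iff.2 (h.X_subset_Y hα)⟩
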